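/- All vector spaces are over $\mathbf C$. A \emph{bornological space} is a complex vector space with a convex vector bornology. A space is \emph{discrete} if its bounded sets are the bounded subsets of finite-dimensional subspaces, and \emph{complete} if every bounded set is bounded in the image of a Banach space under an injective bounded linear map. Sums, products, subspaces, quotients and tensor products carry the usual bornologies. \textbf{Geometric vertex algebras.} Let $\mathcal V=\bigoplus_{k\in\mathbf Z}\mathcal V_k$ be a $\mathbf Z$-graded vector space (each $\mathcal V_k$ discrete), $\overline{\mathcal V}=\prod_k\mathcal V_k$, $p_k$ the projection to degree $k$, and let $\lambda\in\mathbf C^\times$ act on $\mathcal V_k$ by $\lambda^k$. For $U\subseteq\mathbf C$ let $U^m\setminus\Delta$ be the set of $m$-tuples of distinct points of $U$. A \emph{geometric vertex algebra} structure on $\mathcal V$ consists of multilinear maps $(a_1,\dots,a_m)\mapsto \mu(a)$, $m\ge 0$, from $\mathcal V^m$ to functions $\mathbf C^m\setminus\Delta\to\overline{\mathcal V}$, written $\mu(a)(z)=\mu(a_1,z_1,\dots,a_m,z_m)$, such that: (holomorphicity) each $p_k\mu(a)$ is a holomorphic function into a finite-dimensional subspace of $\mathcal V_k$; (permutation invariance)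 $\mu(a_{\sigma(1)},z_{\sigma(1)},\dots,a_{\sigma(m)},z_{\sigma(m)})=\mu(a_1,z_1,\dots,a_m,z_m)$; (insertion at zero) $\mu(a,0)=a$; (equivariance) $\mu(\lambda a_1,\lambda z_1,\dots,\lambda a_m,\lambda z_m)=\lambda\,\mu(a_1,z_1,\dots,a_m,z_m)$ for $\lambda\in\mathbf C^\times$; (associativity) for $m,n\ge 0$, on the set of $(z,w)\in(\mathbf C^{m+1}\setminus\Delta)\times(\mathbf C^n\setminus\Delta)$ with $|w_j|<|z_i-z_{m+1}|$ for all $i\le m$, $j\le n$, the series $\sum_{k\in\mathbf Z}\mu(a_1,z_1,\dots,a_m,z_m,p_k\mu(b_1,w_1,\dots,b_n,w_n),z_{m+1})$ converges, in each degree, absolutely and uniformly on compact subsets inside a finite-dimensional subspace (depending on the compact subset), to $\mu(a_1,z_1,\dots,a_m,z_m,b_1,w_1+z_{m+1},\dots,b_n,w_n+z_{m+1})$; (meromorphicity) for all $a,b\in\mathcal V$ there is $N\ge 0$ such that in each degree $z^N\mu(a,z,b,0)$ extends to a holomorphic function of $z\in\mathbf C$ with values in a finite-dimensional subspace. An isomorphism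 of geometric vertex algebras is a degreewise linear isomorphism commuting with all the maps $\mu$. \textbf{The prefactorization algebra $\mathbf F\mathcal V$.} Let $\mathcal V$ be a geometric vertex algebra. For open $X\subseteq\mathbf C^m$ let $\mathcal O'(X)$ be the space of linear functionals on $\mathcal O(X)$ continuous for uniform convergence on compact subsets; its bounded sets are the sets of functionals with a common bound $|\alpha(f)|\le C\sup_K|f|$, $K\subseteq X$ compact. For $U\subseteq\mathbf C$ open put $\mathbf E\mathcal V(U)=\bigoplus_{m\ge0}\bigl(\mathcal O'(U^m\setminus\Delta)\otimes\mathcal V^{\otimes m}\bigr)_{\Sigma_m}$. For disjoint open $U,U'\subseteq W$ the multiplication is $[\alpha\otimes a]\cdot[\beta\otimes b]=[\alpha\beta\otimes a\otimes b]\in\mathbf E\mathcal V(W)$ with $\alpha\beta(f)=\alpha(z\mapsto\beta(w\mapsto f(z,w)))$; the unit is $1\in\mathbf E\mathcal V(\emptyset)$ (in the summand $m=0$); an affine map $g(z)=\lambda z+t$ acts by $\sigma_g[\alpha\otimes a_1\otimes\cdots\otimes a_m]=[g_*\alpha\otimes\lambda a_1\otimes\cdots\otimes\lambda a_m]$. Let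 $\mathrm{ev}_U:\mathbf E\mathcal V(U)\to\overline{\mathcal V}$, $[\alpha\otimes a]\mapsto\alpha(\mu(a))$, and let $\mathbf F\mathcal V(U)$ be the quotient of $\mathbf E\mathcal V(U)$ by the closure (for the topology whose closed sets are the sets closed under bornological convergence of sequences) of the span of all products $r\cdot e$ with $r\in\ker(\mathrm{ev}_d)$ and $e\in\mathbf E\mathcal V(W)$, where $d\subseteq U$ is a round open disc and $W\subseteq U$ is open and disjoint from $d$. With the induced operations $\mathbf F\mathcal V$ is a prefactorization algebra on $\mathbf C$, invariant under $\mathbf C^\times\ltimes\mathbf C$. \textbf{The space $\mathbf VF$.} Let $F$ be a $\mathbf C^\times\ltimes\mathbf C$-invariant prefactorization algebra on $\mathbf C$ with values in bornological spaces. Write $M$ for its multiplication and extension maps and $\sigma_g$ for its action maps. For $0<|q|<1$ let $\rho(q)$ be the endomorphism of $F(B_r(0))$ obtained by composing $\sigma_q:F(B_r(0))\to F(qB_r(0))$ with the extension map to $F(B_r(0))$. Let $F(0)=\lim_{r>0}F(B_r(0))$ with projections $\pi_r$, let $F(0)_k$ be its subspace on which $\rho(q)=q^k$ for all $0<|q|<1$,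 and let $\mathbf VF=\bigoplus_kF(0)_k$ and $\overline{\mathbf VF}=\prod_k F(0)_k$. Let $P_r:\mathbf VF\to F(B_r(0))$ be induced by the $\pi_r$. Let $L^R:F(B_R(0))\to\overline{\mathbf VF}$ have $k$-th component $x\mapsto \pi_R^{-1}\bigl(\tfrac1{2\pi i}\oint z^{-k-1}\rho(z)x\,dz\bigr)\in F(0)_k$ (integral over $|z|=\tfrac12$). For $z\in\mathbf C^m\setminus\Delta$ and any $r_1,\dots,r_m,R>0$ such that the $B_{r_i}(z_i)$ are disjoint and contained in $B_R(0)$ put $$\tilde\mu(a)(z)=L^R\,M^{B_{r_1}(z_1),\dots,B_{r_m}(z_m)}_{B_R(0)}\bigl(\sigma_{(+z_1)}P_{r_1}a_1,\dots,\sigma_{(+z_m)}P_{r_m}a_m\bigr).$$ $F$ has \emph{discrete weight spaces} if all $F(0)_k$ are discrete; it then has \emph{meromorphic OPE} if $(\mathbf VF,\tilde\mu)$ satisfies the meromorphicity axiom above. \textbf{Theorem.} Let $\mathcal V$ be a geometric vertex algebra, and let $I:\mathcal V\to\mathbf V\mathbf F\mathcal V$ be the linear map sending $a\in\mathcal V_k$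 to the element of $\mathbf F\mathcal V(0)_k$ whose image in each $\mathbf F\mathcal V(B_r(0))$ is $[\delta_0\otimes a]$, where $\delta_0$ is evaluation at $0$. Let $\overline I:\overline{\mathcal V}\to\overline{\mathbf V\mathbf F\mathcal V}$ be the induced map of products. \begin{enumerate} \item $I$ is an isomorphism of $\mathbf Z$-graded complete bornological spaces: $\mathbf V\mathbf F\mathcal V$ and its homogeneous components are complete, and $I$ is, in each degree and on the direct sums, bijective and bounded with bounded inverse. \item For all $m\ge0$, $a_1,\dots,a_m\in\mathcal V$ and $z\in\mathbf C^m\setminus\Delta$, one has $\tilde\mu(Ia_1,\dots,Ia_m)(z)=\overline I(\mu(a_1,\dots,a_m)(z))$, for every choice of the radii used to compute $\tilde\mu$. \item $\mathbf F\mathcal V$ has discrete weight spaces and meromorphic OPE. \item $(\mathbf V\mathbf F\mathcal V,\tilde\mu)$ is a geometric vertex algebra, and $I$ is an isomorphism of geometric vertex algebras $\mathcal V\cong\mathbf V\mathbf F\mathcal V$. \end{enumerate} -/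

import Mathlib

universe u

namespace FactVA

noncomputable section

open scoped TensorProduct DirectSum Topology
open Set Filter TopologicalSpace

/-! ### Bornological vector spaces -/

section Bornological

variable {X Y Z : Type*}

/-- `S` is a bounded set of the bornology `b`. -/
def Bdd (b : Bornology X) (S : Set X) : Prop := @Bornology.IsBounded X b S

/-- Maps sending bounded sets to bounded sets. -/
def BddMap (bX : Bornology X) (bY : Bornology Y) (f : X → Y) : Prop :=
  ∀ S, Bdd bX S → Bdd bY (f '' S)

/-- Two-variable maps sending pairs of bounded sets to bounded sets. For bilinear maps these are
the bounded linear maps out of the (completed) bornological tensor product. -/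
def BddMap₂ (bX : Bornology X) (bY : Bornology Y) (bZ : Bornology Z) (f : X → Y → Z) : Prop :=
  ∀ S T, Bdd bX S → Bdd bY T → Bdd bZ (image2 f S T)

lemma Bdd.subset {b : Bornology X} {S T : Set X} (h : Bdd b T) (hS : S ⊆ T) : Bdd b S :=
  @Bornology.IsBounded.subset X b S T h hS

lemma Bdd.union {b : Bornology X} {S T : Set X} (hS : Bdd b S) (hT : Bdd b T) : Bdd b (S ∪ T) :=
  @Bornology.IsBounded.union X b S T hS hT

lemma bdd_singleton (b : Bornology X) (x : X) : Bdd b {x} := @Bornology.isBounded_singleton X b x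

lemma bdd_empty (b : Bornology X) : Bdd b ∅ := @Bornology.isBounded_empty X b

variable [AddCommGroup X] [Module ℂ X] [AddCommGroup Y] [Module ℂ Y] [AddCommGroup Z] [Module ℂ Z]

def IsAbsConvex (S : Set X) : Prop :=
  ∀ x ∈ S, ∀ y ∈ S, ∀ a b : ℂ, ‖a‖ + ‖b‖ ≤ 1 → a • x + b • y ∈ S

/-- The absolutely convex hull. -/
def absHull (S : Set X) : Set X := ⋂₀ {T | IsAbsConvex T ∧ S ⊆ T}

/-- A (convex) bornological vector space over `ℂ`. -/
structure IsBVS (b : Bornology X) : Prop where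
  smul_bdd : ∀ B, Bdd b B → ∀ r : ℝ, 0 < r → Bdd b ((fun x => (r : ℂ) • x) '' B)
  hull_bdd : ∀ B, Bdd b B → Bdd b (absHull B)

lemma subset_absHull (S : Set X) : S ⊆ absHull S := fun _ hx _ hT => hT.2 hx

lemma isAbsConvex_absHull (S : Set X) : IsAbsConvex (absHull S) :=
  fun x hx y hy a b hab T hT => hT.1 x (hx T hT) y (hy T hT) a b hab

lemma absHull_min {S T : Set X} (hT : IsAbsConvex T) (h : S ⊆ T) : absHull S ⊆ T :=
  fun _ hx => hx T ⟨hT, h⟩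

lemma absHull_mono {S T : Set X} (h : S ⊆ T) : absHull S ⊆ absHull T :=
  absHull_min (isAbsConvex_absHull T) (h.trans (subset_absHull T))

lemma IsAbsConvex.preimage {T : Set Y} (hT : IsAbsConvex T) (f : X →ₗ[ℂ] Y) :
    IsAbsConvex (f ⁻¹' T) := by
  intro x hx y hy a b hab
  simpa using hT _ hx _ hy a b hab

lemma image_absHull_subset (f : X →ₗ[ℂ] Y) (S : Set X) : f '' absHull S ⊆ absHull (f '' S) := by
  rw [image_subset_iff]
  exact absHull_min ((isAbsConvex_absHull _).preimage f)
    fun x hx => subset_absHull _ (mem_image_of_mem f hx)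

lemma image2_absHull_subset (f : X →ₗ[ℂ] Y →ₗ[ℂ] Z) (S : Set X) (T : Set Y) :
    image2 (fun x y => f x y) (absHull S) (absHull T) ⊆ absHull (image2 (fun x y => f x y) S T) := by
  rintro _ ⟨x, hx, y, hy, rfl⟩
  have h1 : ∀ y ∈ T, ∀ x ∈ absHull S, f x y ∈ absHull (image2 (fun x y => f x y) S T) := by
    intro y hy x hx
    have := image_absHull_subset (f.flip y) S (mem_image_of_mem _ hx)
    refine absHull_mono ?_ this
    rintro _ ⟨s, hs, rfl⟩
    exact ⟨s, hs, y, hy, rfl⟩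
  have := image_absHull_subset (f x) T (mem_image_of_mem _ hy)
  refine absHull_min (isAbsConvex_absHull _) ?_ this
  rintro _ ⟨t, ht, rfl⟩
  exact h1 t ht x hx

lemma IsBVS.smul {b : Bornology X} (hb : IsBVS b) {B : Set X} (hB : Bdd b B) (c : ℂ) :
    Bdd b ((fun x => c • x) '' B) := by
  refine (hb.hull_bdd _ (hb.smul_bdd B hB (‖c‖ + 1) (by positivity))).subset ?_
  rintro _ ⟨x, hx, rfl⟩
  have h0 : ((‖c‖ + 1 : ℝ) : ℂ) ≠ 0 := by
    rw [Complex.ofReal_ne_zero]; positivity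
  have := isAbsConvex_absHull _ _ (subset_absHull _ (mem_image_of_mem
    (fun x => ((‖c‖ + 1 : ℝ) : ℂ) • x) hx)) _ (subset_absHull _ (mem_image_of_mem
    (fun x => ((‖c‖ + 1 : ℝ) : ℂ) • x) hx)) (c / ((‖c‖ + 1 : ℝ) : ℂ)) 0 (by
      rw [norm_zero, add_zero, norm_div, Complex.norm_real, Real.norm_of_nonneg (by positivity),
        div_le_one (by positivity)]
      linarith)
  simp only [smul_smul, zero_mul, zero_smul, add_zero, div_mul_cancel₀ _ h0] at this
  exact this

lemma IsBVS.add {b : Bornology X} (hb : IsBVS b) {S T : Set X} (hS : Bdd b S) (hT : Bdd b T) :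
    Bdd b (image2 (fun x y => x + y) S T) := by
  refine (hb.smul (hb.hull_bdd _ (hS.union hT)) 2).subset ?_
  rintro _ ⟨x, hx, y, hy, rfl⟩
  refine ⟨_, isAbsConvex_absHull _ x (subset_absHull _ (Or.inl hx)) y
    (subset_absHull _ (Or.inr hy)) (1/2) (1/2) (by norm_num), ?_⟩
  simp [smul_smul]

lemma IsBVS.finset_sum {b : Bornology X} (hb : IsBVS b) {ι : Type*} (s : Finset ι)
    (S : ι → Set X) (hS : ∀ i ∈ s, Bdd b (S i)) :
    Bdd b {x | ∃ y : ι → X, (∀ i ∈ s, y i ∈ S i) ∧ x = ∑ i ∈ s, y i} := by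
  classical
  induction s using Finset.induction_on with
  | empty =>
    refine (bdd_singleton b 0).subset ?_
    rintro x ⟨y, -, rfl⟩
    simp
  | insert i s hi ih =>
    refine (hb.add (hS i (by simp)) (ih fun j hj => hS j (by simp [hj]))).subset ?_
    rintro x ⟨y, hy, rfl⟩
    exact ⟨y i, hy i (by simp), ∑ j ∈ s, y j, ⟨y, fun j hj => hy j (by simp [hj]), rfl⟩,
      (Finset.sum_insert hi).symm⟩

/-- Completeness: each bounded set lies in, and is bounded in, a completely normable subobject,
that is, the image of a Banach space under an injective bounded linear map. -/
def IsCompleteBorn {X : Type u} [AddCommGroup X] [Module ℂ X] (b : Bornology X) : Prop :=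
  ∀ B, Bdd b B → ∃ (Y : Type u) (_ : NormedAddCommGroup Y) (_ : NormedSpace ℂ Y)
    (_ : CompleteSpace Y) (j : Y →ₗ[ℂ] X), Function.Injective j ∧
      (∀ T : Set Y, Bornology.IsBounded T → Bdd b (j '' T)) ∧
      ∃ T : Set Y, Bornology.IsBounded T ∧ B ⊆ j '' T

/-- The bornology whose bounded sets are the bounded subsets of finite-dimensional subspaces. -/
@[reducible] def discreteBorn (X : Type*) [AddCommGroup X] [Module ℂ X] : Bornology X :=
  Bornology.ofBounded
    {S | ∃ (n : ℕ) (e : (Fin n → ℂ) →ₗ[ℂ] X) (T : Set (Fin n → ℂ)),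
      Bornology.IsBounded T ∧ S ⊆ e '' T}
    ⟨0, 0, ∅, Bornology.isBounded_empty, empty_subset _⟩
    (fun _ ⟨n, e, T, hT, h⟩ _ h' => ⟨n, e, T, hT, h'.trans h⟩)
    (by
      rintro S₁ ⟨n, e, T, hT, h⟩ S₂ ⟨n', e', T', hT', h'⟩
      let p := (LinearMap.funLeft ℂ ℂ (Fin.castAdd n' : Fin n → Fin (n + n')))
      let p' := (LinearMap.funLeft ℂ ℂ (Fin.natAdd n : Fin n' → Fin (n + n')))
      have h0 : ∀ (R R' : ℝ) (x : Fin n → ℂ) (x' : Fin n' → ℂ), ‖x‖ ≤ R → ‖x'‖ ≤ R' →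
          Fin.append x x' ∈ Metric.closedBall (0 : Fin (n + n') → ℂ) (max R R') := by
        intro R R' x x' hx hx'
        rw [mem_closedBall_zero_iff, pi_norm_le_iff_of_nonneg
          (le_max_of_le_left ((norm_nonneg x).trans hx))]
        intro i
        refine Fin.addCases (fun i => ?_) (fun i => ?_) i
        · rw [Fin.append_left]; exact le_max_of_le_left ((norm_le_pi_norm x i).trans hx)
        · rw [Fin.append_right]; exact le_max_of_le_right ((norm_le_pi_norm x' i).trans hx')
      obtain ⟨R, hR⟩ := hT.subset_closedBall 0
      obtain ⟨R', hR'⟩ := hT'.subset_closedBall 0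
      refine ⟨n + n', e ∘ₗ p + e' ∘ₗ p', Metric.closedBall 0 (max (max R 0) (max R' 0)),
        Metric.isBounded_closedBall, ?_⟩
      rintro x (hx | hx)
      · obtain ⟨t, ht, rfl⟩ := h hx
        refine ⟨_, h0 (max R 0) (max R' 0) t 0 (le_max_of_le_left ?_) (by simp), ?_⟩
        · simpa using hR ht
        · have h1 : p (Fin.append t 0) = t := by ext i; simp [p, LinearMap.funLeft_apply]
          have h2 : p' (Fin.append t 0) = 0 := by ext i; simp [p', LinearMap.funLeft_apply]
          simp [h1, h2]
      · obtain ⟨t, ht, rfl⟩ := h' hx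
        refine ⟨_, h0 (max R 0) (max R' 0) 0 t (by simp) (le_max_of_le_left ?_), ?_⟩
        · simpa using hR' ht
        · have h1 : p (Fin.append 0 t) = 0 := by ext i; simp [p, LinearMap.funLeft_apply]
          have h2 : p' (Fin.append 0 t) = t := by ext i; simp [p', LinearMap.funLeft_apply]
          simp [h1, h2])
    (fun x => ⟨1, LinearMap.toSpanSingleton ℂ X x ∘ₗ LinearMap.proj 0, {1},
      Bornology.isBounded_singleton, by simp⟩)

lemma bdd_discrete {S : Set X} : Bdd (discreteBorn X) S ↔
    ∃ (n : ℕ) (e : (Fin n → ℂ) →ₗ[ℂ] X) (T : Set (Fin n → ℂ)),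
      Bornology.IsBounded T ∧ S ⊆ e '' T :=
  Bornology.isBounded_ofBounded_iff _

/-- The bornology of the bornological tensor product. -/
@[reducible] def tensorBorn (bX : Bornology X) (bY : Bornology Y) : Bornology (X ⊗[ℂ] Y) :=
  Bornology.ofBounded
    {S | ∃ B C, Bdd bX B ∧ Bdd bY C ∧ S ⊆ absHull (image2 (fun x y => x ⊗ₜ[ℂ] y) B C)}
    ⟨∅, ∅, bdd_empty _, bdd_empty _, empty_subset _⟩
    (fun _ ⟨B, C, hB, hC, h⟩ _ h' => ⟨B, C, hB, hC, h'.trans h⟩)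
    (by
      rintro S₁ ⟨B, C, hB, hC, h⟩ S₂ ⟨B', C', hB', hC', h'⟩
      exact ⟨B ∪ B', C ∪ C', hB.union hB', hC.union hC', union_subset
        (h.trans (absHull_mono (image2_subset subset_union_left subset_union_left)))
        (h'.trans (absHull_mono (image2_subset subset_union_right subset_union_right)))⟩)
    (fun t => by
      suffices h : ∃ B C, B.Finite ∧ C.Finite ∧
          t ∈ absHull (image2 (fun (x : X) (y : Y) => x ⊗ₜ[ℂ] y) B C) by
        obtain ⟨B, C, hB, hC, h⟩ := h
        exact ⟨B, C, @Set.Finite.isBounded X bX B hB, @Set.Finite.isBounded Y bY C hC,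
          singleton_subset_iff.2 h⟩
      induction t using TensorProduct.induction_on with
      | zero =>
        exact ⟨{0}, {0}, finite_singleton _, finite_singleton _,
          subset_absHull _ ⟨0, rfl, 0, rfl, by simp⟩⟩
      | tmul x y =>
        exact ⟨{x}, {y}, finite_singleton _, finite_singleton _,
          subset_absHull _ ⟨x, rfl, y, rfl, rfl⟩⟩
      | add s t hs ht =>
        obtain ⟨B, C, hB, hC, h⟩ := hs
        obtain ⟨B', C', hB', hC', h'⟩ := ht
        refine ⟨(fun x => (2 : ℂ) • x) '' (B ∪ B'), C ∪ C', (hB.union hB').image _,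
          hC.union hC', ?_⟩
        have h0 : ∀ t ∈ absHull (image2 (fun (x : X) (y : Y) => x ⊗ₜ[ℂ] y) (B ∪ B') (C ∪ C')),
            (2 : ℂ) • t ∈ absHull (image2 (fun (x : X) (y : Y) => x ⊗ₜ[ℂ] y)
              ((fun x => (2 : ℂ) • x) '' (B ∪ B')) (C ∪ C')) := by
          intro t ht
          have := image_absHull_subset ((2 : ℂ) • LinearMap.id) _ (mem_image_of_mem _ ht)
          refine absHull_mono ?_ this
          rintro _ ⟨_, ⟨x, hx, y, hy, rfl⟩, rfl⟩
          exact ⟨_, mem_image_of_mem _ hx, y, hy, by simp [TensorProduct.smul_tmul']⟩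
        have h1 := isAbsConvex_absHull _ _ (h0 s (absHull_mono (image2_subset subset_union_left
          subset_union_left) h)) _ (h0 t (absHull_mono (image2_subset subset_union_right
          subset_union_right) h')) (1 / 2) (1 / 2) (by norm_num)
        simpa [smul_smul] using h1)

lemma bdd_tensor {bX : Bornology X} {bY : Bornology Y} {S : Set (X ⊗[ℂ] Y)} :
    Bdd (tensorBorn bX bY) S ↔ ∃ B C, Bdd bX B ∧ Bdd bY C ∧
      S ⊆ absHull (image2 (fun x y => x ⊗ₜ[ℂ] y) B C) :=
  Bornology.isBounded_ofBounded_iff _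

/-- The quotient bornology. -/
@[reducible] def quotBorn (b : Bornology X) (N : Submodule ℂ X) : Bornology (X ⧸ N) :=
  Bornology.ofBounded {S | ∃ B, Bdd b B ∧ S = N.mkQ '' B}
    ⟨∅, bdd_empty b, by simp⟩
    (by
      rintro _ ⟨B, hB, rfl⟩ S hS
      exact ⟨B ∩ N.mkQ ⁻¹' S, hB.subset inter_subset_left, by
        rw [image_inter_preimage, inter_eq_right.2 hS]⟩)
    (by
      rintro _ ⟨B, hB, rfl⟩ _ ⟨B', hB', rfl⟩
      exact ⟨B ∪ B', hB.union hB', by rw [image_union]⟩)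
    (fun x => by
      obtain ⟨x, rfl⟩ := N.mkQ_surjective x
      exact ⟨{x}, bdd_singleton b x, by simp⟩)

lemma bdd_quot {b : Bornology X} {N : Submodule ℂ X} {S : Set (X ⧸ N)} :
    Bdd (quotBorn b N) S ↔ ∃ B, Bdd b B ∧ S = N.mkQ '' B :=
  Bornology.isBounded_ofBounded_iff _

/-- The direct sum bornology. -/
@[reducible] def sumBorn {ι : Type*} {X : ι → Type*} [∀ i, AddCommGroup (X i)]
    [∀ i, Module ℂ (X i)] (b : ∀ i, Bornology (X i)) : Bornology (⨁ i, X i) :=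
  Bornology.ofBounded
    {S | ∃ (s : Finset ι) (C : ∀ i, Set (X i)), (∀ i, Bdd (b i) (C i)) ∧
      ∀ x ∈ S, (∀ i ∈ s, x i ∈ C i) ∧ ∀ i, i ∉ s → x i = 0}
    ⟨∅, fun _ => ∅, fun i => bdd_empty (b i), by simp⟩
    (fun _ ⟨s, C, hC, h⟩ _ h' => ⟨s, C, hC, fun x hx => h x (h' hx)⟩)
    (by
      classical
      rintro S₁ ⟨s, C, hC, h⟩ S₂ ⟨s', C', hC', h'⟩
      refine ⟨s ∪ s', fun i => (C i ∪ C' i) ∪ {0},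
        fun i => ((hC i).union (hC' i)).union (bdd_singleton _ _), ?_⟩
      rintro x (hx | hx)
      · refine ⟨fun i _ => ?_, fun i hi => (h x hx).2 i fun h => hi (Finset.mem_union_left _ h)⟩
        by_cases his : i ∈ s
        · exact Or.inl (Or.inl ((h x hx).1 i his))
        · exact Or.inr ((h x hx).2 i his)
      · refine ⟨fun i _ => ?_, fun i hi => (h' x hx).2 i fun h => hi (Finset.mem_union_right _ h)⟩
        by_cases his : i ∈ s'
        · exact Or.inl (Or.inr ((h' x hx).1 i his))
        · exact Or.inr ((h' x hx).2 i his))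
    (fun x => by
      classical
      exact ⟨DFinsupp.support x, fun i => {x i}, fun i => bdd_singleton _ _, by
        rintro _ rfl
        exact ⟨fun i _ => rfl, fun i hi => DFinsupp.notMem_support_iff.1 hi⟩⟩)

lemma bdd_sum {ι : Type*} {X : ι → Type*} [∀ i, AddCommGroup (X i)]
    [∀ i, Module ℂ (X i)] {b : ∀ i, Bornology (X i)} {S : Set (⨁ i, X i)} :
    Bdd (sumBorn b) S ↔ ∃ (s : Finset ι) (C : ∀ i, Set (X i)), (∀ i, Bdd (b i) (C i)) ∧
      ∀ x ∈ S, (∀ i ∈ s, x i ∈ C i) ∧ ∀ i, i ∉ s → x i = 0 :=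
  Bornology.isBounded_ofBounded_iff _

/-- The product bornology. -/
@[reducible] def piBorn {ι : Type*} {X : ι → Type*} (b : ∀ i, Bornology (X i)) :
    Bornology (∀ i, X i) := @Pi.instBornology ι X b

/-- The subspace bornology. -/
@[reducible] def subBorn (b : Bornology X) (N : Submodule ℂ X) : Bornology N :=
  @Bornology.induced N X b Subtype.val

lemma IsAbsConvex.smul_image {S : Set X} (h : IsAbsConvex S) (c : ℂ) :
    IsAbsConvex ((fun x => c • x) '' S) := by
  rintro _ ⟨x, hx, rfl⟩ _ ⟨y, hy, rfl⟩ a b hab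
  exact ⟨_, h x hx y hy a b hab, by simp [smul_smul, mul_comm]⟩

lemma isBVS_tensor {bX : Bornology X} {bY : Bornology Y} (hX : IsBVS bX) :
    IsBVS (tensorBorn bX bY) where
  smul_bdd S hS r hr := by
    obtain ⟨B, C, hB, hC, h⟩ := bdd_tensor.1 hS
    refine bdd_tensor.2 ⟨_, C, hX.smul_bdd B hB r hr, hC, ?_⟩
    refine (image_mono h).trans
      ((image_absHull_subset ((r : ℂ) • LinearMap.id : X ⊗[ℂ] Y →ₗ[ℂ] X ⊗[ℂ] Y) _).trans
        (absHull_mono ?_))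
    rintro _ ⟨_, ⟨x, hx, y, hy, rfl⟩, rfl⟩
    exact ⟨_, mem_image_of_mem _ hx, y, hy, by simp [TensorProduct.smul_tmul']⟩
  hull_bdd S hS := by
    obtain ⟨B, C, hB, hC, h⟩ := bdd_tensor.1 hS
    exact bdd_tensor.2 ⟨B, C, hB, hC, absHull_min (isAbsConvex_absHull _) h⟩

lemma isBVS_quot {b : Bornology X} (hb : IsBVS b) (N : Submodule ℂ X) :
    IsBVS (quotBorn b N) where
  smul_bdd S hS r hr := by
    obtain ⟨B, hB, rfl⟩ := bdd_quot.1 hS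
    refine bdd_quot.2 ⟨_, hb.smul_bdd B hB r hr, ?_⟩
    rw [image_image, image_image]
    rfl
  hull_bdd S hS := by
    obtain ⟨B, hB, rfl⟩ := bdd_quot.1 hS
    have h1 : Bdd (quotBorn b N) (N.mkQ '' absHull B) :=
      bdd_quot.2 ⟨_, hb.hull_bdd B hB, rfl⟩
    refine h1.subset (absHull_min ?_ (image_mono (subset_absHull B)))
    rintro _ ⟨x, hx, rfl⟩ _ ⟨y, hy, rfl⟩ a c hac
    exact ⟨_, isAbsConvex_absHull _ x hx y hy a c hac, by simp⟩

lemma isBVS_sum {ι : Type*} {X : ι → Type*} [∀ i, AddCommGroup (X i)]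
    [∀ i, Module ℂ (X i)] {b : ∀ i, Bornology (X i)} (hb : ∀ i, IsBVS (b i)) :
    IsBVS (sumBorn b) where
  smul_bdd S hS r hr := by
    obtain ⟨s, C, hC, h⟩ := bdd_sum.1 hS
    refine bdd_sum.2 ⟨s, _, fun i => (hb i).smul_bdd _ (hC i) r hr, ?_⟩
    rintro _ ⟨x, hx, rfl⟩
    refine ⟨fun i hi => ⟨x i, (h x hx).1 i hi, rfl⟩, fun i hi => ?_⟩
    change (r : ℂ) • x i = 0
    rw [(h x hx).2 i hi, smul_zero]
  hull_bdd S hS := by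
    obtain ⟨s, C, hC, h⟩ := bdd_sum.1 hS
    refine bdd_sum.2 ⟨s, _, fun i => (hb i).hull_bdd _ (hC i), ?_⟩
    refine absHull_min (T := {x : ⨁ i, X i | (∀ i ∈ s, x i ∈ absHull (C i)) ∧
      ∀ i, i ∉ s → x i = 0}) ?_ fun x hx =>
        ⟨fun i hi => subset_absHull _ ((h x hx).1 i hi), (h x hx).2⟩
    rintro x ⟨hx, hx'⟩ y ⟨hy, hy'⟩ a c hac
    refine ⟨fun i hi => isAbsConvex_absHull _ _ (hx i hi) _ (hy i hi) a c hac, fun i hi => ?_⟩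
    change a • x i + c • y i = 0
    rw [hx' i hi, hy' i hi, smul_zero, smul_zero, add_zero]

/-! The universal properties, for bilinear maps. -/

lemma bddMap₂_quot {b : Bornology X} {c : Bornology Y} {d : Bornology Z} {N : Submodule ℂ X} {P : Submodule ℂ Y}
    {f : X ⧸ N → Y ⧸ P → Z} (h : BddMap₂ b c d fun x y => f (N.mkQ x) (P.mkQ y)) :
    BddMap₂ (quotBorn b N) (quotBorn c P) d f := by
  intro S T hS hT
  obtain ⟨B, hB, rfl⟩ := bdd_quot.1 hS
  obtain ⟨C, hC, rfl⟩ := bdd_quot.1 hT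
  rw [image2_image_left, image2_image_right]
  exact h B C hB hC

lemma bddMap_quot {b : Bornology X} {d : Bornology Z} {N : Submodule ℂ X}
    {f : X ⧸ N → Z} (h : BddMap b d fun x => f (N.mkQ x)) :
    BddMap (quotBorn b N) d f := by
  intro S hS
  obtain ⟨B, hB, rfl⟩ := bdd_quot.1 hS
  rw [image_image]
  exact h B hB

lemma bddMap_mkQ (b : Bornology X) (N : Submodule ℂ X) : BddMap b (quotBorn b N) N.mkQ :=
  fun B hB => bdd_quot.2 ⟨B, hB, rfl⟩

lemma eq_sum_lof {ι : Type*} [DecidableEq ι] {X : ι → Type*} [∀ i, AddCommGroup (X i)]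
    [∀ i, Module ℂ (X i)] (s : Finset ι) (x : ⨁ i, X i) (h : ∀ i, i ∉ s → x i = 0) :
    ∑ i ∈ s, DirectSum.lof ℂ ι X i (x i) = x := by
  refine DFinsupp.ext fun i => ?_
  rw [DFinsupp.finsetSum_apply]
  by_cases hi : i ∈ s
  · rw [Finset.sum_eq_single i]
    · exact DirectSum.lof_apply ℂ i (x i)
    · intro j _ hj
      exact DFinsupp.single_eq_of_ne hj.symm
    · exact fun h => absurd hi h
  · rw [h i hi]
    refine Finset.sum_eq_zero fun j hj => ?_
    exact DFinsupp.single_eq_of_ne fun hij => hi (hij ▸ hj)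

lemma bddMap_sum {ι : Type*} [DecidableEq ι] {X : ι → Type*} [∀ i, AddCommGroup (X i)]
    [∀ i, Module ℂ (X i)] {b : ∀ i, Bornology (X i)} {d : Bornology Z} (hd : IsBVS d)
    {f : (⨁ i, X i) →ₗ[ℂ] Z} (h : ∀ i, BddMap (b i) d fun x => f (DirectSum.lof ℂ ι X i x)) :
    BddMap (sumBorn b) d f := by
  intro S hS
  obtain ⟨s, C, hC, h'⟩ := bdd_sum.1 hS
  refine (hd.finset_sum s _ fun i _ => h i _ (hC i)).subset ?_
  rintro _ ⟨x, hx, rfl⟩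
  refine ⟨fun i => f (DirectSum.lof ℂ ι X i (x i)), fun i hi =>
    ⟨x i, (h' x hx).1 i hi, rfl⟩, ?_⟩
  rw [← map_sum, eq_sum_lof s x (h' x hx).2]

lemma bddMap₂_sum {ι κ : Type*} [DecidableEq ι] [DecidableEq κ] {X : ι → Type*} {Y : κ → Type*}
    [∀ i, AddCommGroup (X i)] [∀ i, Module ℂ (X i)] [∀ i, AddCommGroup (Y i)]
    [∀ i, Module ℂ (Y i)] {b : ∀ i, Bornology (X i)} {c : ∀ i, Bornology (Y i)}
    {d : Bornology Z} (hd : IsBVS d) {f : (⨁ i, X i) →ₗ[ℂ] (⨁ i, Y i) →ₗ[ℂ] Z}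
    (h : ∀ i j, BddMap₂ (b i) (c j) d
      fun x y => f (DirectSum.lof ℂ ι X i x) (DirectSum.lof ℂ κ Y j y)) :
    BddMap₂ (sumBorn b) (sumBorn c) d fun x y => f x y := by
  intro S T hS hT
  obtain ⟨s, C, hC, h'⟩ := bdd_sum.1 hS
  obtain ⟨t, D, hD, h''⟩ := bdd_sum.1 hT
  refine (hd.finset_sum s _ fun i _ => hd.finset_sum t _
    fun j _ => h i j _ _ (hC i) (hD j)).subset ?_
  rintro _ ⟨x, hx, y, hy, rfl⟩
  refine ⟨fun i => f (DirectSum.lof ℂ ι X i (x i)) y, fun i hi =>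
    ⟨fun j => f (DirectSum.lof ℂ ι X i (x i)) (DirectSum.lof ℂ κ Y j (y j)), fun j hj =>
      ⟨_, (h' x hx).1 i hi, _, (h'' y hy).1 j hj, rfl⟩, ?_⟩, ?_⟩
  · rw [← map_sum, eq_sum_lof t y (h'' y hy).2]
  · change f x y = _
    conv_lhs => rw [← eq_sum_lof s x (h' x hx).2]
    rw [map_sum, LinearMap.sum_apply]

lemma bddMap_lof {ι : Type*} [DecidableEq ι] {X : ι → Type*} [∀ i, AddCommGroup (X i)]
    [∀ i, Module ℂ (X i)] (b : ∀ i, Bornology (X i)) (i : ι) :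
    BddMap (b i) (sumBorn b) (DirectSum.lof ℂ ι X i) := by
  intro S hS
  refine bdd_sum.2 ⟨{i}, fun j => if h : j = i then h ▸ S else {0}, fun j => ?_, ?_⟩
  · by_cases h : j = i
    · subst h; simpa using hS
    · simpa [h] using bdd_singleton (b j) 0
  · rintro _ ⟨x, hx, rfl⟩
    refine ⟨fun j hj => ?_, fun j hj => DFinsupp.single_eq_of_ne (by simpa using hj)⟩
    obtain rfl := Finset.mem_singleton.1 hj
    simpa using hx

lemma bddMap_tensor {W : Type*} {bX : Bornology X} {bY : Bornology Y} [AddCommGroup W] [Module ℂ W]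
    {d : Bornology W} (hd : IsBVS d) {f : X ⊗[ℂ] Y →ₗ[ℂ] W}
    (h : BddMap₂ bX bY d fun x y => f (x ⊗ₜ y)) : BddMap (tensorBorn bX bY) d f := by
  intro S hS
  obtain ⟨B, C, hB, hC, h'⟩ := bdd_tensor.1 hS
  refine (hd.hull_bdd _ (h B C hB hC)).subset ((image_mono h').trans
    ((image_absHull_subset f _).trans (absHull_mono ?_)))
  rintro _ ⟨_, ⟨x, hx, y, hy, rfl⟩, rfl⟩
  exact ⟨x, hx, y, hy, rfl⟩

lemma bddMap₂_tensor {X' Y' W : Type*} [AddCommGroup X'] [Module ℂ X'] [AddCommGroup Y']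
    [Module ℂ Y'] [AddCommGroup W] [Module ℂ W]
    {bX : Bornology X} {bY : Bornology Y} {bX' : Bornology X'} {bY' : Bornology Y'}
    {d : Bornology W} (hd : IsBVS d) {f : X ⊗[ℂ] Y →ₗ[ℂ] X' ⊗[ℂ] Y' →ₗ[ℂ] W}
    (h : ∀ B C B' C', Bdd bX B → Bdd bY C → Bdd bX' B' → Bdd bY' C' →
      Bdd d {w | ∃ x ∈ B, ∃ y ∈ C, ∃ x' ∈ B', ∃ y' ∈ C', w = f (x ⊗ₜ y) (x' ⊗ₜ y')}) :
    BddMap₂ (tensorBorn bX bY) (tensorBorn bX' bY') d fun x y => f x y := by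
  intro S T hS hT
  obtain ⟨B, C, hB, hC, h1⟩ := bdd_tensor.1 hS
  obtain ⟨B', C', hB', hC', h2⟩ := bdd_tensor.1 hT
  refine (hd.hull_bdd _ (h B C B' C' hB hC hB' hC')).subset ((image2_subset h1 h2).trans
    ((image2_absHull_subset f _ _).trans (absHull_mono ?_)))
  rintro _ ⟨_, ⟨x, hx, y, hy, rfl⟩, _, ⟨x', hx', y', hy', rfl⟩, rfl⟩
  exact ⟨x, hx, y, hy, x', hx', y', hy', rfl⟩

/-! Linear and bilinear maps between discrete spaces are bounded. -/

lemma bddMap_discrete (f : X →ₗ[ℂ] Y) : BddMap (discreteBorn X) (discreteBorn Y) f := by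
  intro S hS
  obtain ⟨n, e, T, hT, h⟩ := bdd_discrete.1 hS
  refine bdd_discrete.2 ⟨n, f ∘ₗ e, T, hT, (image_mono h).trans ?_⟩
  rw [image_image]; rfl

lemma bddMap₂_discrete (f : X →ₗ[ℂ] Y →ₗ[ℂ] Z) :
    BddMap₂ (discreteBorn X) (discreteBorn Y) (discreteBorn Z) fun x y => f x y := by
  intro S S' hS hS'
  obtain ⟨n, e, T, hT, h⟩ := bdd_discrete.1 hS
  obtain ⟨n', e', T', hT', h'⟩ := bdd_discrete.1 hS'
  obtain ⟨R, hR⟩ := hT.subset_closedBall 0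
  obtain ⟨R', hR'⟩ := hT'.subset_closedBall 0
  let E := finProdFinEquiv (m := n) (n := n')
  refine bdd_discrete.2 ⟨n * n', Fintype.linearCombination ℂ (fun k =>
    f (e (Pi.single (E.symm k).1 1)) (e' (Pi.single (E.symm k).2 1))),
    Metric.closedBall 0 (R * R'), Metric.isBounded_closedBall, ?_⟩
  rintro _ ⟨x, hx, y, hy, rfl⟩
  obtain ⟨t, ht, rfl⟩ := h hx
  obtain ⟨t', ht', rfl⟩ := h' hy
  have hRt : ‖t‖ ≤ R := by simpa using hR ht
  have hRt' : ‖t'‖ ≤ R' := by simpa using hR' ht'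
  refine ⟨fun k => t (E.symm k).1 * t' (E.symm k).2, ?_, ?_⟩
  · rw [mem_closedBall_zero_iff, pi_norm_le_iff_of_nonneg
      (mul_nonneg ((norm_nonneg _).trans hRt) ((norm_nonneg _).trans hRt'))]
    intro k
    rw [norm_mul]
    exact mul_le_mul ((norm_le_pi_norm t _).trans hRt) ((norm_le_pi_norm t' _).trans hRt')
      (norm_nonneg _) ((norm_nonneg _).trans hRt)
  · have h1 : ∀ (N : ℕ) (g : (Fin N → ℂ) →ₗ[ℂ] X) (t : Fin N → ℂ),
        g t = ∑ i, t i • g (Pi.single i 1) := by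
      intro N g t
      conv_lhs => rw [← Finset.univ_sum_single t, map_sum]
      refine Finset.sum_congr rfl fun i _ => ?_
      rw [← map_smul, ← Pi.single_smul, smul_eq_mul, mul_one]
    have h2 : ∀ (N : ℕ) (g : (Fin N → ℂ) →ₗ[ℂ] Y) (t : Fin N → ℂ),
        g t = ∑ i, t i • g (Pi.single i 1) := by
      intro N g t
      conv_lhs => rw [← Finset.univ_sum_single t, map_sum]
      refine Finset.sum_congr rfl fun i _ => ?_
      rw [← map_smul, ← Pi.single_smul, smul_eq_mul, mul_one]
    rw [h1 n e t, h2 n' e' t', Fintype.linearCombination_apply,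
      ← E.sum_comp, Fintype.sum_prod_type]
    simp [LinearMap.sum_apply, map_sum, Finset.smul_sum, smul_smul, Finset.sum_comm (γ := Fin n),
      mul_comm]

/-! Bornological convergence and the closure in the topology of b-closed sets. -/

/-- `x n → y`: for some bounded `B` and some null sequence `ε n`, one has `x n - y ∈ ε n B`. -/
def BConverges (b : Bornology X) (x : ℕ → X) (y : X) : Prop :=
  ∃ (B : Set X) (ε : ℕ → ℝ), Bdd b B ∧ Tendsto ε atTop (𝓝 0) ∧
    ∀ n, ∃ v ∈ B, x n - y = (ε n : ℂ) • v

/-- b-closed sets: the sequentially closed sets. -/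
def BClosed (b : Bornology X) (S : Set X) : Prop :=
  ∀ (x : ℕ → X) (y : X), (∀ n, x n ∈ S) → BConverges b x y → y ∈ S

lemma BClosed.preimage {b : Bornology X} {c : Bornology Y} {S : Set Y} (hS : BClosed c S)
    (f : X →ₗ[ℂ] Y) (hf : BddMap b c f) (a : Y) : BClosed b {x | f x + a ∈ S} := by
  rintro x y hx ⟨B, ε, hB, hε, h⟩
  refine hS (fun n => f (x n) + a) _ hx ⟨f '' B, ε, hf B hB, hε, fun n => ?_⟩
  obtain ⟨v, hv, h⟩ := h n
  exact ⟨f v, mem_image_of_mem f hv, by rw [add_sub_add_right_eq_sub, ← map_sub, h, map_smul]⟩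

lemma bddMap_id (b : Bornology X) : BddMap b b (LinearMap.id : X →ₗ[ℂ] X) := by
  intro S hS; simpa using hS

/-- The closure of a subspace in the topology whose closed sets are the b-closed sets. -/
def bClosure {b : Bornology X} (hb : IsBVS b) (N : Submodule ℂ X) : Submodule ℂ X where
  carrier := ⋂₀ {S | BClosed b S ∧ (N : Set X) ⊆ S}
  zero_mem' := fun _ hS => hS.2 N.zero_mem
  add_mem' := by
    intro x y hx hy S hS
    have h1 : ∀ a ∈ N, a + y ∈ S := by
      intro a ha
      have := hy {z | LinearMap.id (R := ℂ) z + a ∈ S}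
        ⟨hS.1.preimage _ (bddMap_id b) a, fun z hz => hS.2 (N.add_mem hz ha)⟩
      simpa [add_comm] using this
    exact hx {z | LinearMap.id (R := ℂ) z + y ∈ S} ⟨hS.1.preimage _ (bddMap_id b) y, h1⟩
  smul_mem' := by
    intro c x hx S hS
    have h := hx {z | (c • LinearMap.id : X →ₗ[ℂ] X) z + 0 ∈ S}
      ⟨hS.1.preimage _ (fun B hB => hb.smul hB c) 0, fun z hz => by
        simpa using hS.2 (N.smul_mem c hz)⟩
    simpa using h

lemma le_bClosure {b : Bornology X} (hb : IsBVS b) (N : Submodule ℂ X) : N ≤ bClosure hb N :=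
  fun _ hx _ hS => hS.2 hx

lemma bClosure_map {b : Bornology X} {c : Bornology Y} (hb : IsBVS b) (hc : IsBVS c)
    {N : Submodule ℂ X} {P : Submodule ℂ Y} (f : X →ₗ[ℂ] Y) (hf : BddMap b c f)
    (h : ∀ x ∈ N, f x ∈ bClosure hc P) : ∀ x ∈ bClosure hb N, f x ∈ bClosure hc P := by
  intro x hx S hS
  have := hx {z | f z + 0 ∈ S} ⟨hS.1.preimage f hf 0, fun z hz => by
    simpa using h z hz S hS⟩
  simpa using this

end Bornological

/-! ### Holomorphic functions and analytic functionals -/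

section Functionals

variable {E E' E'' : Type*} [NormedAddCommGroup E] [NormedSpace ℂ E] [NormedAddCommGroup E']
  [NormedSpace ℂ E'] [NormedAddCommGroup E''] [NormedSpace ℂ E'']

/-- The space `𝒪(X)` of holomorphic functions on `X` (used for open `X`). -/
def Hol (X : Set E) : Submodule ℂ (X → ℂ) where
  carrier := {f | ∃ F : E → ℂ, DifferentiableOn ℂ F X ∧ ∀ x : X, F x = f x}
  zero_mem' := ⟨0, differentiableOn_const 0, fun _ => rfl⟩
  add_mem' := by
    rintro f g ⟨F, hF, hf⟩ ⟨G, hG, hg⟩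
    exact ⟨F + G, hF.add hG, fun x => by simp [hf, hg]⟩
  smul_mem' := by
    rintro c f ⟨F, hF, hf⟩
    exact ⟨c • F, hF.const_smul c, fun x => by simp [hf]⟩

/-- `|α(f)| ≤ C ‖f‖_K` for all `f ∈ 𝒪(X)`. -/
def BoundedBy {X : Set E} (α : Module.Dual ℂ (Hol X)) (K : Set E) (C : ℝ) : Prop :=
  ∀ (f : Hol X) (M : ℝ), 0 ≤ M → (∀ x : X, x.1 ∈ K → ‖f.1 x‖ ≤ M) → ‖α f‖ ≤ C * M

lemma BoundedBy.mono {X : Set E} {α : Module.Dual ℂ (Hol X)} {K K' : Set E} {C C' : ℝ}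
    (h : BoundedBy α K C) (hK : K ⊆ K') (hC : C ≤ C') : BoundedBy α K' C' :=
  fun f M hM hf => (h f M hM fun x hx => hf x (hK hx)).trans
    (mul_le_mul_of_nonneg_right hC hM)

/-- The functionals on `𝒪(X)` that are continuous for the topology of uniform convergence on compact
subsets. -/
def OPrimeSub (X : Set E) : Submodule ℂ (Module.Dual ℂ (Hol X)) where
  carrier := {α | ∃ K ⊆ X, IsCompact K ∧ ∃ C, BoundedBy α K C}
  zero_mem' := ⟨∅, empty_subset _, isCompact_empty, 0, fun f M _ _ => by simp⟩
  add_mem' := by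
    rintro α β ⟨K, hKX, hK, C, h⟩ ⟨K', hKX', hK', C', h'⟩
    refine ⟨K ∪ K', union_subset hKX hKX', hK.union hK', C + C', fun f M hM hf => ?_⟩
    rw [add_mul]
    exact (norm_add_le _ _).trans (add_le_add (h f M hM fun x hx => hf x (Or.inl hx))
      (h' f M hM fun x hx => hf x (Or.inr hx)))
  smul_mem' := by
    rintro c α ⟨K, hKX, hK, C, h⟩
    refine ⟨K, hKX, hK, ‖c‖ * C, fun f M hM hf => ?_⟩
    rw [LinearMap.smul_apply, norm_smul, mul_assoc]
    exact mul_le_mul_of_nonneg_left (h f M hM hf) (norm_nonneg c)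

/-- The space `𝒪'(X)` of analytic functionals. -/
def OPrime (X : Set E) := OPrimeSub X

instance (X : Set E) : AddCommGroup (OPrime X) := inferInstanceAs (AddCommGroup (OPrimeSub X))

instance (X : Set E) : Module ℂ (OPrime X) := inferInstanceAs (Module ℂ (OPrimeSub X))

/-- Constructor for analytic functionals. -/
def OPrime.mk {X : Set E} (α : Module.Dual ℂ (Hol X)) (h : α ∈ OPrimeSub X) : OPrime X := ⟨α, h⟩

lemma OPrime.ext' {X : Set E} {α β : OPrime X} (h : ∀ f, α.1 f = β.1 f) : α = β :=
  Subtype.ext (LinearMap.ext h)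

/-- The bornology of `𝒪'(X)`. -/
@[reducible] def functBorn (X : Set E) : Bornology (OPrime X) :=
  Bornology.ofBounded
    {B | ∃ K ⊆ X, IsCompact K ∧ ∃ C, 0 ≤ C ∧ ∀ α ∈ B, BoundedBy α.1 K C}
    ⟨∅, empty_subset _, isCompact_empty, 0, le_rfl, by simp⟩
    (fun _ ⟨K, hKX, hK, C, hC, h⟩ _ h' => ⟨K, hKX, hK, C, hC, fun α hα => h α (h' hα)⟩)
    (by
      rintro _ ⟨K, hKX, hK, C, hC, h⟩ _ ⟨K', hKX', hK', C', hC', h'⟩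
      refine ⟨K ∪ K', union_subset hKX hKX', hK.union hK', max C C', le_max_of_le_left hC, ?_⟩
      rintro α (hα | hα)
      · exact (h α hα).mono subset_union_left (le_max_left _ _)
      · exact (h' α hα).mono subset_union_right (le_max_right _ _))
    (fun α => by
      obtain ⟨K, hKX, hK, C, h⟩ := α.2
      refine ⟨K, hKX, hK, max C 0, le_max_right _ _, ?_⟩
      rintro _ rfl
      exact h.mono subset_rfl (le_max_left _ _))

lemma bdd_funct {X : Set E} {B : Set (OPrime X)} : Bdd (functBorn X) B ↔
    ∃ K ⊆ X, IsCompact K ∧ ∃ C, 0 ≤ C ∧ ∀ α ∈ B, BoundedBy α.1 K C :=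
  Bornology.isBounded_ofBounded_iff _

lemma isBVS_funct (X : Set E) : IsBVS (functBorn X) where
  smul_bdd B hB r hr := by
    obtain ⟨K, hKX, hK, C, hC, h⟩ := bdd_funct.1 hB
    refine bdd_funct.2 ⟨K, hKX, hK, r * C, by positivity, ?_⟩
    rintro _ ⟨α, hα, rfl⟩ f M hM hf
    change ‖(r : ℂ) • α.1 f‖ ≤ _
    rw [norm_smul, mul_assoc, Complex.norm_real, Real.norm_of_nonneg hr.le]
    exact mul_le_mul_of_nonneg_left (h α hα f M hM hf) hr.le
  hull_bdd B hB := by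
    obtain ⟨K, hKX, hK, C, hC, h⟩ := bdd_funct.1 hB
    refine bdd_funct.2 ⟨K, hKX, hK, C, hC, fun α hα => ?_⟩
    refine absHull_min (T := {α : OPrime X | BoundedBy α.1 K C}) ?_ h hα
    intro x hx y hy a b hab f M hM hf
    change ‖a • x.1 f + b • y.1 f‖ ≤ _
    refine (norm_add_le _ _).trans ?_
    rw [norm_smul, norm_smul]
    have h1 := mul_le_mul_of_nonneg_left (hx f M hM hf) (norm_nonneg a)
    have h2 := mul_le_mul_of_nonneg_left (hy f M hM hf) (norm_nonneg b)
    have h3 := mul_le_mul_of_nonneg_right hab (mul_nonneg hC hM)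
    linarith

/-- Pullback of holomorphic functions along (the restriction of) a holomorphic map. -/
def pull {X : Set E} {Y : Set E'} (g : E → E') (hg : Differentiable ℂ g) (h : MapsTo g X Y) :
    Hol Y →ₗ[ℂ] Hol X where
  toFun f := ⟨fun x => f.1 ⟨g x, h x.2⟩, by
    obtain ⟨F, hF, hf⟩ := f.2
    exact ⟨F ∘ g, hF.comp hg.differentiableOn h, fun x => hf ⟨g x, h x.2⟩⟩⟩
  map_add' _ _ := rfl
  map_smul' _ _ := rfl

/-- Pushforward of analytic functionals. -/
def push {X : Set E} {Y : Set E'} (g : E → E') (hg : Differentiable ℂ g) (h : MapsTo g X Y) :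
    OPrime X →ₗ[ℂ] OPrime Y where
  toFun α := .mk (α.1 ∘ₗ pull g hg h) (by
    obtain ⟨K, hKX, hK, C, hα⟩ := α.2
    exact ⟨g '' K, image_subset_iff.2 fun x hx => h (hKX hx), hK.image hg.continuous, C,
      fun f M hM hf => hα _ M hM fun x hx => hf _ (mem_image_of_mem g hx)⟩)
  map_add' _ _ := rfl
  map_smul' _ _ := rfl

lemma push_apply {X : Set E} {Y : Set E'} (g : E → E') (hg : Differentiable ℂ g)
    (h : MapsTo g X Y) (α : OPrime X) (f : Hol Y) : (push g hg h α).1 f = α.1 (pull g hg h f) := rfl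

lemma bddMap_push {X : Set E} {Y : Set E'} (g : E → E') (hg : Differentiable ℂ g)
    (h : MapsTo g X Y) : BddMap (functBorn X) (functBorn Y) (push g hg h) := by
  intro B hB
  obtain ⟨K, hKX, hK, C, hC, hα⟩ := bdd_funct.1 hB
  refine bdd_funct.2 ⟨g '' K, image_subset_iff.2 fun x hx => h (hKX hx),
    hK.image hg.continuous, C, hC, ?_⟩
  rintro _ ⟨α, hα', rfl⟩ f M hM hf
  exact hα α hα' _ M hM fun x hx => hf _ (mem_image_of_mem g hx)

/-- The evaluation functional `δ_x`. -/
def delta {X : Set E} (x : X) : OPrime X :=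
  .mk (LinearMap.proj x ∘ₗ (Hol X).subtype) ⟨{x.1}, singleton_subset_iff.2 x.2,
    isCompact_singleton, 1, fun f M _ hf => by simpa using hf x rfl⟩

/-! Extension of functionals to continuous functions on a compact set. -/

lemma Hol.continuous {X : Set E} (f : Hol X) : Continuous f.1 := by
  obtain ⟨F, hF, hf⟩ := f.2
  have : f.1 = X.domRestrict F := funext fun x => (hf x).symm
  rw [this]
  exact hF.continuousOn.domRestrict

/-- Restriction to a subset, as a continuous function. -/
def resC {X K : Set E} (hK : K ⊆ X) : Hol X →ₗ[ℂ] C(K, ℂ) where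
  toFun f := ⟨fun x => f.1 ⟨x.1, hK x.2⟩, (Hol.continuous f).comp (by fun_prop)⟩
  map_add' _ _ := rfl
  map_smul' _ _ := rfl

lemma exists_extension {X : Set E} (β : OPrime X) : ∃ (K : Set E) (hK : K ⊆ X),
    IsCompact K ∧ ∃ b : StrongDual ℂ C(K, ℂ), ∀ f, β.1 f = b (resC hK f) := by
  obtain ⟨K, hKX, hK, C, hβ⟩ := β.2
  refine ⟨K, hKX, hK, ?_⟩
  have : CompactSpace K := isCompact_iff_compactSpace.1 hK
  have hb : ∀ f, ‖β.1 f‖ ≤ C * ‖resC hKX f‖ := fun f =>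
    hβ f _ (norm_nonneg _) fun x hx => (resC hKX f).norm_coe_le_norm ⟨x.1, hx⟩
  have hker : LinearMap.ker (resC hKX) ≤ LinearMap.ker β.1 := by
    intro f hf
    rw [LinearMap.mem_ker] at hf ⊢
    have := hb f
    rw [hf, norm_zero, mul_zero] at this
    exact norm_le_zero_iff.1 this
  let ψ : LinearMap.range (resC hKX) →ₗ[ℂ] ℂ :=
    (Submodule.liftQ _ β.1 hker) ∘ₗ (resC hKX).quotKerEquivRange.symm.toLinearMap
  have hψ : ∀ f, ψ ⟨resC hKX f, LinearMap.mem_range_self _ f⟩ = β.1 f := by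
    intro f
    have : (resC hKX).quotKerEquivRange.symm ⟨resC hKX f, LinearMap.mem_range_self _ f⟩ =
        Submodule.Quotient.mk f := by
      rw [LinearEquiv.symm_apply_eq]; rfl
    simp only [ψ, LinearMap.comp_apply, LinearEquiv.coe_coe, this]
    rfl
  obtain ⟨b, hb', -⟩ := exists_extension_norm_eq (LinearMap.range (resC hKX))
    (ψ.mkContinuous C (by
      rintro ⟨_, f, rfl⟩
      rw [hψ]
      exact hb f))
  refine ⟨b, fun f => ?_⟩
  rw [← hψ f]
  exact (hb' ⟨resC hKX f, LinearMap.mem_range_self _ f⟩).symm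

lemma second_order {φ : ℂ → ℂ} {ρ M : ℝ} (hρ : 1 < ρ)
    (hφ : DifferentiableOn ℂ φ (Metric.ball 0 ρ)) (hM : ∀ t ∈ Metric.ball (0 : ℂ) ρ, ‖φ t‖ ≤ M) :
    ‖φ 1 - φ 0 - deriv φ 0‖ ≤ 4 * M / ρ ^ 2 := by
  have hρ0 : 0 < ρ := by linarith
  have h0 : (0 : ℂ) ∈ Metric.ball (0 : ℂ) ρ := Metric.mem_ball_self hρ0
  have h1 : (1 : ℂ) ∈ Metric.ball (0 : ℂ) ρ := by simpa using hρ
  have hg : ∀ t ∈ Metric.ball (0 : ℂ) ρ, ‖dslope φ 0 t‖ ≤ 2 * M / ρ := by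
    intro t ht
    refine Complex.norm_dslope_le_div_of_mapsTo_ball hφ (fun s hs => ?_) ht
    rw [mem_closedBall_iff_norm]
    exact (norm_sub_le _ _).trans (by linarith [hM s hs, hM 0 h0])
  have hgd : DifferentiableOn ℂ (dslope φ 0) (Metric.ball 0 ρ) :=
    (Complex.differentiableOn_dslope (Metric.isOpen_ball.mem_nhds h0)).2 hφ
  have h2 := Complex.norm_dslope_le_div_of_mapsTo_ball (R₂ := 4 * M / ρ) hgd (fun s hs => by
    rw [mem_closedBall_iff_norm]
    refine (norm_sub_le _ _).trans ((add_le_add (hg s hs) (hg 0 h0)).trans (le_of_eq ?_))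
    ring) h1
  have h3 : dslope (dslope φ 0) 0 1 = φ 1 - φ 0 - deriv φ 0 := by
    rw [dslope_of_ne _ one_ne_zero, slope_def_field, dslope_same, dslope_of_ne _ one_ne_zero,
      slope_def_field]
    simp
  rw [h3] at h2
  refine h2.trans (le_of_eq ?_)
  field_simp

end Functionals

section Products

variable {E E' : Type*} [NormedAddCommGroup E] [NormedSpace ℂ E] [NormedAddCommGroup E']
  [NormedSpace ℂ E']

/-- A continuous functional applied to a holomorphic family is holomorphic. -/
lemma differentiableOn_family [FiniteDimensional ℂ E] {X : Set E} {Y K : Set E'}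
    (hX : IsOpen X) (hY : IsOpen Y) (hK : IsCompact K) (hKY : K ⊆ Y) {F : E × E' → ℂ}
    (hF : DifferentiableOn ℂ F (X ×ˢ Y)) (b : StrongDual ℂ C(K, ℂ)) (Φ : E → C(K, ℂ))
    (hΦ : ∀ z ∈ X, ∀ w : K, Φ z w = F (z, w)) : DifferentiableOn ℂ (fun z => b (Φ z)) X := by
  have : CompactSpace K := isCompact_iff_compactSpace.1 hK
  have : ProperSpace E := FiniteDimensional.proper ℂ E
  have hFat : ∀ z ∈ X, ∀ w ∈ Y, DifferentiableAt ℂ F (z, w) := fun z hz w hw =>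
    hF.differentiableAt ((hX.prod hY).mem_nhds ⟨hz, hw⟩)
  intro z₀ hz₀
  refine DifferentiableAt.differentiableWithinAt ?_
  obtain ⟨δ, hδ, hball⟩ := Metric.nhds_basis_closedBall.mem_iff.1 (hX.mem_nhds hz₀)
  obtain ⟨M, hM⟩ := ((isCompact_closedBall z₀ δ).prod hK).exists_bound_of_continuousOn
    (hF.continuousOn.mono (prod_mono hball hKY))
  have key : ∀ w ∈ K, ∀ h : E, 2 * ‖h‖ ≤ δ →
      ‖F (z₀ + h, w) - F (z₀, w) - fderiv ℂ F (z₀, w) (h, 0)‖ ≤ 4 * M / δ ^ 2 * ‖h‖ ^ 2 := by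
    intro w hw h hh
    rcases eq_or_ne h 0 with rfl | hne
    · simp only [add_zero, sub_self, zero_sub, norm_neg, norm_zero]
      rw [show ((0 : E), (0 : E')) = 0 from rfl, map_zero]
      simp
    have hn : 0 < ‖h‖ := norm_pos_iff.2 hne
    have hmem : ∀ t ∈ Metric.ball (0 : ℂ) (δ / ‖h‖), z₀ + t • h ∈ Metric.closedBall z₀ δ := by
      intro t ht
      rw [mem_closedBall_iff_norm, add_sub_cancel_left, norm_smul]
      rw [mem_ball_zero_iff, lt_div_iff₀ hn] at ht
      exact ht.le
    have hd : ∀ t ∈ Metric.ball (0 : ℂ) (δ / ‖h‖), HasDerivAt (fun t : ℂ => F (z₀ + t • h, w))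
        (fderiv ℂ F (z₀ + t • h, w) (h, 0)) t := by
      intro t ht
      have h1 := (hFat _ (hball (hmem t ht)) w (hKY hw)).hasFDerivAt
      have h2 : HasDerivAt (fun t : ℂ => (z₀ + t • h, w)) (h, 0) t := by
        refine HasDerivAt.prodMk ?_ (hasDerivAt_const t w)
        simpa using ((hasDerivAt_id t).smul_const h).const_add z₀
      exact h1.comp_hasDerivAt t h2
    have h3 := second_order (φ := fun t : ℂ => F (z₀ + t • h, w)) (ρ := δ / ‖h‖) (M := M)
      (by rw [lt_div_iff₀ hn]; linarith)
      (fun t ht => (hd t ht).differentiableAt.differentiableWithinAt)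
      (fun t ht => hM _ ⟨hmem t ht, hw⟩)
    have h4 := (hd 0 (Metric.mem_ball_self (by positivity))).deriv
    rw [h4] at h3
    simp only [one_smul, zero_smul, add_zero] at h3
    refine h3.trans (le_of_eq ?_)
    field_simp
  have hL : ∀ h : E, Continuous fun w : K => fderiv ℂ F (z₀, (w : E')) (h, 0) := by
    intro h
    refine continuous_of_uniform_approx_of_continuous fun u hu => ?_
    obtain ⟨ε, hε, hu⟩ := Metric.mem_uniformity_dist.1 hu
    set A := 4 * M / δ ^ 2 * ‖h‖ ^ 2
    obtain ⟨t, ht0, ht1, ht2⟩ : ∃ t : ℝ, 0 < t ∧ 2 * (t * ‖h‖) ≤ δ ∧ A * t < ε := by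
      refine ⟨min (δ / (2 * ‖h‖ + 1)) (ε / (2 * (|A| + 1))), by positivity, ?_, ?_⟩
      · have := min_le_left (δ / (2 * ‖h‖ + 1)) (ε / (2 * (|A| + 1)))
        calc 2 * (_ * ‖h‖) ≤ 2 * (δ / (2 * ‖h‖ + 1) * ‖h‖) := by gcongr
          _ = δ * (2 * ‖h‖ / (2 * ‖h‖ + 1)) := by ring
          _ ≤ δ * 1 := by
            gcongr
            rw [div_le_one (by positivity)]; linarith
          _ = δ := mul_one δ
      · have := min_le_right (δ / (2 * ‖h‖ + 1)) (ε / (2 * (|A| + 1)))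
        calc A * _ ≤ |A| * _ := by gcongr; exact le_abs_self A
          _ ≤ |A| * (ε / (2 * (|A| + 1))) := by gcongr
          _ = ε * (|A| / (2 * (|A| + 1))) := by ring
          _ < ε * 1 := by
            gcongr
            rw [div_lt_one (by positivity)]; linarith [abs_nonneg A]
          _ = ε := mul_one ε
    have htc : ((t : ℝ) : ℂ) ≠ 0 := by exact_mod_cast ht0.ne'
    have hth : ‖((t : ℝ) : ℂ) • h‖ = t * ‖h‖ := by
      rw [norm_smul, Complex.norm_real, Real.norm_of_nonneg ht0.le]
    have hmem : z₀ + ((t : ℝ) : ℂ) • h ∈ X := hball (by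
      rw [mem_closedBall_iff_norm, add_sub_cancel_left, hth]
      nlinarith [norm_nonneg h])
    refine ⟨fun w => ((t : ℝ) : ℂ)⁻¹ * (Φ (z₀ + ((t : ℝ) : ℂ) • h) w - Φ z₀ w), by fun_prop,
      fun w => hu ?_⟩
    beta_reduce
    rw [hΦ _ hmem, hΦ _ hz₀, dist_comm, dist_eq_norm]
    have h5 := key w w.2 (((t : ℝ) : ℂ) • h) (by rw [hth]; exact ht1)
    have h6 : fderiv ℂ F (z₀, (w : E')) (((t : ℝ) : ℂ) • h, 0) =
        (t : ℂ) * fderiv ℂ F (z₀, (w : E')) (h, 0) := by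
      rw [← smul_eq_mul, ← map_smul]; simp
    rw [h6, hth] at h5
    have h7 : ((t : ℝ) : ℂ)⁻¹ * (F (z₀ + ((t : ℝ) : ℂ) • h, (w : E')) - F (z₀, (w : E'))) -
        fderiv ℂ F (z₀, (w : E')) (h, 0) = ((t : ℝ) : ℂ)⁻¹ *
          (F (z₀ + ((t : ℝ) : ℂ) • h, (w : E')) - F (z₀, (w : E')) -
            (t : ℂ) * fderiv ℂ F (z₀, (w : E')) (h, 0)) := by
      field_simp
    rw [h7, norm_mul, norm_inv, Complex.norm_real, Real.norm_of_nonneg ht0.le,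
      inv_mul_lt_iff₀ ht0]
    refine h5.trans_lt ?_
    calc _ = t * (A * t) := by simp only [A]; ring
      _ < t * ε := by gcongr
  let L : E →ₗ[ℂ] C(K, ℂ) :=
    { toFun := fun h => ⟨_, hL h⟩
      map_add' := fun h h' => by
        ext w
        change fderiv ℂ F (z₀, (w : E')) (h + h', 0) = fderiv ℂ F (z₀, (w : E')) (h, 0) +
          fderiv ℂ F (z₀, (w : E')) (h', 0)
        rw [← map_add]; simp
      map_smul' := fun c h => by
        ext w
        change fderiv ℂ F (z₀, (w : E')) (c • h, 0) = c • fderiv ℂ F (z₀, (w : E')) (h, 0)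
        rw [← map_smul]; simp }
  have hM0 : ∀ w ∈ K, 0 ≤ M := fun w hw =>
    (norm_nonneg _).trans (hM (z₀, w) ⟨Metric.mem_closedBall_self hδ.le, hw⟩)
  have hder : HasFDerivAt Φ (LinearMap.toContinuousLinearMap L) z₀ := by
    rw [hasFDerivAt_iff_isLittleO_nhds_zero]
    refine Asymptotics.IsBigO.trans_isLittleO (g := fun h : E => ‖h‖ ^ 2) ?_ ?_
    · refine Asymptotics.IsBigO.of_bound (|4 * M / δ ^ 2|) ?_
      filter_upwards [Metric.closedBall_mem_nhds (0 : E) (half_pos hδ)] with h hh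
      rw [mem_closedBall_zero_iff] at hh
      rw [ContinuousMap.norm_le _ (by positivity)]
      intro w
      have hmem : z₀ + h ∈ X := hball (by
        rw [mem_closedBall_iff_norm, add_sub_cancel_left]; linarith)
      change ‖Φ (z₀ + h) w - Φ z₀ w - fderiv ℂ F (z₀, (w : E')) (h, 0)‖ ≤ _
      rw [hΦ _ hmem, hΦ _ hz₀]
      refine (key w w.2 h (by linarith)).trans ?_
      rw [Real.norm_of_nonneg (by positivity : 0 ≤ ‖h‖ ^ 2)]
      exact mul_le_mul_of_nonneg_right (le_abs_self _) (by positivity)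
    · have := Asymptotics.isLittleO_norm_pow_id (E' := E) (n := 2) (by norm_num)
      exact this
  exact (b.differentiableAt.comp z₀ hder.differentiableAt)

/-- Restriction of a holomorphic function on `X × Y` to a slice. -/
def sliceR {X : Set E} {Y : Set E'} (f : Hol (X ×ˢ Y)) (z : X) : Hol Y :=
  ⟨fun w => f.1 ⟨(z, w), z.2, w.2⟩, by
    obtain ⟨F, hF, hf⟩ := f.2
    exact ⟨fun w => F (z, w), hF.comp
      ((differentiable_const _).prodMk differentiable_id).differentiableOn fun w hw => ⟨z.2, hw⟩,
      fun w => hf ⟨(z, w), z.2, w.2⟩⟩⟩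

/-- The holomorphic function `z ↦ β (w ↦ f (z, w))`. -/
def integrateR [FiniteDimensional ℂ E] {X : Set E} {Y : Set E'} (hX : IsOpen X) (hY : IsOpen Y)
    (β : OPrime Y) (f : Hol (X ×ˢ Y)) : Hol X :=
  ⟨fun z => β.1 (sliceR f z), by
    classical
    obtain ⟨F, hF, hf⟩ := f.2
    obtain ⟨K, hKY, hK, b, hb⟩ := exists_extension β
    refine ⟨_, differentiableOn_family hX hY hK hKY hF b
      (fun z => if h : z ∈ X then resC hKY (sliceR f ⟨z, h⟩) else 0) ?_, ?_⟩
    · intro z hz w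
      rw [dif_pos hz]
      exact (hf ⟨(z, w), hz, hKY w.2⟩).symm
    · intro z
      simp only [z.2, dif_pos, hb]⟩

/-- The external product `α × β` of analytic functionals,
`(α × β)(f) = α (z ↦ β (w ↦ f (z, w)))`. -/
def extProd [FiniteDimensional ℂ E] {X : Set E} {Y : Set E'} (hX : IsOpen X) (hY : IsOpen Y) :
    OPrime X →ₗ[ℂ] OPrime Y →ₗ[ℂ] OPrime (X ×ˢ Y) :=
  LinearMap.mk₂ ℂ (fun α β => .mk
    { toFun := fun f => α.1 (integrateR hX hY β f)
      map_add' := fun f g => by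
        rw [← map_add]; congr 1; ext z
        exact map_add β.1 (sliceR f z) (sliceR g z)
      map_smul' := fun c f => by
        rw [← map_smul]; congr 1; ext z
        exact map_smul β.1 c (sliceR f z) } (by
    obtain ⟨K, hKX, hK, C, hα⟩ := α.2
    obtain ⟨K', hKY, hK', C', hβ⟩ := β.2
    refine ⟨K ×ˢ K', prod_mono hKX hKY, hK.prod hK', C * max C' 0, fun f M hM hf => ?_⟩
    rw [mul_assoc]
    refine hα _ _ (mul_nonneg (le_max_right _ _) hM) fun z hz => ?_
    exact (hβ.mono subset_rfl (le_max_left C' 0)) _ M hM fun w hw => hf _ ⟨hz, hw⟩))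
    (fun α α' β => rfl) (fun c α β => rfl)
    (fun α β β' => by
      refine OPrime.ext' fun f => ?_
      change α.1 (integrateR hX hY (β + β') f) = α.1 (integrateR hX hY β f) +
        α.1 (integrateR hX hY β' f)
      rw [← map_add]; rfl)
    (fun c α β => by
      refine OPrime.ext' fun f => ?_
      change α.1 (integrateR hX hY (c • β) f) = c • α.1 (integrateR hX hY β f)
      rw [← map_smul]; rfl)

lemma extProd_apply [FiniteDimensional ℂ E] {X : Set E} {Y : Set E'} (hX : IsOpen X)
    (hY : IsOpen Y) (α : OPrime X) (β : OPrime Y) (f : Hol (X ×ˢ Y)) :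
    (extProd hX hY α β).1 f = α.1 (integrateR hX hY β f) := rfl

lemma bddMap₂_extProd [FiniteDimensional ℂ E] {X : Set E} {Y : Set E'} (hX : IsOpen X)
    (hY : IsOpen Y) : BddMap₂ (functBorn X) (functBorn Y) (functBorn (X ×ˢ Y))
      fun α β => extProd hX hY α β := by
  intro B B' hB hB'
  obtain ⟨K, hKX, hK, C, hC, hα⟩ := bdd_funct.1 hB
  obtain ⟨K', hKY, hK', C', hC', hβ⟩ := bdd_funct.1 hB'
  refine bdd_funct.2 ⟨K ×ˢ K', prod_mono hKX hKY, hK.prod hK', C * C', mul_nonneg hC hC', ?_⟩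
  rintro _ ⟨α, hα', β, hβ', rfl⟩ f M hM hf
  rw [mul_assoc]
  exact hα α hα' _ _ (mul_nonneg hC' hM) fun z hz =>
    hβ β hβ' _ M hM fun w hw => hf _ ⟨hz, hw⟩

/-! The external product is commutative. -/

lemma dense_products (K K' : Type*) [TopologicalSpace K] [CompactSpace K]
    [TopologicalSpace K'] [CompactSpace K'] [T2Space K] [T2Space K'] (P : C(K × K', ℂ) → Prop)
    (hP : IsClosed {G | P G}) (hadd : ∀ G G', P G → P G' → P (G + G'))
    (hprod : ∀ (g : C(K, ℂ)) (h : C(K', ℂ)), P (g.comp .fst * h.comp .snd)) : ∀ G, P G := by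
  let i : C(K, ℂ) →⋆ₐ[ℂ] C(K × K', ℂ) := ContinuousMap.compStarAlgHom' ℂ ℂ .fst
  let j : C(K', ℂ) →⋆ₐ[ℂ] C(K × K', ℂ) := ContinuousMap.compStarAlgHom' ℂ ℂ .snd
  let S : Subalgebra ℂ C(K × K', ℂ) :=
    (Algebra.TensorProduct.productMap i.toAlgHom j.toAlgHom).range
  have hS : ∀ G ∈ S, P G := by
    rintro _ ⟨t, rfl⟩
    induction t using TensorProduct.induction_on with
    | zero =>
      have := hprod 0 0
      simpa using this
    | tmul g h =>
      simp
      exact hprod g h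
    | add s t hs ht => simpa using hadd _ _ hs ht
  let S' : StarSubalgebra ℂ C(K × K', ℂ) :=
    { S with
      star_mem' := by
        rintro _ ⟨t, rfl⟩
        induction t using TensorProduct.induction_on with
        | zero => simp
        | tmul g h =>
          refine ⟨star g ⊗ₜ star h, ?_⟩
          simp [map_star]
        | add s t hs ht =>
          have := S.add_mem hs ht
          simpa using this }
  have hsep : S'.toSubalgebra.SeparatesPoints := by
    intro x y hxy
    by_cases h1 : x.1 = y.1
    · have h2 : x.2 ≠ y.2 := fun h => hxy (Prod.ext h1 h)
      obtain ⟨g, hg⟩ := exists_continuous_zero_one_of_isClosed (isClosed_singleton (x := x.2))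
        (isClosed_singleton (x := y.2)) (by simpa using h2)
      let g' : C(K', ℂ) := ⟨fun z => (g z : ℂ), by fun_prop⟩
      refine ⟨_, ⟨j g', ⟨1 ⊗ₜ g', by simp⟩, rfl⟩, ?_⟩
      have e1 := hg.1 rfl
      have e2 := hg.2.1 rfl
      simp [j, g', e1, e2]
    · obtain ⟨g, hg⟩ := exists_continuous_zero_one_of_isClosed (isClosed_singleton (x := x.1))
        (isClosed_singleton (x := y.1)) (by simpa using h1)
      let g' : C(K, ℂ) := ⟨fun z => (g z : ℂ), by fun_prop⟩
      refine ⟨_, ⟨i g', ⟨g' ⊗ₜ 1, by simp⟩, rfl⟩, ?_⟩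
      have e1 := hg.1 rfl
      have e2 := hg.2.1 rfl
      simp [i, g', e1, e2]
  have htop := ContinuousMap.starSubalgebra_topologicalClosure_eq_top_of_separatesPoints S' hsep
  intro G
  have hG : G ∈ S'.topologicalClosure := by rw [htop]; trivial
  exact closure_minimal (s := (S' : Set C(K × K', ℂ))) (fun G hG => hS G hG) hP hG

lemma fubini_functionals {K K' : Type*} [TopologicalSpace K] [CompactSpace K]
    [TopologicalSpace K'] [CompactSpace K'] [T2Space K] [T2Space K']
    (a : StrongDual ℂ C(K, ℂ)) (b : StrongDual ℂ C(K', ℂ)) (G : C(K × K', ℂ)) :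
    a ((b : C(C(K', ℂ), ℂ)).comp G.curry) =
      b ((a : C(C(K, ℂ), ℂ)).comp (G.comp ContinuousMap.prodSwap).curry) := by
  revert G
  apply dense_products
  · refine isClosed_eq ?_ ?_
    · exact a.continuous.comp ((ContinuousMap.continuous_postcomp _).comp
        ContinuousMap.continuous_curry)
    · exact b.continuous.comp ((ContinuousMap.continuous_postcomp _).comp
        (ContinuousMap.continuous_curry.comp (ContinuousMap.continuous_precomp _)))
  · intro G G' h h'
    have e1 : (b : C(C(K', ℂ), ℂ)).comp (G + G').curry =
        (b : C(C(K', ℂ), ℂ)).comp G.curry + (b : C(C(K', ℂ), ℂ)).comp G'.curry := by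
      ext x
      exact map_add b (G.curry x) (G'.curry x)
    have e2 : (a : C(C(K, ℂ), ℂ)).comp ((G + G').comp ContinuousMap.prodSwap).curry =
        (a : C(C(K, ℂ), ℂ)).comp (G.comp ContinuousMap.prodSwap).curry +
        (a : C(C(K, ℂ), ℂ)).comp (G'.comp ContinuousMap.prodSwap).curry := by
      ext x
      exact map_add a ((G.comp ContinuousMap.prodSwap).curry x)
        ((G'.comp ContinuousMap.prodSwap).curry x)
    rw [e1, e2, map_add, map_add, h, h']
  · intro g h
    have e1 : (b : C(C(K', ℂ), ℂ)).comp (g.comp .fst * h.comp .snd).curry = b h • g := by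
      ext x
      have : (g.comp .fst * h.comp .snd : C(K × K', ℂ)).curry x = g x • h := by ext y; rfl
      change b ((g.comp .fst * h.comp .snd : C(K × K', ℂ)).curry x) = b h • g x
      rw [this, map_smul, smul_eq_mul, smul_eq_mul, mul_comm]
    have e2 : (a : C(C(K, ℂ), ℂ)).comp
        ((g.comp .fst * h.comp .snd : C(K × K', ℂ)).comp ContinuousMap.prodSwap).curry =
        a g • h := by
      ext y
      have : ((g.comp .fst * h.comp .snd : C(K × K', ℂ)).comp ContinuousMap.prodSwap).curry y =
          h y • g := by
        ext x
        change g x * h y = h y * g x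
        exact mul_comm _ _
      change a (((g.comp .fst * h.comp .snd : C(K × K', ℂ)).comp
        ContinuousMap.prodSwap).curry y) = a g • h y
      rw [this, map_smul, smul_eq_mul, smul_eq_mul, mul_comm]
    rw [e1, e2, map_smul, map_smul, smul_eq_mul, smul_eq_mul, mul_comm]

lemma mapsTo_swap (X : Set E) (Y : Set E') : MapsTo Prod.swap (X ×ˢ Y) (Y ×ˢ X) :=
  fun _ h => ⟨h.2, h.1⟩

lemma extProd_comm [FiniteDimensional ℂ E] [FiniteDimensional ℂ E'] {X : Set E} {Y : Set E'}
    (hX : IsOpen X) (hY : IsOpen Y) (α : OPrime X) (β : OPrime Y) :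
    push (X := X ×ˢ Y) (Y := Y ×ˢ X) Prod.swap (differentiable_snd.prodMk differentiable_fst) (mapsTo_swap X Y)
      (extProd hX hY α β) = extProd hY hX β α := by
  refine OPrime.ext' fun f => ?_
  obtain ⟨K, hKX, hK, a, ha⟩ := exists_extension α
  obtain ⟨K', hKY, hK', b, hb⟩ := exists_extension β
  have : CompactSpace K := isCompact_iff_compactSpace.1 hK
  have : CompactSpace K' := isCompact_iff_compactSpace.1 hK'
  let G : C(K × K', ℂ) := ⟨fun p => f.1 (⟨((p.2 : E'), (p.1 : E)), hKY p.2.2, hKX p.1.2⟩ : ↥(Y ×ˢ X)),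
    (Hol.continuous f).comp (by fun_prop)⟩
  rw [push_apply, extProd_apply, extProd_apply, ha, hb]
  refine Eq.trans ?_ ((fubini_functionals a b G).trans ?_)
  · congr 1
    ext z
    exact hb _
  · congr 1
    ext w
    exact (ha (sliceR f ⟨w, hKY w.2⟩)).symm

end Products

/-! ### Affine transformations of the plane -/

/-- The affine transformation `z ↦ lam * z + tr`; together these form the group `ℂˣ ⋉ ℂ`. -/
@[ext] structure Aff where
  lam : ℂˣ
  tr : ℂ

namespace Aff

/-- The action on the plane. -/
def act (g : Aff) (z : ℂ) : ℂ := g.lam * z + g.tr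

instance : Mul Aff := ⟨fun g h => ⟨g.lam * h.lam, g.lam * h.tr + g.tr⟩⟩
instance : One Aff := ⟨⟨1, 0⟩⟩
instance : Inv Aff := ⟨fun g => ⟨g.lam⁻¹, -((g.lam⁻¹ : ℂˣ) * g.tr)⟩⟩

lemma act_mul (g h : Aff) (z : ℂ) : (g * h).act z = g.act (h.act z) := by
  change ((g.lam * h.lam : ℂˣ) : ℂ) * z + (g.lam * h.tr + g.tr) = g.lam * (h.lam * z + h.tr) + g.tr
  push_cast; ring

lemma act_one (z : ℂ) : (1 : Aff).act z = z := by
  change ((1 : ℂˣ) : ℂ) * z + 0 = z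
  simp

instance : Group Aff := Group.ofLeftAxioms
  (fun a b c => by
    ext
    · change ((a.lam * b.lam * c.lam : ℂˣ) : ℂ) = (a.lam * (b.lam * c.lam) : ℂˣ)
      rw [mul_assoc]
    · change ((a.lam * b.lam : ℂˣ) : ℂ) * c.tr + (a.lam * b.tr + a.tr) =
        a.lam * (b.lam * c.tr + b.tr) + a.tr
      push_cast; ring)
  (fun a => by
    ext
    · change ((1 * a.lam : ℂˣ) : ℂ) = a.lam
      simp
    · change ((1 : ℂˣ) : ℂ) * a.tr + 0 = a.tr
      simp)
  (fun a => by
    ext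
    · change ((a.lam⁻¹ * a.lam : ℂˣ) : ℂ) = (1 : ℂˣ)
      simp
    · change ((a.lam⁻¹ : ℂˣ) : ℂ) * a.tr + -((a.lam⁻¹ : ℂˣ) * a.tr) = 0
      ring)

lemma act_injective (g : Aff) : Function.Injective g.act := fun z w h => by
  have : (g.lam : ℂ) * z = g.lam * w := add_right_cancel h
  exact mul_left_cancel₀ g.lam.ne_zero this

lemma differentiable_act (g : Aff) : Differentiable ℂ g.act := by
  unfold act; fun_prop

/-- The image `gU` of an open set. -/
def map (g : Aff) (U : Opens ℂ) : Opens ℂ :=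
  ⟨g.act '' U, by
    have h : g.act '' U = (g⁻¹).act ⁻¹' U := by
      ext z
      constructor
      · rintro ⟨w, hw, rfl⟩
        rw [mem_preimage, ← act_mul, inv_mul_cancel, act_one]; exact hw
      · intro hz
        exact ⟨_, hz, by rw [← act_mul, mul_inv_cancel, act_one]⟩
    rw [h]
    exact U.2.preimage (g⁻¹).differentiable_act.continuous⟩

lemma act_mem_map (g : Aff) {U : Opens ℂ} {z : ℂ} (hz : z ∈ U) : g.act z ∈ g.map U :=
  ⟨z, hz, rfl⟩

lemma map_mono (g : Aff) {U V : Opens ℂ} (h : U ≤ V) : g.map U ≤ g.map V :=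
  fun _ ⟨w, hw, e⟩ => ⟨w, h hw, e⟩

lemma map_one (U : Opens ℂ) : (1 : Aff).map U = U := by
  ext z
  constructor
  · rintro ⟨w, hw, rfl⟩
    rw [act_one]; exact hw
  · exact fun hz => ⟨z, hz, act_one z⟩

lemma map_mul (g h : Aff) (U : Opens ℂ) : (g * h).map U = g.map (h.map U) := by
  ext z
  constructor
  · rintro ⟨w, hw, rfl⟩
    exact ⟨_, ⟨w, hw, rfl⟩, (act_mul g h w).symm⟩
  · rintro ⟨_, ⟨w, hw, rfl⟩, rfl⟩
    exact ⟨w, hw, act_mul g h w⟩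

lemma _root_.FactVA.disjoint_iff_mem {U V : Opens ℂ} :
    Disjoint U V ↔ ∀ z, z ∈ U → z ∈ V → False := by
  rw [← Opens.coe_disjoint, Set.disjoint_left]; rfl

lemma map_disjoint (g : Aff) {U V : Opens ℂ} (h : Disjoint U V) :
    Disjoint (g.map U) (g.map V) := by
  rw [disjoint_iff_mem] at h ⊢
  rintro _ ⟨z, hz, rfl⟩ ⟨w, hw, e⟩
  rw [g.act_injective e] at hw
  exact h z hz hw

end Aff

/-! ### Affine-linearly invariant prefactorization algebras on the plane -/

/-- Affine-linearly invariant (unital) prefactorization algebras on `ℂ` with values in bornological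
vector spaces. The multiplication maps are given as bounded bilinear maps. The extension map of an
inclusion `U ≤ W` is multiplication with the unit of the value on the empty set; this extension map
is also used to identify the values on equal open sets, such as `U` and `1 U`. -/
structure AffPFA where
  obj : Opens ℂ → Type u
  [grp : ∀ U, AddCommGroup (obj U)]
  [mod : ∀ U, Module ℂ (obj U)]
  born : ∀ U, Bornology (obj U)
  isBVS : ∀ U, IsBVS (born U)
  mul : ∀ {U V W : Opens ℂ}, Disjoint U V → U ≤ W → V ≤ W → obj U →ₗ[ℂ] obj V →ₗ[ℂ] obj W
  mul_bdd : ∀ {U V W : Opens ℂ} (h : Disjoint U V) (hU : U ≤ W) (hV : V ≤ W),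
    BddMap₂ (born U) (born V) (born W) fun x y => mul h hU hV x y
  one : obj ⊥
  mul_assoc : ∀ {U₁ U₂ U₃ V₁ V₂ W : Opens ℂ} (h₁₂ : Disjoint U₁ U₂) (h₂₃ : Disjoint U₂ U₃)
    (h₁ : Disjoint U₁ V₂) (h₃ : Disjoint V₁ U₃) (i₁ : U₁ ≤ V₁) (i₂ : U₂ ≤ V₁) (i₂' : U₂ ≤ V₂)
    (i₃ : U₃ ≤ V₂) (hV₁ : V₁ ≤ W) (hV₂ : V₂ ≤ W) (x : obj U₁) (y : obj U₂) (z : obj U₃),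
    mul h₃ hV₁ (i₃.trans hV₂) (mul h₁₂ i₁ i₂ x y) z =
      mul h₁ (i₁.trans hV₁) hV₂ x (mul h₂₃ i₂' i₃ y z)
  mul_one : ∀ {U : Opens ℂ} (x : obj U), mul disjoint_bot_right le_rfl bot_le x one = x
  mul_comm : ∀ {U V W : Opens ℂ} (h : Disjoint U V) (hU : U ≤ W) (hV : V ≤ W)
    (x : obj U) (y : obj V), mul h.symm hV hU y x = mul h hU hV x y
  act : ∀ (g : Aff) (U : Opens ℂ), obj U →ₗ[ℂ] obj (g.map U)
  act_bdd : ∀ (g : Aff) (U : Opens ℂ), BddMap (born U) (born (g.map U)) (act g U)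
  act_one : ∀ {U : Opens ℂ} (x : obj U),
    act 1 U x = mul disjoint_bot_right (Aff.map_one U).ge bot_le x one
  act_mul : ∀ (g h : Aff) {U : Opens ℂ} (x : obj U),
    act (g * h) U x =
      mul disjoint_bot_right (Aff.map_mul g h U).ge bot_le (act g (h.map U) (act h U x)) one
  act_unit : ∀ g : Aff, act g ⊥ one = mul disjoint_bot_right bot_le bot_le one one
  act_mul_map : ∀ (g : Aff) {U V W : Opens ℂ} (h : Disjoint U V) (hU : U ≤ W) (hV : V ≤ W)
    (x : obj U) (y : obj V), act g W (mul h hU hV x y) =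
      mul (g.map_disjoint h) (g.map_mono hU) (g.map_mono hV) (act g U x) (act g V y)

attribute [instance] AffPFA.grp AffPFA.mod

/-! ### Configuration spaces and expressions -/

/-- `U^ι ∖ Δ`. -/
def Conf (U : Set ℂ) (ι : Type) : Set (ι → ℂ) := {z | (∀ i, z i ∈ U) ∧ Function.Injective z}

lemma isOpen_conf {U : Set ℂ} (hU : IsOpen U) (ι : Type) [Finite ι] : IsOpen (Conf U ι) := by
  have : Conf U ι = (⋂ i, {z | z i ∈ U}) ∩ ⋂ (i : ι) (j : ι) (_ : i ≠ j), {z | z i ≠ z j} := by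
    ext z
    simp only [Conf, Set.mem_ofPred_eq, mem_inter_iff, mem_iInter, Function.Injective]
    refine and_congr Iff.rfl ⟨fun h i j hij e => hij (h e), fun h i j e => ?_⟩
    by_contra hij
    exact h i j hij e
  rw [this]
  refine IsOpen.inter (isOpen_iInter_of_finite fun i => hU.preimage (continuous_apply i))
    (isOpen_iInter_of_finite fun i => isOpen_iInter_of_finite fun j =>
      isOpen_iInter_of_finite fun _ => ?_)
  exact isOpen_ne_fun (continuous_apply i) (continuous_apply j)

section Graded

variable (V : ℤ → Type u) [∀ k, AddCommGroup (V k)] [∀ k, Module ℂ (V k)]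

/-- The total space of a `ℤ`-graded vector space. -/
abbrev Tot : Type u := ⨁ k, V k

/-- `λ^{L₀}`, acting on degree `k` by `λ^k`. -/
def scale (lam : ℂˣ) : Tot V →ₗ[ℂ] Tot V :=
  DFinsupp.mapRange.linearMap fun k => ((lam ^ k : ℂˣ) : ℂ) • LinearMap.id

lemma scale_apply (lam : ℂˣ) (a : Tot V) (k : ℤ) :
    (scale V lam a) k = ((lam ^ k : ℂˣ) : ℂ) • a k := rfl

end Graded

/-- The tensor product of vector spaces. -/
abbrev BTensor (X Y : Type*) [AddCommGroup X] [Module ℂ X] [AddCommGroup Y] [Module ℂ Y] :=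
  X ⊗[ℂ] Y

section TensorPowers

variable (M : Type u) [AddCommGroup M] [Module ℂ M] (ι : Type)

/-- The tensor power `M^{⊗ ι}`. -/
def TPow : Type u := ⨂[ℂ] _ : ι, M

instance : AddCommGroup (TPow M ι) := inferInstanceAs (AddCommGroup (⨂[ℂ] _ : ι, M))

instance : Module ℂ (TPow M ι) := inferInstanceAs (Module ℂ (⨂[ℂ] _ : ι, M))

variable {M ι} {κ : Type}

/-- The pure tensors. -/
def tprod : MultilinearMap ℂ (fun _ : ι => M) (TPow M ι) := PiTensorProduct.tprod ℂ

/-- The linear map induced by a multilinear map. -/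
def tlift {P : Type*} [AddCommGroup P] [Module ℂ P] (f : MultilinearMap ℂ (fun _ : ι => M) P) :
    TPow M ι →ₗ[ℂ] P := PiTensorProduct.lift f

lemma tlift_tprod {P : Type*} [AddCommGroup P] [Module ℂ P]
    (f : MultilinearMap ℂ (fun _ : ι => M) P) (a : ι → M) : tlift f (tprod a) = f a :=
  PiTensorProduct.lift.tprod a

/-- Relabelling of the factors. -/
def treindex (e : ι ≃ κ) : TPow M ι →ₗ[ℂ] TPow M κ :=
  (PiTensorProduct.reindex ℂ (fun _ => M) e).toLinearMap

lemma treindex_tprod (e : ι ≃ κ) (a : ι → M) :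
    treindex e (tprod a) = tprod fun j => a (e.symm j) := PiTensorProduct.reindex_tprod e a

/-- The multiplication of tensors. -/
def tmulT : TPow M ι →ₗ[ℂ] TPow M κ →ₗ[ℂ] TPow M (ι ⊕ κ) :=
  LinearMap.compr₂ (TensorProduct.mk ℂ (⨂[ℂ] _ : ι, M) (⨂[ℂ] _ : κ, M))
    (PiTensorProduct.tmulEquiv ℂ M).toLinearMap

lemma tmulT_tprod (a : ι → M) (b : κ → M) :
    tmulT (tprod a) (tprod b) = tprod (Sum.elim a b) := PiTensorProduct.tmulEquiv_apply ℂ M a b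

/-- `s^{⊗ ι}`. -/
def tmap (s : M →ₗ[ℂ] M) : TPow M ι →ₗ[ℂ] TPow M ι := PiTensorProduct.map fun _ => s

lemma tmap_tprod (s : M →ₗ[ℂ] M) (a : ι → M) : tmap s (tprod a) = tprod fun i => s (a i) :=
  PiTensorProduct.map_tprod _ a

lemma tpow_induction {p : TPow M ι → Prop} (h : ∀ (r : ℂ) (a : ι → M), p (r • tprod a))
    (hadd : ∀ s t, p s → p t → p (s + t)) : ∀ t, p t := fun t =>
  PiTensorProduct.induction_on (motive := p) t h hadd

end TensorPowers

section Expressions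

variable {ι κ τ : Type}

lemma mapsTo_reindex (U : Set ℂ) (e : ι ≃ κ) :
    MapsTo (fun (z : ι → ℂ) (j : κ) => z (e.symm j)) (Conf U ι) (Conf U κ) :=
  fun _ hz => ⟨fun _ => hz.1 _, fun _ _ h => e.symm.injective (hz.2 h)⟩

lemma mapsTo_act (g : Aff) (U : Opens ℂ) :
    MapsTo (fun (z : ι → ℂ) (i : ι) => g.act (z i)) (Conf U ι) (Conf (g.map U) ι) :=
  fun _ hz => ⟨fun i => g.act_mem_map (hz.1 i), fun _ _ h => hz.2 (g.act_injective h)⟩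

lemma mapsTo_id {U V : Opens ℂ} (h : U ≤ V) : MapsTo id (Conf (U : Set ℂ) ι) (Conf V ι) :=
  fun _ hz => ⟨fun i => h (hz.1 i), hz.2⟩

lemma mapsTo_elim {U V W : Opens ℂ} (h : Disjoint U V) (hU : U ≤ W) (hV : V ≤ W) :
    MapsTo (fun (p : (ι → ℂ) × (κ → ℂ)) => (Sum.elim p.1 p.2 : ι ⊕ κ → ℂ))
      (Conf (U : Set ℂ) ι ×ˢ Conf (V : Set ℂ) κ) (Conf W (ι ⊕ κ)) := by
  rintro ⟨z, w⟩ ⟨hz, hw⟩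
  rw [disjoint_iff_mem] at h
  refine ⟨?_, ?_⟩
  · rintro (i | j)
    · exact hU (hz.1 i)
    · exact hV (hw.1 j)
  · rintro (i | i) (j | j) e
    · exact congrArg _ (hz.2 e)
    · exact (h _ (hz.1 i) (show z i ∈ V from (show z i = w j from e) ▸ hw.1 j)).elim
    · exact (h _ (hz.1 j) (show z j ∈ V from (show w i = z j from e) ▸ hw.1 i)).elim
    · exact congrArg _ (hw.2 e)

variable [Fintype ι] [Fintype κ] [Fintype τ]

lemma differentiable_reindex (e : ι ≃ κ) :
    Differentiable ℂ (fun (z : ι → ℂ) (j : κ) => z (e.symm j)) := by fun_prop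

lemma differentiable_act' (g : Aff) :
    Differentiable ℂ (fun (z : ι → ℂ) (i : ι) => g.act (z i)) := by
  unfold Aff.act; fun_prop

lemma differentiable_elim : Differentiable ℂ
    (fun (p : (ι → ℂ) × (κ → ℂ)) => (Sum.elim p.1 p.2 : ι ⊕ κ → ℂ)) := by
  rw [differentiable_pi]
  rintro (i | j)
  · change Differentiable ℂ fun p : (ι → ℂ) × (κ → ℂ) => p.1 i
    fun_prop
  · change Differentiable ℂ fun p : (ι → ℂ) × (κ → ℂ) => p.2 j
    fun_prop

/-- The product `αβ` of analytic functionals on configuration spaces of disjoint open sets. -/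
def mulFun {U V W : Opens ℂ} (h : Disjoint U V) (hU : U ≤ W) (hV : V ≤ W) :
    OPrime (Conf (U : Set ℂ) ι) →ₗ[ℂ] OPrime (Conf (V : Set ℂ) κ) →ₗ[ℂ]
      OPrime (Conf (W : Set ℂ) (ι ⊕ κ)) :=
  (extProd (isOpen_conf U.2 ι) (isOpen_conf V.2 κ)).compr₂
    (push _ differentiable_elim (mapsTo_elim h hU hV))

variable (M : Type u) [AddCommGroup M] [Module ℂ M]

/-- `𝒪'(U^ι ∖ Δ) ⊗ V^{⊗ ι}`. -/
abbrev Pre (U : Opens ℂ) (ι : Type) [Fintype ι] : Type u :=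
  BTensor (OPrime (Conf (U : Set ℂ) ι)) (TPow M ι)

variable {M}

/-- Relabelling of the points along `e`; the symmetric group actions are the case `ι = κ`. -/
def reix (U : Opens ℂ) (e : ι ≃ κ) : Pre M U ι →ₗ[ℂ] Pre M U κ :=
  TensorProduct.map (push _ (differentiable_reindex e) (mapsTo_reindex U e))
    (treindex e)

variable (M) in
/-- The subspace spanned by the `σ x - x`. -/
def permSub (U : Opens ℂ) (m : ℕ) : Submodule ℂ (Pre M U (Fin m)) :=
  Submodule.span ℂ {x | ∃ (s : Equiv.Perm (Fin m)) (t : Pre M U (Fin m)), x = reix U s t - t}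

variable (M) in
/-- The space `EV(U) = ⨁ₘ (𝒪'(U^m ∖ Δ) ⊗ V^{⊗ m})_{Σₘ}` of expressions. -/
def Expr (U : Opens ℂ) : Type u := ⨁ m : ℕ, (Pre M U (Fin m) ⧸ permSub M U m)

instance (U : Opens ℂ) : AddCommGroup (Expr M U) :=
  inferInstanceAs (AddCommGroup (⨁ m : ℕ, (Pre M U (Fin m) ⧸ permSub M U m)))

instance (U : Opens ℂ) : Module ℂ (Expr M U) :=
  inferInstanceAs (Module ℂ (⨁ m : ℕ, (Pre M U (Fin m) ⧸ permSub M U m)))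

variable (M) in
/-- The inclusion of the summands of `EV(U)`. -/
def exprIn (U : Opens ℂ) (m : ℕ) : (Pre M U (Fin m) ⧸ permSub M U m) →ₗ[ℂ] Expr M U :=
  DirectSum.lof ℂ ℕ (fun m => Pre M U (Fin m) ⧸ permSub M U m) m

variable (M) in
/-- The bornology of `𝒪'(U^ι ∖ Δ) ⊗ V^{⊗ ι}`, where `V^{⊗ ι}` is discrete. -/
@[reducible] def preBorn (U : Opens ℂ) (ι : Type) [Fintype ι] : Bornology (Pre M U ι) :=
  tensorBorn (functBorn (Conf (U : Set ℂ) ι)) (discreteBorn (TPow M ι))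

variable (M) in
/-- The bornology of `EV(U)`. -/
@[reducible] def exprBorn (U : Opens ℂ) : Bornology (Expr M U) :=
  sumBorn fun m => quotBorn (preBorn M U (Fin m)) (permSub M U m)

lemma isBVS_pre (U : Opens ℂ) : IsBVS (preBorn M U ι) := isBVS_tensor (isBVS_funct _)

variable (M) in
lemma isBVS_expr (U : Opens ℂ) : IsBVS (exprBorn M U) :=
  isBVS_sum fun _ => isBVS_quot (isBVS_pre U) _

/-- The class in `EV(U)` of an element whose points are labelled by `ι ≃ Fin m`. -/
def mkE (U : Opens ℂ) {m : ℕ} (e : ι ≃ Fin m) : Pre M U ι →ₗ[ℂ] Expr M U :=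
  exprIn M U m ∘ₗ (permSub M U m).mkQ ∘ₗ reix U e

/-- The class `[α ⊗ a₁ ⊗ ⋯ ⊗ aₘ]`. -/
def cls (U : Opens ℂ) {m : ℕ} (α : OPrime (Conf (U : Set ℂ) (Fin m))) (a : Fin m → M) :
    Expr M U :=
  mkE U (Equiv.refl _) (α ⊗ₜ tprod a)

lemma reix_tmul (U : Opens ℂ) (e : ι ≃ κ) (α : OPrime (Conf (U : Set ℂ) ι)) (a : ι → M) :
    reix U e (α ⊗ₜ tprod a) =
      push _ (differentiable_reindex e) (mapsTo_reindex U e) α ⊗ₜ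
        tprod fun j => a (e.symm j) := by
  rw [reix, TensorProduct.map_tmul]
  congr 1
  exact treindex_tprod e a

/-- Induction for elements of `𝒪' ⊗ V^{⊗ ι}`. -/
lemma pre_induction {U : Opens ℂ} {p : Pre M U ι → Prop} (h0 : p 0)
    (hadd : ∀ s t, p s → p t → p (s + t))
    (h : ∀ (α : OPrime (Conf (U : Set ℂ) ι)) (a : ι → M),
      p (α ⊗ₜ tprod a)) : ∀ t, p t := by
  intro t
  induction t using TensorProduct.induction_on with
  | zero => exact h0
  | tmul α a =>
    refine tpow_induction (p := fun a => p (α ⊗ₜ a)) (fun r a => ?_) (fun a b ha hb => ?_) a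
    · rw [← TensorProduct.smul_tmul]
      exact h _ _
    · rw [TensorProduct.tmul_add]
      exact hadd _ _ ha hb
  | add s t hs ht => exact hadd _ _ hs ht

lemma pre_ext {U : Opens ℂ} {P : Type*} [AddCommGroup P] [Module ℂ P] {f g : Pre M U ι →ₗ[ℂ] P}
    (h : ∀ (α : OPrime (Conf (U : Set ℂ) ι)) (a : ι → M),
      f (α ⊗ₜ tprod a) = g (α ⊗ₜ tprod a)) (t : Pre M U ι) :
    f t = g t :=
  pre_induction (p := fun t => f t = g t) (by simp) (fun s t hs ht => by simp [hs, ht]) h t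

lemma reix_refl (U : Opens ℂ) (t : Pre M U ι) : reix U (Equiv.refl ι) t = t := by
  refine pre_ext (g := LinearMap.id) (fun α a => ?_) t
  rw [reix_tmul]
  rfl

lemma reix_reix (U : Opens ℂ) (e : ι ≃ κ) (e' : κ ≃ τ) (t : Pre M U ι) :
    reix U e' (reix U e t) = reix U (e.trans e') t := by
  refine pre_ext (f := reix U e' ∘ₗ reix U e) (fun α a => ?_) t
  rw [LinearMap.comp_apply, reix_tmul, reix_tmul, reix_tmul]
  rfl

lemma mkE_reix (U : Opens ℂ) {m : ℕ} (e : ι ≃ κ) (e' : κ ≃ Fin m) (t : Pre M U ι) :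
    mkE U e' (reix U e t) = mkE U (e.trans e') t := by
  simp [mkE, reix_reix]

/-- The class does not depend on the enumeration of the points. -/
lemma mkE_eq (U : Opens ℂ) {m m' : ℕ} (e : ι ≃ Fin m) (e' : ι ≃ Fin m') (t : Pre M U ι) :
    mkE U e t = mkE U e' t := by
  obtain rfl : m = m' := by
    simpa using Fintype.card_congr (e.symm.trans e')
  simp only [mkE, LinearMap.comp_apply]
  congr 1
  rw [Submodule.mkQ_apply, Submodule.mkQ_apply, Submodule.Quotient.eq]
  refine Submodule.subset_span ⟨e'.symm.trans e, reix U e' t, ?_⟩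
  rw [reix_reix, ← Equiv.trans_assoc, Equiv.self_trans_symm, Equiv.refl_trans]

lemma expr_induction {U : Opens ℂ} {p : Expr M U → Prop} (h0 : p 0)
    (hadd : ∀ s t, p s → p t → p (s + t))
    (h : ∀ (m : ℕ) (α : OPrime (Conf (U : Set ℂ) (Fin m))) (a : Fin m → M), p (cls U α a)) :
    ∀ x, p x := by
  intro x
  induction x using DirectSum.induction_on with
  | zero => exact h0
  | of m x =>
    obtain ⟨t, rfl⟩ := Submodule.mkQ_surjective _ x
    refine pre_induction (p := fun t => p (exprIn M U m ((permSub M U m).mkQ t))) ?_ ?_ ?_ t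
    · rw [map_zero, map_zero]
      exact h0
    · intro s t hs ht
      rw [map_add, map_add]
      exact hadd _ _ hs ht
    · intro α a
      have := h m α a
      rwa [cls, mkE, LinearMap.comp_apply, LinearMap.comp_apply, reix_refl] at this
  | add x y hx hy => exact hadd _ _ hx hy

/-- Descent of linear maps to `EV(U)`. -/
def liftE {U : Opens ℂ} {P : Type*} [AddCommGroup P] [Module ℂ P]
    (φ : ∀ m : ℕ, Pre M U (Fin m) →ₗ[ℂ] P)
    (h : ∀ m (s : Equiv.Perm (Fin m)) t, φ m (reix U s t) = φ m t) : Expr M U →ₗ[ℂ] P :=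
  DirectSum.toModule ℂ ℕ P fun m => (permSub M U m).liftQ (φ m) (by
    rw [permSub, Submodule.span_le]
    rintro _ ⟨s, t, rfl⟩
    rw [SetLike.mem_coe, LinearMap.mem_ker, map_sub, h, sub_self])

lemma liftE_lof {U : Opens ℂ} {P : Type*} [AddCommGroup P] [Module ℂ P]
    (φ : ∀ m : ℕ, Pre M U (Fin m) →ₗ[ℂ] P)
    (h : ∀ m (s : Equiv.Perm (Fin m)) t, φ m (reix U s t) = φ m t) (m : ℕ) (t : Pre M U (Fin m)) :
    liftE φ h (exprIn M U m ((permSub M U m).mkQ t)) = φ m t := by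
  exact DirectSum.toModule_lof _ _ _

lemma liftE_mkE {U : Opens ℂ} {P : Type*} [AddCommGroup P] [Module ℂ P]
    (φ : ∀ m : ℕ, Pre M U (Fin m) →ₗ[ℂ] P)
    (h : ∀ m (s : Equiv.Perm (Fin m)) t, φ m (reix U s t) = φ m t) {m : ℕ} (e : ι ≃ Fin m)
    (t : Pre M U ι) : liftE φ h (mkE U e t) = φ m (reix U e t) := by
  rw [mkE, LinearMap.comp_apply, LinearMap.comp_apply, liftE_lof]

lemma liftE_cls {U : Opens ℂ} {P : Type*} [AddCommGroup P] [Module ℂ P]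
    (φ : ∀ m : ℕ, Pre M U (Fin m) →ₗ[ℂ] P)
    (h : ∀ m (s : Equiv.Perm (Fin m)) t, φ m (reix U s t) = φ m t) {m : ℕ}
    (α : OPrime (Conf (U : Set ℂ) (Fin m))) (a : Fin m → M) :
    liftE φ h (cls U α a) = φ m (α ⊗ₜ tprod a) := by
  rw [cls, liftE_mkE, reix_refl]

lemma bddMap_liftE {U : Opens ℂ} {P : Type*} [AddCommGroup P] [Module ℂ P] {d : Bornology P}
    (hd : IsBVS d) (φ : ∀ m : ℕ, Pre M U (Fin m) →ₗ[ℂ] P)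
    (h : ∀ m (s : Equiv.Perm (Fin m)) t, φ m (reix U s t) = φ m t)
    (hφ : ∀ m, BddMap (preBorn M U (Fin m)) d (φ m)) : BddMap (exprBorn M U) d (liftE φ h) := by
  refine bddMap_sum hd (f := (liftE φ h : (⨁ m : ℕ, (Pre M U (Fin m) ⧸ permSub M U m)) →ₗ[ℂ] P))
    fun m => bddMap_quot ?_
  have : (fun x => liftE φ h (exprIn M U m ((permSub M U m).mkQ x))) = φ m :=
    funext fun x => liftE_lof φ h m x
  exact this ▸ hφ m

/-- The product on representatives. -/
def preMul {U U' W : Opens ℂ} (h : Disjoint U U') (hU : U ≤ W) (hU' : U' ≤ W) :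
    Pre M U ι →ₗ[ℂ] Pre M U' κ →ₗ[ℂ] Pre M W (ι ⊕ κ) :=
  TensorProduct.map₂ (mulFun h hU hU') tmulT

lemma preMul_tmul {U U' W : Opens ℂ} (h : Disjoint U U') (hU : U ≤ W) (hU' : U' ≤ W)
    (α : OPrime (Conf (U : Set ℂ) ι)) (a : ι → M) (β : OPrime (Conf (U' : Set ℂ) κ))
    (b : κ → M) :
    preMul h hU hU' (α ⊗ₜ tprod a) (β ⊗ₜ tprod b) =
      mulFun h hU hU' α β ⊗ₜ tprod (Sum.elim a b) := by
  rw [preMul, TensorProduct.map₂_apply_tmul, TensorProduct.map_tmul, tmulT_tprod]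

end Expressions

section ExprAlgebra

variable {ι κ τ ι' κ' : Type} [Fintype ι] [Fintype κ] [Fintype τ] [Fintype ι'] [Fintype κ']
  {M : Type u} [AddCommGroup M] [Module ℂ M]

lemma mulFun_reindex {U V W : Opens ℂ} (h : Disjoint U V) (hU : U ≤ W) (hV : V ≤ W)
    (s : ι ≃ ι') (s' : κ ≃ κ') (α : OPrime (Conf (U : Set ℂ) ι)) (β : OPrime (Conf (V : Set ℂ) κ)) :
    mulFun h hU hV (push _ (differentiable_reindex s) (mapsTo_reindex U s) α)
        (push _ (differentiable_reindex s') (mapsTo_reindex V s') β) =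
      push _ (differentiable_reindex (s.sumCongr s')) (mapsTo_reindex W (s.sumCongr s'))
        (mulFun h hU hV α β) :=
  OPrime.ext' fun f => congrArg α.1 (Subtype.ext (funext fun _ => congrArg β.1 (Subtype.ext
    (funext fun _ => congrArg f.1 (Subtype.ext (funext fun k => by rcases k with i | j <;> rfl))))))

lemma mulFun_assoc {U₁ U₂ U₃ V₁ V₂ W : Opens ℂ} (h₁₂ : Disjoint U₁ U₂) (h₂₃ : Disjoint U₂ U₃)
    (h₁ : Disjoint U₁ V₂) (h₃ : Disjoint V₁ U₃) (i₁ : U₁ ≤ V₁) (i₂ : U₂ ≤ V₁) (i₂' : U₂ ≤ V₂)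
    (i₃ : U₃ ≤ V₂) (hV₁ : V₁ ≤ W) (hV₂ : V₂ ≤ W) (α : OPrime (Conf (U₁ : Set ℂ) ι))
    (β : OPrime (Conf (U₂ : Set ℂ) κ)) (γ : OPrime (Conf (U₃ : Set ℂ) τ)) :
    push _ (differentiable_reindex (Equiv.sumAssoc ι κ τ)) (mapsTo_reindex W _)
        (mulFun h₃ hV₁ (i₃.trans hV₂) (mulFun h₁₂ i₁ i₂ α β) γ) =
      mulFun h₁ (i₁.trans hV₁) hV₂ α (mulFun h₂₃ i₂' i₃ β γ) :=
  OPrime.ext' fun f => congrArg α.1 (Subtype.ext (funext fun _ => congrArg β.1 (Subtype.ext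
    (funext fun _ => congrArg γ.1 (Subtype.ext (funext fun _ => congrArg f.1 (Subtype.ext
      (funext fun k => by rcases k with i | j | l <;> rfl))))))))

lemma mulFun_comm {U V W : Opens ℂ} (h : Disjoint U V) (hU : U ≤ W) (hV : V ≤ W)
    (α : OPrime (Conf (U : Set ℂ) ι)) (β : OPrime (Conf (V : Set ℂ) κ)) :
    push _ (differentiable_reindex (Equiv.sumComm ι κ)) (mapsTo_reindex W _)
        (mulFun h hU hV α β) = mulFun h.symm hV hU β α := by
  change _ = push _ differentiable_elim (mapsTo_elim h.symm hV hU)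
    (extProd (isOpen_conf V.2 κ) (isOpen_conf U.2 ι) β α)
  rw [← extProd_comm (isOpen_conf U.2 ι) (isOpen_conf V.2 κ)]
  exact OPrime.ext' fun f => congrArg α.1 (Subtype.ext (funext fun _ => congrArg β.1 (Subtype.ext
    (funext fun _ => congrArg f.1 (Subtype.ext (funext fun k => by rcases k with i | j <;> rfl))))))

/-- The empty configuration. -/
def emptyConf (U : Set ℂ) : Conf U (Fin 0) := ⟨Fin.elim0, fun i => i.elim0, fun i => i.elim0⟩

lemma mulFun_one {U V W : Opens ℂ} (h : Disjoint U V) (hU : U ≤ W) (hV : V ≤ W)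
    (α : OPrime (Conf (U : Set ℂ) ι)) :
    push _ (differentiable_reindex (Equiv.sumEmpty ι (Fin 0))) (mapsTo_reindex W _)
        (mulFun h hU hV α (delta (emptyConf V))) = push id differentiable_id (mapsTo_id hU) α :=
  OPrime.ext' fun f => congrArg α.1 (Subtype.ext (funext fun _ => congrArg f.1 (Subtype.ext
    (funext fun _ => rfl))))

lemma bddMap₂_mulFun {U V W : Opens ℂ} (h : Disjoint U V) (hU : U ≤ W) (hV : V ≤ W) :
    BddMap₂ (functBorn _) (functBorn _) (functBorn _) fun (α : OPrime (Conf (U : Set ℂ) ι))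
      (β : OPrime (Conf (V : Set ℂ) κ)) => mulFun h hU hV α β := by
  intro S T hS hT
  have := bddMap_push _ differentiable_elim (mapsTo_elim h hU hV) _
    (bddMap₂_extProd (isOpen_conf U.2 ι) (isOpen_conf V.2 κ) S T hS hT)
  refine this.subset ?_
  rintro _ ⟨α, hα, β, hβ, rfl⟩
  exact ⟨_, ⟨α, hα, β, hβ, rfl⟩, rfl⟩

lemma tprod_congr {a b : ι → M} (h : ∀ i, a i = b i) : (tprod a : TPow M ι) = tprod b :=
  congrArg _ (funext h)

lemma pre_ext₂ {U U' : Opens ℂ} {P : Type*} [AddCommGroup P] [Module ℂ P]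
    {f g : Pre M U ι →ₗ[ℂ] Pre M U' κ →ₗ[ℂ] P}
    (h : ∀ (α : OPrime (Conf (U : Set ℂ) ι)) (a : ι → M) (β : OPrime (Conf (U' : Set ℂ) κ))
      (b : κ → M), f (α ⊗ₜ tprod a) (β ⊗ₜ tprod b) = g (α ⊗ₜ tprod a) (β ⊗ₜ tprod b))
    (t : Pre M U ι) (t' : Pre M U' κ) : f t t' = g t t' := by
  refine LinearMap.congr_fun ?_ t'
  refine pre_ext (fun α a => ?_) t
  exact LinearMap.ext fun s => pre_ext (fun β b => h α a β b) s

lemma bddMap₂_expr {U U' : Opens ℂ} {P : Type*} [AddCommGroup P] [Module ℂ P] {d : Bornology P}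
    (hd : IsBVS d) (f : Expr M U →ₗ[ℂ] Expr M U' →ₗ[ℂ] P)
    (h : ∀ m n, BddMap₂ (preBorn M U (Fin m)) (preBorn M U' (Fin n)) d
      fun t t' => f (mkE U (Equiv.refl _) t) (mkE U' (Equiv.refl _) t')) :
    BddMap₂ (exprBorn M U) (exprBorn M U') d fun x y => f x y := by
  have key : ∀ m n, BddMap₂ (quotBorn (preBorn M U (Fin m)) (permSub M U m))
      (quotBorn (preBorn M U' (Fin n)) (permSub M U' n)) d
      fun x y => f (exprIn M U m x) (exprIn M U' n y) := by
    intro m n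
    refine bddMap₂_quot ?_
    intro S T hS hT
    refine (h m n S T hS hT).subset ?_
    rintro _ ⟨t, ht, t', ht', rfl⟩
    refine ⟨t, ht, t', ht', ?_⟩
    simp only [mkE, LinearMap.comp_apply, reix_refl]
  exact bddMap₂_sum (X := fun m => Pre M U (Fin m) ⧸ permSub M U m)
    (Y := fun m => Pre M U' (Fin m) ⧸ permSub M U' m) hd (f := f) key

section

variable {U U' W : Opens ℂ} (h : Disjoint U U') (hU : U ≤ W) (hU' : U' ≤ W)

lemma preMul_reix (s : ι ≃ ι') (s' : κ ≃ κ') (t : Pre M U ι) (t' : Pre M U' κ) :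
    preMul h hU hU' (reix U s t) (reix U' s' t') =
      reix W (s.sumCongr s') (preMul h hU hU' t t') := by
  refine pre_ext₂ (f := (preMul h hU hU').compl₁₂ (reix U s) (reix U' s'))
    (g := (preMul h hU hU').compr₂ (reix W (s.sumCongr s'))) (fun α a β b => ?_) t t'
  rw [LinearMap.compl₁₂_apply, LinearMap.compr₂_apply, reix_tmul, reix_tmul, preMul_tmul,
    preMul_tmul, reix_tmul, mulFun_reindex]
  congr 1
  exact tprod_congr fun i => by rcases i with i | i <;> rfl

lemma preMul_comm (t : Pre M U ι) (t' : Pre M U' κ) :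
    reix W (Equiv.sumComm ι κ) (preMul h hU hU' t t') = preMul h.symm hU' hU t' t := by
  refine pre_ext₂ (f := (preMul h hU hU').compr₂ (reix W (Equiv.sumComm ι κ)))
    (g := (preMul h.symm hU' hU).flip) (fun α a β b => ?_) t t'
  rw [LinearMap.compr₂_apply, LinearMap.flip_apply, preMul_tmul, preMul_tmul, reix_tmul,
    mulFun_comm]
  congr 1
  exact tprod_congr fun i => by rcases i with i | i <;> rfl

/-- The product of classes in `EV(U')` with representatives. -/
def exprMulR (m : ℕ) : Expr M U' →ₗ[ℂ] Pre M U (Fin m) →ₗ[ℂ] Expr M W :=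
  liftE (P := Pre M U (Fin m) →ₗ[ℂ] Expr M W) (fun n => ((preMul h hU hU').compr₂
      (mkE W (finSumFinEquiv (m := m) (n := n)))).flip) (by
    intro n s t
    refine LinearMap.ext fun t' => ?_
    rw [LinearMap.flip_apply, LinearMap.flip_apply, LinearMap.compr₂_apply,
      LinearMap.compr₂_apply]
    conv_lhs => rw [← reix_refl U t']
    rw [preMul_reix, mkE_reix]
    exact mkE_eq _ _ _ _)

lemma exprMulR_mkE (m : ℕ) {n : ℕ} (e' : κ ≃ Fin n) (t : Pre M U (Fin m)) (t' : Pre M U' κ) :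
    exprMulR h hU hU' m (mkE U' e' t') t =
      mkE W (((Equiv.refl _).sumCongr e').trans finSumFinEquiv) (preMul h hU hU' t t') := by
  rw [exprMulR, liftE_mkE, LinearMap.flip_apply, LinearMap.compr₂_apply]
  conv_lhs => rw [← reix_refl U t]
  rw [preMul_reix, mkE_reix]

/-- The product `EV(U) ⊗ EV(U') → EV(W)`. -/
def exprMul : Expr M U →ₗ[ℂ] Expr M U' →ₗ[ℂ] Expr M W :=
  liftE (P := Expr M U' →ₗ[ℂ] Expr M W) (fun m => (exprMulR h hU hU' m).flip) (by
    intro m s t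
    refine LinearMap.ext fun x => ?_
    rw [LinearMap.flip_apply, LinearMap.flip_apply]
    induction x using expr_induction with
    | h0 => simp
    | hadd x y hx hy => rw [map_add, LinearMap.add_apply, LinearMap.add_apply, hx, hy]
    | h n α a =>
      rw [cls, exprMulR_mkE, exprMulR_mkE]
      conv_lhs => rw [← reix_refl U' (α ⊗ₜ tprod a)]
      rw [preMul_reix, mkE_reix]
      exact mkE_eq _ _ _ _)

lemma exprMul_mkE {m n k : ℕ} (e : ι ≃ Fin m) (e' : κ ≃ Fin n) (e'' : ι ⊕ κ ≃ Fin k)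
    (t : Pre M U ι) (t' : Pre M U' κ) :
    exprMul h hU hU' (mkE U e t) (mkE U' e' t') = mkE W e'' (preMul h hU hU' t t') := by
  rw [exprMul, liftE_mkE, LinearMap.flip_apply, exprMulR_mkE]
  conv_lhs => rw [← reix_refl U' t']
  rw [preMul_reix, mkE_reix]
  exact mkE_eq _ _ _ _

lemma bddMap_reix (U : Opens ℂ) (e : ι ≃ κ) :
    BddMap (preBorn M U ι) (preBorn M U κ) (reix U e) := by
  refine bddMap_tensor (isBVS_pre U) fun S T hS hT => ?_
  refine bdd_tensor.2 ⟨_, _, bddMap_push _ (differentiable_reindex e) (mapsTo_reindex U e) S hS,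
    bddMap_discrete (treindex e) T hT, ?_⟩
  refine Subset.trans ?_ (subset_absHull _)
  rintro _ ⟨α, hα, a, ha, rfl⟩
  exact ⟨_, ⟨α, hα, rfl⟩, _, ⟨a, ha, rfl⟩, TensorProduct.map_tmul _ _ _ _⟩

lemma BddMap.comp' {X Y Z : Type*} {a : Bornology X} {b : Bornology Y} {c : Bornology Z}
    {f : Y → Z} {g : X → Y} (hf : BddMap b c f) (hg : BddMap a b g) :
    BddMap a c fun x => f (g x) := fun S hS => by
  have := hf _ (hg S hS)
  rwa [image_image] at this

lemma bddMap_mkE (U : Opens ℂ) {m : ℕ} (e : ι ≃ Fin m) :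
    BddMap (preBorn M U ι) (exprBorn M U) (mkE U e) :=
  (bddMap_lof (X := fun m => Pre M U (Fin m) ⧸ permSub M U m) _ m).comp'
    ((bddMap_mkQ _ _).comp' (bddMap_reix U e))

lemma bddMap₂_preMul : BddMap₂ (preBorn M U ι) (preBorn M U' κ) (preBorn M W (ι ⊕ κ))
    fun t t' => preMul h hU hU' t t' := by
  refine bddMap₂_tensor (isBVS_pre W) fun S T S' T' hS hT hS' hT' => ?_
  refine bdd_tensor.2 ⟨_, _, bddMap₂_mulFun h hU hU' S S' hS hS',
    bddMap₂_discrete tmulT T T' hT hT', ?_⟩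
  refine Subset.trans ?_ (subset_absHull _)
  rintro _ ⟨α, hα, a, ha, β, hβ, b, hb, rfl⟩
  exact ⟨_, ⟨α, hα, β, hβ, rfl⟩, _, ⟨a, ha, b, hb, rfl⟩, by
    rw [preMul, TensorProduct.map₂_apply_tmul, TensorProduct.map_tmul]⟩

lemma bddMap₂_exprMul :
    BddMap₂ (exprBorn M U) (exprBorn M U') (exprBorn M W) fun x y => exprMul h hU hU' x y := by
  refine bddMap₂_expr (isBVS_expr M W) _ fun m n S T hS hT => ?_
  refine (bddMap_mkE W (finSumFinEquiv (m := m) (n := n)) _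
    (bddMap₂_preMul h hU hU' S T hS hT)).subset ?_
  rintro _ ⟨t, ht, t', ht', rfl⟩
  exact ⟨_, ⟨t, ht, t', ht', rfl⟩, (exprMul_mkE h hU hU' _ _ _ _ _).symm⟩

lemma exprMul_comm (x : Expr M U) (y : Expr M U') :
    exprMul h.symm hU' hU y x = exprMul h hU hU' x y := by
  induction x using expr_induction with
  | h0 => simp
  | hadd x x' hx hx' => rw [map_add, map_add, LinearMap.add_apply, hx, hx']
  | h m α a =>
    induction y using expr_induction with
    | h0 => simp
    | hadd x x' hx hx' => rw [map_add, map_add, LinearMap.add_apply, hx, hx']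
    | h n β b =>
      rw [cls, cls, exprMul_mkE h hU hU' _ _ finSumFinEquiv,
        exprMul_mkE h.symm hU' hU _ _ ((Equiv.sumComm _ _).trans finSumFinEquiv),
        ← preMul_comm h hU hU', mkE_reix]
      exact mkE_eq _ _ _ _

end

lemma preMul_assoc {U₁ U₂ U₃ V₁ V₂ W : Opens ℂ} (h₁₂ : Disjoint U₁ U₂) (h₂₃ : Disjoint U₂ U₃)
    (h₁ : Disjoint U₁ V₂) (h₃ : Disjoint V₁ U₃) (i₁ : U₁ ≤ V₁) (i₂ : U₂ ≤ V₁) (i₂' : U₂ ≤ V₂)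
    (i₃ : U₃ ≤ V₂) (hV₁ : V₁ ≤ W) (hV₂ : V₂ ≤ W) (α : OPrime (Conf (U₁ : Set ℂ) ι)) (a : ι → M)
    (β : OPrime (Conf (U₂ : Set ℂ) κ)) (b : κ → M) (γ : OPrime (Conf (U₃ : Set ℂ) τ)) (c : τ → M) :
    reix W (Equiv.sumAssoc ι κ τ) (preMul h₃ hV₁ (i₃.trans hV₂)
        (preMul h₁₂ i₁ i₂ (α ⊗ₜ tprod a) (β ⊗ₜ tprod b)) (γ ⊗ₜ tprod c)) =
      preMul h₁ (i₁.trans hV₁) hV₂ (α ⊗ₜ tprod a)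
        (preMul h₂₃ i₂' i₃ (β ⊗ₜ tprod b) (γ ⊗ₜ tprod c)) := by
  rw [preMul_tmul, preMul_tmul, preMul_tmul, preMul_tmul, reix_tmul,
    mulFun_assoc h₁₂ h₂₃ h₁ h₃ i₁ i₂ i₂' i₃ hV₁ hV₂]
  congr 1
  exact tprod_congr fun i => by rcases i with i | i | i <;> rfl

lemma exprMul_assoc {U₁ U₂ U₃ V₁ V₂ W : Opens ℂ} (h₁₂ : Disjoint U₁ U₂) (h₂₃ : Disjoint U₂ U₃)
    (h₁ : Disjoint U₁ V₂) (h₃ : Disjoint V₁ U₃) (i₁ : U₁ ≤ V₁) (i₂ : U₂ ≤ V₁) (i₂' : U₂ ≤ V₂)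
    (i₃ : U₃ ≤ V₂) (hV₁ : V₁ ≤ W) (hV₂ : V₂ ≤ W) (x : Expr M U₁) (y : Expr M U₂) (z : Expr M U₃) :
    exprMul h₃ hV₁ (i₃.trans hV₂) (exprMul h₁₂ i₁ i₂ x y) z =
      exprMul h₁ (i₁.trans hV₁) hV₂ x (exprMul h₂₃ i₂' i₃ y z) := by
  induction x using expr_induction with
  | h0 => simp
  | hadd x x' hx hx' => simp only [map_add, LinearMap.add_apply, hx, hx']
  | h m α a =>
    induction y using expr_induction with
    | h0 => simp
    | hadd x x' hx hx' => simp only [map_add, LinearMap.add_apply, hx, hx']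
    | h n β b =>
      induction z using expr_induction with
      | h0 => simp
      | hadd x x' hx hx' => simp only [map_add, hx, hx']
      | h k γ c =>
        rw [cls, cls, cls, exprMul_mkE _ _ _ _ _ finSumFinEquiv,
          exprMul_mkE _ _ _ _ _ finSumFinEquiv]
        refine (exprMul_mkE h₃ hV₁ (i₃.trans hV₂) _ _
          (((finSumFinEquiv).sumCongr (Equiv.refl _)).trans finSumFinEquiv) _ _).trans
          (Eq.trans ?_ (exprMul_mkE h₁ (i₁.trans hV₁) hV₂ _ _
            (((Equiv.refl _).sumCongr finSumFinEquiv).trans finSumFinEquiv) _ _).symm)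
        rw [← preMul_assoc h₁₂ h₂₃ h₁ h₃ i₁ i₂ i₂' i₃ hV₁ hV₂, mkE_reix]
        exact mkE_eq _ _ _ _

variable (M) in
/-- The unit `[δ ⊗ 1]`. -/
def exprOne (U : Opens ℂ) : Expr M U := cls U (delta (emptyConf U)) Fin.elim0

/-- The extension map on representatives. -/
def preInc {U W : Opens ℂ} (hU : U ≤ W) : Pre M U ι →ₗ[ℂ] Pre M W ι :=
  TensorProduct.map (push id differentiable_id (mapsTo_id hU)) LinearMap.id

lemma preInc_tmul {U W : Opens ℂ} (hU : U ≤ W) (α : OPrime (Conf (U : Set ℂ) ι)) (a : ι → M) :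
    preInc hU (α ⊗ₜ tprod a) = push id differentiable_id (mapsTo_id hU) α ⊗ₜ tprod a := by
  rw [preInc, TensorProduct.map_tmul, LinearMap.id_apply]

lemma exprMul_one {U V W : Opens ℂ} (h : Disjoint U V) (hU : U ≤ W) (hV : V ≤ W) {m : ℕ}
    (e : ι ≃ Fin m) (t : Pre M U ι) :
    exprMul h hU hV (mkE U e t) (exprOne M V) = mkE W e (preInc hU t) := by
  rw [exprOne, cls, exprMul_mkE h hU hV _ _ ((Equiv.sumEmpty _ _).trans e), ← mkE_reix]
  congr 1
  refine pre_ext (f := reix W (Equiv.sumEmpty ι (Fin 0)) ∘ₗ (preMul h hU hV).flip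
    (delta (emptyConf V) ⊗ₜ tprod Fin.elim0)) (fun α a => ?_) t
  rw [LinearMap.comp_apply, LinearMap.flip_apply, preMul_tmul, reix_tmul, mulFun_one, preInc_tmul]
  congr 1

lemma preInc_refl (U : Opens ℂ) (t : Pre M U ι) : preInc le_rfl t = t := by
  refine pre_ext (g := LinearMap.id) (fun α a => ?_) t
  rw [preInc_tmul]; rfl

/-- The action of an affine transformation `g` and an endomorphism `s` on representatives. -/
def preAct (g : Aff) (s : M →ₗ[ℂ] M) (U : Opens ℂ) : Pre M U ι →ₗ[ℂ] Pre M (g.map U) ι :=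
  TensorProduct.map (push _ (differentiable_act' g) (mapsTo_act g U)) (tmap s)

lemma preAct_tmul (g : Aff) (s : M →ₗ[ℂ] M) (U : Opens ℂ) (α : OPrime (Conf (U : Set ℂ) ι))
    (a : ι → M) : preAct g s U (α ⊗ₜ tprod a) =
      push _ (differentiable_act' g) (mapsTo_act g U) α ⊗ₜ tprod fun i => s (a i) := by
  rw [preAct, TensorProduct.map_tmul, tmap_tprod]

lemma preAct_reix (g : Aff) (s : M →ₗ[ℂ] M) (U : Opens ℂ) (e : ι ≃ κ) (t : Pre M U ι) :
    preAct g s U (reix U e t) = reix _ e (preAct g s U t) := by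
  refine pre_ext (f := preAct g s U ∘ₗ reix U e) (g := reix _ e ∘ₗ preAct g s U)
    (fun α a => ?_) t
  rw [LinearMap.comp_apply, LinearMap.comp_apply, reix_tmul, preAct_tmul, preAct_tmul, reix_tmul]
  rfl

/-- The action of an affine transformation `g` and an endomorphism `s` on `EV`. -/
def exprAct (g : Aff) (s : M →ₗ[ℂ] M) (U : Opens ℂ) : Expr M U →ₗ[ℂ] Expr M (g.map U) :=
  liftE (fun _ => mkE _ (Equiv.refl _) ∘ₗ preAct g s U) (by
    intro m e t
    rw [LinearMap.comp_apply, LinearMap.comp_apply, preAct_reix, mkE_reix]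
    exact mkE_eq _ _ _ _)

lemma exprAct_mkE (g : Aff) (s : M →ₗ[ℂ] M) (U : Opens ℂ) {m : ℕ} (e : ι ≃ Fin m)
    (t : Pre M U ι) : exprAct g s U (mkE U e t) = mkE _ e (preAct g s U t) := by
  rw [exprAct, liftE_mkE, LinearMap.comp_apply, preAct_reix, mkE_reix]
  exact mkE_eq _ _ _ _

lemma bddMap_exprAct (g : Aff) (s : M →ₗ[ℂ] M) (U : Opens ℂ) :
    BddMap (exprBorn M U) (exprBorn M (g.map U)) (exprAct g s U) := by
  refine bddMap_liftE (isBVS_expr M _) _ _ fun m => (bddMap_mkE _ _).comp' ?_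
  refine bddMap_tensor (isBVS_pre _) fun S T hS hT => ?_
  refine bdd_tensor.2 ⟨_, _, bddMap_push _ (differentiable_act' g) (mapsTo_act g U) S hS,
    bddMap_discrete (tmap s) T hT, ?_⟩
  refine Subset.trans ?_ (subset_absHull _)
  rintro _ ⟨α, hα, a, ha, rfl⟩
  exact ⟨_, ⟨α, hα, rfl⟩, _, ⟨a, ha, rfl⟩, TensorProduct.map_tmul _ _ _ _⟩

lemma exprAct_mul (g : Aff) (s : M →ₗ[ℂ] M) {U U' W : Opens ℂ} (h : Disjoint U U') (hU : U ≤ W)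
    (hU' : U' ≤ W) (x : Expr M U) (y : Expr M U') : exprAct g s W (exprMul h hU hU' x y) =
      exprMul (g.map_disjoint h) (g.map_mono hU) (g.map_mono hU') (exprAct g s U x)
        (exprAct g s U' y) := by
  induction x using expr_induction with
  | h0 => simp
  | hadd x x' hx hx' => simp only [map_add, LinearMap.add_apply, hx, hx']
  | h m α a =>
    induction y using expr_induction with
    | h0 => simp
    | hadd x x' hx hx' => simp only [map_add, hx, hx']
    | h n β b =>
      rw [cls, cls, exprMul_mkE _ _ _ _ _ finSumFinEquiv, exprAct_mkE, exprAct_mkE, exprAct_mkE,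
        exprMul_mkE _ _ _ _ _ finSumFinEquiv, preMul_tmul, preAct_tmul, preAct_tmul, preAct_tmul,
        preMul_tmul]
      congr 2
      · exact OPrime.ext' fun f => congrArg α.1 (Subtype.ext (funext fun _ => congrArg β.1
          (Subtype.ext (funext fun _ => congrArg f.1 (Subtype.ext (funext fun k => by
            rcases k with i | j <;> rfl))))))
      · exact tprod_congr fun i => by rcases i with i | i <;> rfl

end ExprAlgebra

/-! ### Holomorphic functions with values in vector spaces -/

section VectorValued

variable {E : Type*} [NormedAddCommGroup E] [NormedSpace ℂ E] {W : Type*} [AddCommGroup W] [Module ℂ W]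

/-- Holomorphic functions on `X` with values in a finite-dimensional subspace of `W`. -/
def HolFD {X : Set E} (f : X → W) : Prop :=
  ∃ S : Submodule ℂ W, FiniteDimensional ℂ S ∧ (∀ x, f x ∈ S) ∧
    ∀ φ : Module.Dual ℂ W, (fun x => φ (f x)) ∈ Hol X

variable (W) in
/-- The space `𝒪(X; W)` for a discrete vector space `W`. -/
def HolW (X : Set E) : Submodule ℂ (X → W) where
  carrier := {f | HolFD f}
  zero_mem' := ⟨⊥, inferInstance, fun _ => Submodule.zero_mem _, fun φ => by
    rw [show (fun x => φ ((0 : X → W) x)) = 0 from funext fun x => map_zero φ]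
    exact (Hol X).zero_mem⟩
  add_mem' := by
    rintro f g ⟨S, hS, hfS, hf⟩ ⟨T, hT, hgT, hg⟩
    refine ⟨S ⊔ T, inferInstance, fun x => Submodule.add_mem_sup (hfS x) (hgT x), fun φ => ?_⟩
    rw [show (fun x => φ ((f + g) x)) = (fun x => φ (f x)) + fun x => φ (g x) from
      funext fun x => map_add φ _ _]
    exact (Hol X).add_mem (hf φ) (hg φ)
  smul_mem' := by
    rintro c f ⟨S, hS, hfS, hf⟩
    refine ⟨S, hS, fun x => S.smul_mem c (hfS x), fun φ => ?_⟩
    rw [show (fun x => φ ((c • f) x)) = c • fun x => φ (f x) from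
      funext fun x => map_smul φ _ _]
    exact (Hol X).smul_mem c (hf φ)

/-- Composition with a linear functional. -/
def holComp {X : Set E} (φ : Module.Dual ℂ W) (f : HolW W X) : Hol X :=
  ⟨fun x => φ (f.1 x), by obtain ⟨S, _, _, h⟩ := f.2; exact h φ⟩

lemma exists_pairing {X : Set E} (α : OPrime X) (f : HolW W X) :
    ∃ v : W, ∀ φ : Module.Dual ℂ W, φ v = α.1 (holComp φ f) := by
  obtain ⟨S, hS, hfS, hf⟩ := f.2
  let b := Module.finBasis ℂ S
  choose c hc using fun i => (b.coord i).exists_extend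
  refine ⟨∑ i, α.1 (holComp (c i) f) • (b i : W), fun φ => ?_⟩
  rw [map_sum]
  simp only [map_smul, smul_eq_mul]
  have h : holComp φ f = ∑ i, φ (b i) • holComp (c i) f := by
    ext x
    have h1 : f.1 x = ∑ i, c i (f.1 x) • (b i : W) := by
      have := congrArg (Submodule.subtype S) (b.sum_repr ⟨f.1 x, hfS x⟩)
      rw [map_sum] at this
      refine this.symm.trans (Finset.sum_congr rfl fun i _ => ?_)
      rw [map_smul]
      congr 1
      exact (LinearMap.congr_fun (hc i) ⟨f.1 x, hfS x⟩).symm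
    have h2 : (∑ i, φ (b i) • holComp (c i) f : Hol X).1 x = ∑ i, φ (b i) * c i (f.1 x) := by
      rw [AddSubmonoidClass.coe_finsetSum, Finset.sum_apply]
      rfl
    rw [h2]
    change φ (f.1 x) = _
    conv_lhs => rw [h1, map_sum]
    simp [mul_comm]
  rw [h, map_sum]
  simp [mul_comm]

lemma eq_of_dual {v w : W} (h : ∀ φ : Module.Dual ℂ W, φ v = φ w) : v = w := by
  rw [← sub_eq_zero, ← Module.forall_dual_apply_eq_zero_iff ℂ]
  intro φ
  rw [map_sub, h, sub_self]

/-- The evaluation pairing `α(f) ∈ W` of `α ∈ 𝒪'(X)` and `f ∈ 𝒪(X; W)`: the element with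
`φ(α(f)) = α(φ ∘ f)` for all linear functionals `φ` on `W`. -/
def pairing {X : Set E} : OPrime X →ₗ[ℂ] HolW W X →ₗ[ℂ] W :=
  LinearMap.mk₂ ℂ (fun α f => Classical.choose (exists_pairing α f))
    (fun α β f => eq_of_dual fun φ => by
      rw [map_add, Classical.choose_spec (exists_pairing _ _),
        Classical.choose_spec (exists_pairing _ _), Classical.choose_spec (exists_pairing _ _)]
      rfl)
    (fun c α f => eq_of_dual fun φ => by
      rw [map_smul, Classical.choose_spec (exists_pairing _ _),
        Classical.choose_spec (exists_pairing _ _)]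
      rfl)
    (fun α f g => eq_of_dual fun φ => by
      rw [map_add, Classical.choose_spec (exists_pairing _ _),
        Classical.choose_spec (exists_pairing _ _), Classical.choose_spec (exists_pairing _ _),
        ← map_add]
      congr 1
      ext x
      exact map_add φ (f.1 x) (g.1 x))
    (fun c α f => eq_of_dual fun φ => by
      rw [map_smul, Classical.choose_spec (exists_pairing _ _),
        Classical.choose_spec (exists_pairing _ _), ← map_smul]
      congr 1
      ext x
      exact map_smul φ c (f.1 x))

lemma dual_pairing {X : Set E} (α : OPrime X) (f : HolW W X) (φ : Module.Dual ℂ W) :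
    φ (pairing α f) = α.1 (holComp φ f) := Classical.choose_spec (exists_pairing α f) φ

/-- Analytic functionals commute with locally uniformly absolutely convergent series. -/
lemma hasSum_functional {ι : Type*} {X : Set E} (α : OPrime X) (h : ι → Hol X) (f : Hol X)
    (H : ∀ K ⊆ X, IsCompact K → ∃ u : ι → ℝ, Summable u ∧
      (∀ i, ∀ x : X, x.1 ∈ K → ‖(h i).1 x‖ ≤ u i) ∧
      ∀ x : X, x.1 ∈ K → HasSum (fun i => (h i).1 x) (f.1 x)) :
    HasSum (fun i => α.1 (h i)) (α.1 f) := by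
  classical
  obtain ⟨K, hKX, hK, C, hα⟩ := α.2
  obtain ⟨u, hu, hb, hs⟩ := H K hKX hK
  rcases K.eq_empty_or_nonempty with rfl | ⟨x₀, hx₀⟩
  · have h0 : ∀ f, α.1 f = 0 := fun f => by
      have := hα f 0 le_rfl (fun x hx => hx.elim)
      simpa using this
    simp only [h0]
    exact hasSum_zero
  have hu0 : ∀ i, 0 ≤ u i := fun i => (norm_nonneg _).trans (hb i ⟨x₀, hKX hx₀⟩ hx₀)
  have hbound : ∀ s : Finset ι, ‖α.1 f - ∑ i ∈ s, α.1 (h i)‖ ≤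
      C * ∑' i : {i // i ∉ s}, u i := by
    intro s
    rw [← map_sum, ← map_sub]
    refine hα _ _ (tsum_nonneg fun i => hu0 i) fun x hx => ?_
    have hsum := hs x hx
    have hn : Summable fun i => ‖(h i).1 x‖ := hu.of_nonneg_of_le (fun _ => norm_nonneg _)
      fun i => hb i x hx
    have e1 : (f - ∑ i ∈ s, h i).1 x = ∑' i : {i // i ∉ s}, (h i).1 x := by
      have e2 : (f - ∑ i ∈ s, h i).1 x = f.1 x - ∑ i ∈ s, (h i).1 x := by
        change f.1 x - (∑ i ∈ s, h i : Hol X).1 x = _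
        rw [AddSubmonoidClass.coe_finsetSum, Finset.sum_apply]
      rw [e2, ← hsum.tsum_eq, ← hsum.summable.sum_add_tsum_subtype_compl s, add_sub_cancel_left]
    rw [e1]
    refine (norm_tsum_le_tsum_norm (hn.subtype _)).trans ?_
    exact (hn.subtype _).tsum_le_tsum (fun i => hb i x hx) (hu.subtype _)
  rw [HasSum, tendsto_iff_norm_sub_tendsto_zero]
  have h1 := (tendsto_tsum_compl_atTop_zero u).const_mul C
  rw [mul_zero] at h1
  exact squeeze_zero (fun _ => norm_nonneg _) (fun s => by
    rw [norm_sub_rev]; exact hbound s) h1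

end VectorValued

/-! ### Geometric vertex algebras -/

section GeometricVertexAlgebras

/-- The pairs `(z, w)` of configurations with `|w j| < |z i - z last|` for all `j` and all
`i ≠ last`. -/
def assocSet (m n : ℕ) : Set ((Fin (m + 1) → ℂ) × (Fin n → ℂ)) :=
  {p | p.1 ∈ Conf univ (Fin (m + 1)) ∧ p.2 ∈ Conf univ (Fin n) ∧
    ∀ (i : Fin m) (j : Fin n), ‖p.2 j‖ < ‖p.1 i.castSucc - p.1 (Fin.last m)‖}

/-- The configuration `(z 1, …, z m, w 1 + z (m + 1), …, w n + z (m + 1))`. -/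
def insertConf {m n : ℕ} (p : assocSet m n) : Conf (univ : Set ℂ) (Fin (m + n)) :=
  ⟨Fin.append (fun i => p.1.1 i.castSucc) (fun j => p.1.2 j + p.1.1 (Fin.last m)),
    fun _ => mem_univ _, by
    obtain ⟨⟨z, w⟩, hz, hw, h⟩ := p
    change Function.Injective (Fin.append (fun i => z i.castSucc) (fun j => w j + z (Fin.last m)))
    rw [Fin.append_injective_iff]
    refine ⟨hz.2.comp (Fin.castSucc_injective m), fun i j e => hw.2 (add_right_cancel e),
      fun i j e => ?_⟩
    have := h i j
    simp only at this
    rw [e, add_sub_cancel_right] at this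
    exact lt_irrefl _ this⟩

/-- Permutation of a configuration. -/
def permConf {ι : Type} (s : Equiv.Perm ι) (z : Conf (univ : Set ℂ) ι) : Conf (univ : Set ℂ) ι :=
  ⟨fun i => z.1 (s i), fun _ => mem_univ _, z.2.2.comp s.injective⟩

/-- The configuration `λ z`. -/
def scaleConf {ι : Type} (lam : ℂˣ) (z : Conf (univ : Set ℂ) ι) : Conf (univ : Set ℂ) ι :=
  ⟨fun i => lam * z.1 i, fun _ => mem_univ _, fun _ _ h =>
    z.2.2 (mul_left_cancel₀ lam.ne_zero h)⟩

/-- The configuration consisting of a single point. -/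
def pointConf (z : ℂ) : Conf (univ : Set ℂ) (Fin 1) :=
  ⟨fun _ => z, fun _ => mem_univ _, fun _ _ _ => Subsingleton.elim _ _⟩

/-- The configuration `(z, 0)` for `z ≠ 0`. -/
def pairConf (z : ({0}ᶜ : Set ℂ)) : Conf (univ : Set ℂ) (Fin 2) :=
  ⟨![z.1, 0], fun _ => mem_univ _, by
    have hz : z.1 ≠ 0 := z.2
    intro i j
    fin_cases i <;> fin_cases j <;> simp [hz, hz.symm]⟩

variable (V : ℤ → Type u) [∀ k, AddCommGroup (V k)] [∀ k, Module ℂ (V k)]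

/-- The inclusion of the degree `k` part. -/
def tin (k : ℤ) : V k →ₗ[ℂ] Tot V := DirectSum.lof ℂ ℤ V k

/-- The data of multiplication maps `V^{⊗ m} → {functions ℂ^m ∖ Δ → ∏ₖ V k}`. -/
abbrev MultData := ∀ m : ℕ,
  MultilinearMap ℂ (fun _ : Fin m => Tot V) (Conf (univ : Set ℂ) (Fin m) → ∀ k, V k)

variable {V}

/-- The meromorphicity axiom: for all `a`, `b` there is an `N` such that `z ^ N μ(a, z, b, 0)`
extends to a holomorphic function on the plane. -/
def IsMeromorphic (mu : ∀ m : ℕ, (Fin m → Tot V) → Conf (univ : Set ℂ) (Fin m) → ∀ k, V k) :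
    Prop :=
  ∀ a b : Tot V, ∃ N : ℕ, ∀ k, ∃ f : ↥(univ : Set ℂ) → V k, HolFD f ∧
    ∀ z : ({0}ᶜ : Set ℂ), f ⟨z.1, mem_univ _⟩ = z.1 ^ N • mu 2 ![a, b] (pairConf z) k

/-- The `k`-th summand `μ(a 1, z 1, …, a m, z m, p_k (μ(b 1, w 1, …, b n, w n)), z (m + 1))` of the
associativity axiom. -/
def assocTerm (mu : MultData V) {m n : ℕ} (a : Fin m → Tot V) (b : Fin n → Tot V) (k : ℤ)
    (p : assocSet m n) : ∀ l, V l :=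
  mu (m + 1) (Fin.snoc (α := fun _ => Tot V) a (tin V k (mu n b ⟨p.1.2, p.2.2.1⟩ k)))
    ⟨p.1.1, p.2.1⟩

/-- The associativity axiom: the sum over `k` converges absolutely and locally uniformly, in
finite-dimensional subspaces in each degree, to
`μ(a 1, z 1, …, a m, z m, b 1, w 1 + z (m + 1), …, b n, w n + z (m + 1))`. -/
def IsAssoc (mu : MultData V) : Prop :=
  ∀ (m n : ℕ) (a : Fin m → Tot V) (b : Fin n → Tot V) (l : ℤ),
    ∀ K ⊆ assocSet m n, IsCompact K →
      (∃ S : Submodule ℂ (V l), FiniteDimensional ℂ S ∧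
        ∀ k, ∀ p : assocSet m n, p.1 ∈ K → assocTerm mu a b k p l ∈ S) ∧
      ∀ φ : Module.Dual ℂ (V l), ∃ u : ℤ → ℝ, Summable u ∧
        (∀ k, ∀ p : assocSet m n, p.1 ∈ K → ‖φ (assocTerm mu a b k p l)‖ ≤ u k) ∧
        ∀ p : assocSet m n, p.1 ∈ K → HasSum (fun k => φ (assocTerm mu a b k p l))
          (φ (mu (m + n) (Fin.append a b) (insertConf p) l))

variable (V) in
/-- Geometric vertex algebra structures on a `ℤ`-graded vector space. -/
structure GVA where
  mu : MultData V
  holo : ∀ (m : ℕ) (a : Fin m → Tot V) (k : ℤ), HolFD fun z => mu m a z k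
  perm : ∀ (m : ℕ) (s : Equiv.Perm (Fin m)) (a : Fin m → Tot V) (z : Conf univ (Fin m)),
    mu m (fun i => a (s i)) (permConf s z) = mu m a z
  insertion : ∀ (a : Tot V) (k : ℤ), mu 1 (fun _ => a) (pointConf 0) k = a k
  equivariant : ∀ (m : ℕ) (lam : ℂˣ) (a : Fin m → Tot V) (z : Conf univ (Fin m)) (k : ℤ),
    mu m (fun i => scale V lam (a i)) (scaleConf lam z) k = ((lam ^ k : ℂˣ) : ℂ) • mu m a z k
  assoc : IsAssoc mu
  merom : IsMeromorphic fun m => mu m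

end GeometricVertexAlgebras

/-! ### The evaluation map -/

section Evaluation

variable {V : ℤ → Type u} [∀ k, AddCommGroup (V k)] [∀ k, Module ℂ (V k)] (G : GVA V)

/-- A configuration in `U` as a configuration in the plane. -/
def toUniv {U : Set ℂ} {ι : Type} (z : Conf U ι) : Conf (univ : Set ℂ) ι :=
  ⟨z.1, fun _ => mem_univ _, z.2.2⟩

lemma HolFD.restrict {ι : Type} [Fintype ι] {W : Type*} [AddCommGroup W] [Module ℂ W]
    {f : Conf (univ : Set ℂ) ι → W} (hf : HolFD f) (U : Set ℂ) :
    HolFD fun z : Conf U ι => f (toUniv z) := by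
  obtain ⟨S, hS, h, h'⟩ := hf
  refine ⟨S, hS, fun z => h _, fun φ => ?_⟩
  obtain ⟨F, hF, hf⟩ := h' φ
  exact ⟨F, hF.mono fun z hz => ⟨fun _ => mem_univ _, hz.2⟩, fun z => hf (toUniv z)⟩

/-- `p_k ∘ μ(a)` as a holomorphic function on `U^m ∖ Δ`. -/
def muW (U : Set ℂ) (m : ℕ) (k : ℤ) :
    MultilinearMap ℂ (fun _ : Fin m => Tot V) (HolW (V k) (Conf U (Fin m))) where
  toFun a := ⟨fun z => G.mu m a (toUniv z) k, (G.holo m a k).restrict U⟩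
  map_update_add' a i x y := by
    ext z
    exact congrFun (congrFun ((G.mu m).map_update_add a i x y) (toUniv z)) k
  map_update_smul' a i c x := by
    ext z
    exact congrFun (congrFun ((G.mu m).map_update_smul a i c x) (toUniv z)) k

/-- `α ⊗ a ↦ α(p_k ∘ μ(a))`. -/
def preEv (U : Opens ℂ) (k : ℤ) (m : ℕ) : Pre (Tot V) U (Fin m) →ₗ[ℂ] V k :=
  TensorProduct.lift (pairing.compl₂ (tlift (muW G U m k)))

lemma preEv_tmul (U : Opens ℂ) (k : ℤ) (m : ℕ) (α : OPrime (Conf (U : Set ℂ) (Fin m)))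
    (a : Fin m → Tot V) : preEv G U k m (α ⊗ₜ tprod a) = pairing α (muW G U m k a) := by
  rw [preEv, TensorProduct.lift.tmul, LinearMap.compl₂_apply, tlift_tprod]

lemma preEv_reix (U : Opens ℂ) (k : ℤ) (m : ℕ) (s : Equiv.Perm (Fin m))
    (t : Pre (Tot V) U (Fin m)) : preEv G U k m (reix U s t) = preEv G U k m t := by
  refine pre_ext (f := preEv G U k m ∘ₗ reix U s) (fun α a => ?_) t
  rw [LinearMap.comp_apply, reix_tmul, preEv_tmul, preEv_tmul]
  refine eq_of_dual fun φ => ?_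
  rw [dual_pairing, dual_pairing, push_apply]
  refine congrArg α.1 (Subtype.ext (funext fun z => ?_))
  exact congrArg φ (congrFun (G.perm m s.symm a (toUniv z)) k)

/-- The evaluation map `[α ⊗ a] ↦ α(μ(a))`. -/
def ev (U : Opens ℂ) : Expr (Tot V) U →ₗ[ℂ] ∀ k, V k :=
  LinearMap.pi fun k => liftE (preEv G U k) (preEv_reix G U k)

lemma ev_cls (U : Opens ℂ) {m : ℕ} (α : OPrime (Conf (U : Set ℂ) (Fin m))) (a : Fin m → Tot V)
    (k : ℤ) : ev G U (cls U α a) k = pairing α (muW G U m k a) := by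
  change liftE (preEv G U k) (preEv_reix G U k) (cls U α a) = _
  rw [liftE_cls, preEv_tmul]

/-- The relations on `U`. -/
def relations (U : Opens ℂ) : Submodule ℂ (Expr (Tot V) U) := LinearMap.ker (ev G U)

/-- The action of affine transformations on `EV`. -/
abbrev sigmaE (g : Aff) (U : Opens ℂ) : Expr (Tot V) U →ₗ[ℂ] Expr (Tot V) (g.map U) :=
  exprAct g (scale V g.lam) U

lemma sigmaE_cls (g : Aff) (U : Opens ℂ) {m : ℕ} (α : OPrime (Conf (U : Set ℂ) (Fin m)))
    (a : Fin m → Tot V) : sigmaE g U (cls U α a) =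
      cls _ (push _ (differentiable_act' g) (mapsTo_act g U) α) fun i => scale V g.lam (a i) := by
  rw [cls, exprAct_mkE, preAct_tmul, cls]

lemma assocTerm_zero {n : ℕ} (b : Fin n → Tot V) (k : ℤ) (p : assocSet 0 n) (l : ℤ) :
    assocTerm G.mu (m := 0) Fin.elim0 b k p l =
      G.mu 1 (fun _ => tin V k (G.mu n b ⟨p.1.2, p.2.2.1⟩ k)) ⟨p.1.1, p.2.1⟩ l := by
  rw [assocTerm]
  congr 2

/-- The linear functional `v ↦ φ(μ(v, t)_l)` on `V k`. -/
def shiftFun (t : ℂ) (l : ℤ) (φ : Module.Dual ℂ (V l)) (k : ℤ) : Module.Dual ℂ (V k) where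
  toFun v := φ (G.mu 1 (fun _ => tin V k v) (pointConf t) l)
  map_add' v w := by
    have := (G.mu 1).map_update_add (fun _ => 0) 0 (tin V k v) (tin V k w)
    rw [← map_add] at this
    have e : ∀ x : Tot V, Function.update (fun _ : Fin 1 => (0 : Tot V)) 0 x = fun _ => x :=
      fun x => by ext i : 1; rw [Subsingleton.elim i 0, Function.update_self]
    rw [e, e, e] at this
    rw [this, Pi.add_apply, Pi.add_apply, map_add]
  map_smul' c v := by
    have := (G.mu 1).map_update_smul (fun _ => 0) 0 c (tin V k v)
    rw [← map_smul] at this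
    have e : ∀ x : Tot V, Function.update (fun _ : Fin 1 => (0 : Tot V)) 0 x = fun _ => x :=
      fun x => by ext i : 1; rw [Subsingleton.elim i 0, Function.update_self]
    rw [e, e] at this
    rw [this, Pi.smul_apply, Pi.smul_apply, map_smul, RingHom.id_apply]

lemma hasSum_translate (t : ℂ) (l : ℤ) (φ : Module.Dual ℂ (V l)) {m : ℕ} (b : Fin m → Tot V)
    (K : Set (Fin m → ℂ)) (hK : IsCompact K) (hK' : K ⊆ Conf univ (Fin m)) :
    ∃ u : ℤ → ℝ, Summable u ∧
      (∀ k, ∀ w (hw : w ∈ K), ‖shiftFun G t l φ k (G.mu m b ⟨w, hK' hw⟩ k)‖ ≤ u k) ∧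
      ∀ w (hw : w ∈ K), HasSum (fun k => shiftFun G t l φ k (G.mu m b ⟨w, hK' hw⟩ k))
        (φ (G.mu m b ⟨fun i => w i + t, fun _ => mem_univ _,
          fun _ _ e => (hK' hw).2 (add_right_cancel e)⟩ l)) := by
  have hmem : ∀ w ∈ K, ((fun _ => t, w) : (Fin (0 + 1) → ℂ) × (Fin m → ℂ)) ∈ assocSet 0 m :=
    fun w hw => ⟨⟨fun _ => mem_univ _, fun i j _ => Subsingleton.elim (α := Fin 1) i j⟩, hK' hw,
      fun i => i.elim0⟩
  obtain ⟨-, h⟩ := G.assoc 0 m Fin.elim0 b l ((fun w => (fun _ => t, w)) '' K)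
    (by rintro _ ⟨w, hw, rfl⟩; exact hmem w hw) (hK.image (by fun_prop))
  obtain ⟨u, hu, hb, hs⟩ := h φ
  refine ⟨u, hu, fun k w hw => ?_, fun w hw => ?_⟩
  · have := hb k ⟨_, hmem w hw⟩ (mem_image_of_mem _ hw)
    rw [assocTerm_zero] at this
    exact this
  · have := hs ⟨_, hmem w hw⟩ (mem_image_of_mem _ hw)
    simp only [assocTerm_zero] at this
    have key : ∀ (n : ℕ) (hn : m = n) (b' : Fin n → Tot V) (z' : Conf univ (Fin n))
        (z : Conf univ (Fin m)), (∀ i, b' i = b (Fin.cast hn.symm i)) →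
        (∀ i, z'.1 i = z.1 (Fin.cast hn.symm i)) → G.mu m b z l = G.mu n b' z' l := by
      rintro n rfl b' z' z hb hz
      rw [show b' = b from funext hb, show z' = z from Subtype.ext (funext hz)]
    refine Eq.mp ?_ this
    refine congrArg (HasSum _) (congrArg φ ?_)
    symm
    refine key _ (Nat.zero_add m).symm _ _ _ (fun i => ?_) (fun i => ?_)
    · rw [Fin.elim0_append]; rfl
    · change Fin.append (fun _ : Fin 0 => t) (fun j => w j + t) i = _
      rw [show (fun _ : Fin 0 => t) = Fin.elim0 from funext fun i => i.elim0, Fin.elim0_append]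
      rfl

/-- The evaluation of `g x` is determined by that of `x`. -/
lemma hasSum_ev_sigmaE (g : Aff) (U : Opens ℂ) (x : Expr (Tot V) U) (l : ℤ)
    (φ : Module.Dual ℂ (V l)) :
    HasSum (fun k => shiftFun G g.tr l φ k (((g.lam ^ k : ℂˣ) : ℂ) • ev G U x k))
      (φ (ev G (g.map U) (sigmaE g U x) l)) := by
  induction x using expr_induction with
  | h0 => simp
  | hadd x y hx hy => simpa using hx.add hy
  | h m α a =>
    rw [sigmaE_cls, ev_cls, dual_pairing, push_apply]
    have e1 : ∀ k, shiftFun G g.tr l φ k (((g.lam ^ k : ℂˣ) : ℂ) • ev G U (cls U α a) k) =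
        α.1 (holComp (((g.lam ^ k : ℂˣ) : ℂ) • shiftFun G g.tr l φ k) (muW G U m k a)) := by
      intro k
      rw [ev_cls, ← dual_pairing, LinearMap.smul_apply, map_smul]
    simp only [e1]
    refine hasSum_functional α _ _ fun K hKU hK => ?_
    set b : Fin m → Tot V := fun i => scale V g.lam (a i) with hb
    let s : (Fin m → ℂ) → (Fin m → ℂ) := fun z i => g.lam * z i
    have hs : Continuous s := by fun_prop
    have hK' : s '' K ⊆ Conf univ (Fin m) := by
      rintro _ ⟨z, hz, rfl⟩
      exact ⟨fun _ => mem_univ _, fun _ _ e =>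
        (hKU hz).2 (mul_left_cancel₀ g.lam.ne_zero e)⟩
    obtain ⟨u, hu, hb', hs'⟩ := hasSum_translate G g.tr l φ b (s '' K) (hK.image hs) hK'
    have e2 : ∀ k (x : Conf (U : Set ℂ) (Fin m)) (hx : x.1 ∈ K),
        (holComp (((g.lam ^ k : ℂˣ) : ℂ) • shiftFun G g.tr l φ k) (muW G U m k a)).1 x =
        shiftFun G g.tr l φ k (G.mu m b ⟨s x.1, hK' (mem_image_of_mem s hx)⟩ k) := by
      intro k x hx
      have := G.equivariant m g.lam a (toUniv x) k
      change _ = shiftFun G g.tr l φ k (G.mu m b (scaleConf g.lam (toUniv x)) k)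
      rw [hb, this, map_smul]
      rfl
    refine ⟨u, hu, fun k x hx => ?_, fun x hx => ?_⟩
    · rw [e2 k x hx]
      exact hb' k _ (mem_image_of_mem s hx)
    · simp only [e2 _ x hx]
      exact hs' _ (mem_image_of_mem s hx)

lemma sigmaE_mem_relations (g : Aff) {U : Opens ℂ} {x : Expr (Tot V) U}
    (hx : x ∈ relations G U) : sigmaE g U x ∈ relations G (g.map U) := by
  rw [relations, LinearMap.mem_ker] at hx ⊢
  ext l
  refine eq_of_dual fun φ => ?_
  have := hasSum_ev_sigmaE G g U x l φ
  rw [hx] at this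
  simp only [Pi.zero_apply, smul_zero, map_zero] at this
  rw [Pi.zero_apply, map_zero]
  exact this.unique hasSum_zero

/-! ### The prefactorization algebra `FV` -/

/-- Round open discs. -/
def IsDisc (d : Opens ℂ) : Prop := ∃ (p : ℂ) (r : ℝ), 0 < r ∧ (d : Set ℂ) = Metric.ball p r

lemma IsDisc.map {d : Opens ℂ} (h : IsDisc d) (g : Aff) : IsDisc (g.map d) := by
  obtain ⟨p, r, hr, e⟩ := h
  have hn : 0 < ‖(g.lam : ℂ)‖ := norm_pos_iff.2 g.lam.ne_zero
  refine ⟨g.act p, ‖(g.lam : ℂ)‖ * r, by positivity, ?_⟩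
  have key : ∀ z, dist (g.act z) (g.act p) = ‖(g.lam : ℂ)‖ * dist z p := by
    intro z
    rw [dist_eq_norm, dist_eq_norm, ← norm_mul]
    congr 1
    unfold Aff.act; ring
  ext w
  constructor
  · rintro ⟨z, hz, rfl⟩
    rw [e] at hz
    rw [Metric.mem_ball, key]
    exact mul_lt_mul_of_pos_left hz hn
  · intro hw
    have h1 : g.act ((g⁻¹).act w) = w := by rw [← Aff.act_mul, mul_inv_cancel, Aff.act_one]
    refine ⟨(g⁻¹).act w, ?_, h1⟩
    rw [e, Metric.mem_ball]
    rw [Metric.mem_ball, ← h1, key] at hw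
    exact lt_of_mul_lt_mul_left hw hn.le

/-- The relations on discs. -/
def discRelations (U : Opens ℂ) : Submodule ℂ (Expr (Tot V) U) :=
  Submodule.span ℂ {x | ∃ (d W : Opens ℂ) (h : Disjoint d W) (hd : d ≤ U) (hW : W ≤ U),
    IsDisc d ∧ ∃ r ∈ relations G d, ∃ e : Expr (Tot V) W, x = exprMul h hd hW r e}

/-- The subspace that is divided out. -/
def closedRelations (U : Opens ℂ) : Submodule ℂ (Expr (Tot V) U) :=
  bClosure (isBVS_expr (Tot V) U) (discRelations G U)

lemma exprMul_mem_closed {U U' W : Opens ℂ} (h : Disjoint U U') (hU : U ≤ W) (hU' : U' ≤ W)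
    {x : Expr (Tot V) U} (hx : x ∈ closedRelations G U) (y : Expr (Tot V) U') :
    exprMul h hU hU' x y ∈ closedRelations G W := by
  refine bClosure_map (isBVS_expr _ U) (isBVS_expr _ W) ((exprMul h hU hU').flip y) ?_ ?_ x hx
  · intro S hS
    refine (bddMap₂_exprMul h hU hU' S {y} hS (bdd_singleton _ _)).subset ?_
    rintro _ ⟨x, hx, rfl⟩
    exact ⟨x, hx, y, rfl, rfl⟩
  · intro x hx
    refine le_bClosure _ _ ?_
    rw [discRelations] at hx
    refine Submodule.span_induction (p := fun x _ => (exprMul h hU hU').flip y x ∈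
      discRelations G W) ?_ ?_ ?_ ?_ hx
    · rintro _ ⟨d, D, hdD, hd, hD, hdisc, r, hr, e, rfl⟩
      have h1 : Disjoint d U' := h.mono_left hd
      have h2 : Disjoint D U' := h.mono_left hD
      have h3 : Disjoint d (D ⊔ U') := disjoint_sup_right.2 ⟨hdD, h1⟩
      refine Submodule.subset_span ⟨d, D ⊔ U', h3, hd.trans hU,
        sup_le (hD.trans hU) hU', hdisc, r, hr, exprMul h2 le_sup_left le_sup_right e y, ?_⟩
      rw [LinearMap.flip_apply]
      exact exprMul_assoc hdD h2 h3 h hd hD le_sup_left le_sup_right hU _ r e y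
    · rw [map_zero]; exact Submodule.zero_mem _
    · intro x y _ _ hx hy
      rw [map_add]; exact Submodule.add_mem _ hx hy
    · intro c x _ hx
      rw [map_smul]; exact Submodule.smul_mem _ c hx

lemma exprMul_mem_closed' {U U' W : Opens ℂ} (h : Disjoint U U') (hU : U ≤ W) (hU' : U' ≤ W)
    (x : Expr (Tot V) U) {y : Expr (Tot V) U'} (hy : y ∈ closedRelations G U') :
    exprMul h hU hU' x y ∈ closedRelations G W := by
  rw [← exprMul_comm]
  exact exprMul_mem_closed G h.symm hU' hU hy x

lemma sigmaE_mem_closed (g : Aff) {U : Opens ℂ} {x : Expr (Tot V) U}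
    (hx : x ∈ closedRelations G U) : sigmaE g U x ∈ closedRelations G (g.map U) := by
  refine bClosure_map (isBVS_expr _ U) (isBVS_expr _ _) (sigmaE g U) (bddMap_exprAct _ _ _) ?_ x hx
  intro x hx
  refine le_bClosure _ _ ?_
  rw [discRelations] at hx
  refine Submodule.span_induction (p := fun x _ => sigmaE g U x ∈
    discRelations G (g.map U)) ?_ ?_ ?_ ?_ hx
  · rintro _ ⟨d, D, hdD, hd, hD, hdisc, r, hr, e, rfl⟩
    exact Submodule.subset_span ⟨g.map d, g.map D, g.map_disjoint hdD, g.map_mono hd,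
      g.map_mono hD, hdisc.map g, _, sigmaE_mem_relations G g hr, _, exprAct_mul _ _ _ _ _ _ _⟩
  · rw [map_zero]; exact Submodule.zero_mem _
  · intro x y _ _ hx hy
    rw [map_add]; exact Submodule.add_mem _ hx hy
  · intro c x _ hx
    rw [map_smul]; exact Submodule.smul_mem _ c hx

end Evaluation

section FactorizationAlgebra

variable {V : ℤ → Type u} [∀ k, AddCommGroup (V k)] [∀ k, Module ℂ (V k)] (G : GVA V)

lemma scale_one (a : Tot V) : scale V 1 a = a := by
  refine DFinsupp.ext fun k => ?_
  rw [scale_apply, one_zpow, Units.val_one, one_smul]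

lemma scale_mul (x y : ℂˣ) (a : Tot V) : scale V (x * y) a = scale V x (scale V y a) := by
  refine DFinsupp.ext fun k => ?_
  rw [scale_apply, scale_apply, scale_apply, mul_zpow, Units.val_mul, mul_smul]

lemma sigmaE_one {U : Opens ℂ} (x : Expr (Tot V) U) : sigmaE 1 U x =
    exprMul disjoint_bot_right (Aff.map_one U).ge bot_le x (exprOne (Tot V) ⊥) := by
  induction x using expr_induction with
  | h0 => simp
  | hadd x y hx hy => simp only [map_add, LinearMap.add_apply, hx, hy]
  | h m α a =>
    rw [sigmaE_cls, cls, cls, exprMul_one, preInc_tmul]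
    congr 2
    · exact OPrime.ext' fun f => congrArg α.1 (Subtype.ext (funext fun z =>
        congrArg f.1 (Subtype.ext (funext fun i => Aff.act_one (z.1 i)))))
    · exact tprod_congr fun i => scale_one (a i)

lemma sigmaE_mul (g h : Aff) {U : Opens ℂ} (x : Expr (Tot V) U) : sigmaE (g * h) U x =
    exprMul disjoint_bot_right (Aff.map_mul g h U).ge bot_le
      (sigmaE g (h.map U) (sigmaE h U x)) (exprOne (Tot V) ⊥) := by
  induction x using expr_induction with
  | h0 => simp
  | hadd x y hx hy => simp only [map_add, LinearMap.add_apply, hx, hy]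
  | h m α a =>
    rw [sigmaE_cls, sigmaE_cls, sigmaE_cls, cls, cls, exprMul_one, preInc_tmul]
    congr 2
    · exact OPrime.ext' fun f => congrArg α.1 (Subtype.ext (funext fun z =>
        congrArg f.1 (Subtype.ext (funext fun i => Aff.act_mul g h (z.1 i)))))
    · exact tprod_congr fun i => scale_mul g.lam h.lam (a i)

lemma sigmaE_unit (g : Aff) : sigmaE g ⊥ (exprOne (Tot V) ⊥) =
    exprMul disjoint_bot_right bot_le bot_le (exprOne (Tot V) ⊥) (exprOne (Tot V) ⊥) := by
  conv_lhs => rw [exprOne, sigmaE_cls]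
  conv_rhs =>
    arg 1
    rw [exprOne]
  rw [cls, cls, exprMul_one, preInc_tmul]
  congr 2
  · exact OPrime.ext' fun f => congrArg f.1 (Subtype.ext (funext fun i => i.elim0))
  · exact tprod_congr fun i => i.elim0

lemma exprMul_one_self {U : Opens ℂ} (x : Expr (Tot V) U) :
    exprMul disjoint_bot_right le_rfl bot_le x (exprOne (Tot V) ⊥) = x := by
  induction x using expr_induction with
  | h0 => simp
  | hadd x y hx hy => simp only [map_add, LinearMap.add_apply, hx, hy]
  | h m α a => rw [cls, exprMul_one, preInc_refl]

/-- `FV(U) = EV(U) / closure of the relations on discs`. -/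
def FObj (U : Opens ℂ) : Type u := Expr (Tot V) U ⧸ closedRelations G U

instance (U : Opens ℂ) : AddCommGroup (FObj G U) :=
  inferInstanceAs (AddCommGroup (Expr (Tot V) U ⧸ closedRelations G U))

instance (U : Opens ℂ) : Module ℂ (FObj G U) :=
  inferInstanceAs (Module ℂ (Expr (Tot V) U ⧸ closedRelations G U))

/-- The quotient map `EV(U) → FV(U)`. -/
def toF (U : Opens ℂ) : Expr (Tot V) U →ₗ[ℂ] FObj G U := (closedRelations G U).mkQ

lemma toF_surjective (U : Opens ℂ) : Function.Surjective (toF G U) :=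
  (closedRelations G U).mkQ_surjective

lemma toF_eq_zero {U : Opens ℂ} {x : Expr (Tot V) U} (hx : x ∈ closedRelations G U) :
    toF G U x = 0 := (Submodule.Quotient.mk_eq_zero _).2 hx

/-- Descent of linear maps to `FV(U)`. -/
def liftF {U : Opens ℂ} {P : Type*} [AddCommGroup P] [Module ℂ P] (f : Expr (Tot V) U →ₗ[ℂ] P)
    (h : ∀ x ∈ closedRelations G U, f x = 0) : FObj G U →ₗ[ℂ] P :=
  (closedRelations G U).liftQ f fun x hx => h x hx

lemma liftF_toF {U : Opens ℂ} {P : Type*} [AddCommGroup P] [Module ℂ P]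
    (f : Expr (Tot V) U →ₗ[ℂ] P) (h : ∀ x ∈ closedRelations G U, f x = 0) (x : Expr (Tot V) U) :
    liftF G f h (toF G U x) = f x := rfl

/-- The multiplication of `FV`. -/
def mulF {U U' W : Opens ℂ} (h : Disjoint U U') (hU : U ≤ W) (hU' : U' ≤ W) :
    FObj G U →ₗ[ℂ] FObj G U' →ₗ[ℂ] FObj G W :=
  liftF G (LinearMap.flip (liftF G ((exprMul h hU hU').compr₂ (toF G W)).flip (fun y hy => by
    refine LinearMap.ext fun x => ?_
    exact toF_eq_zero G (exprMul_mem_closed' G h hU hU' x hy)))) (fun x hx => by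
    refine LinearMap.ext fun y => ?_
    obtain ⟨y, rfl⟩ := toF_surjective G U' y
    exact toF_eq_zero G (exprMul_mem_closed G h hU hU' hx y))

lemma mulF_toF {U U' W : Opens ℂ} (h : Disjoint U U') (hU : U ≤ W) (hU' : U' ≤ W)
    (x : Expr (Tot V) U) (y : Expr (Tot V) U') :
    mulF G h hU hU' (toF G U x) (toF G U' y) = toF G W (exprMul h hU hU' x y) := rfl

/-- The action of affine transformations on `FV`. -/
def sigmaF (g : Aff) (U : Opens ℂ) : FObj G U →ₗ[ℂ] FObj G (g.map U) :=
  liftF G (toF G _ ∘ₗ sigmaE g U) fun _ hx => toF_eq_zero G (sigmaE_mem_closed G g hx)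

lemma sigmaF_toF (g : Aff) (U : Opens ℂ) (x : Expr (Tot V) U) :
    sigmaF G g U (toF G U x) = toF G _ (sigmaE g U x) := rfl

/-- The bornology of `FV(U)`. -/
@[reducible] def bornF (U : Opens ℂ) : Bornology (FObj G U) :=
  quotBorn (exprBorn (Tot V) U) (closedRelations G U)

lemma mulF_bdd {U U' W : Opens ℂ} (h : Disjoint U U') (hU : U ≤ W) (hU' : U' ≤ W) :
    BddMap₂ (bornF G U) (bornF G U') (bornF G W) fun x y => mulF G h hU hU' x y := by
  have key : BddMap₂ (exprBorn (Tot V) U) (exprBorn (Tot V) U') (bornF G W)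
      fun x y => mulF G h hU hU' (toF G U x) (toF G U' y) := by
    intro S T hS hT
    refine (bddMap_mkQ (exprBorn (Tot V) W) (closedRelations G W) _
      (bddMap₂_exprMul h hU hU' S T hS hT)).subset ?_
    rintro _ ⟨x, hx, y, hy, rfl⟩
    exact ⟨_, ⟨x, hx, y, hy, rfl⟩, rfl⟩
  exact bddMap₂_quot (X := Expr (Tot V) U) (Y := Expr (Tot V) U') (Z := FObj G W) key

lemma mulF_assoc {U₁ U₂ U₃ V₁ V₂ W : Opens ℂ} (h₁₂ : Disjoint U₁ U₂) (h₂₃ : Disjoint U₂ U₃)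
    (h₁ : Disjoint U₁ V₂) (h₃ : Disjoint V₁ U₃) (i₁ : U₁ ≤ V₁) (i₂ : U₂ ≤ V₁) (i₂' : U₂ ≤ V₂)
    (i₃ : U₃ ≤ V₂) (hV₁ : V₁ ≤ W) (hV₂ : V₂ ≤ W) (x : FObj G U₁) (y : FObj G U₂)
    (z : FObj G U₃) : mulF G h₃ hV₁ (i₃.trans hV₂) (mulF G h₁₂ i₁ i₂ x y) z =
      mulF G h₁ (i₁.trans hV₁) hV₂ x (mulF G h₂₃ i₂' i₃ y z) := by
  obtain ⟨x, rfl⟩ := toF_surjective G _ x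
  obtain ⟨y, rfl⟩ := toF_surjective G _ y
  obtain ⟨z, rfl⟩ := toF_surjective G _ z
  rw [mulF_toF, mulF_toF, mulF_toF, mulF_toF]
  exact congrArg (toF G W) (exprMul_assoc h₁₂ h₂₃ h₁ h₃ i₁ i₂ i₂' i₃ hV₁ hV₂ x y z)

/-- The unit of `FV`. -/
def oneF : FObj G ⊥ := toF G ⊥ (exprOne (Tot V) ⊥)

lemma mulF_one {U : Opens ℂ} (x : FObj G U) :
    mulF G disjoint_bot_right le_rfl bot_le x (oneF G) = x := by
  obtain ⟨x, rfl⟩ := toF_surjective G _ x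
  rw [oneF, mulF_toF, exprMul_one_self]

lemma mulF_comm {U U' W : Opens ℂ} (h : Disjoint U U') (hU : U ≤ W) (hU' : U' ≤ W)
    (x : FObj G U) (y : FObj G U') : mulF G h.symm hU' hU y x = mulF G h hU hU' x y := by
  obtain ⟨x, rfl⟩ := toF_surjective G _ x
  obtain ⟨y, rfl⟩ := toF_surjective G _ y
  rw [mulF_toF, mulF_toF, exprMul_comm]

lemma sigmaF_bdd (g : Aff) (U : Opens ℂ) :
    BddMap (bornF G U) (bornF G (g.map U)) (sigmaF G g U) :=
  bddMap_quot (X := Expr (Tot V) U) (Z := FObj G (g.map U))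
    ((bddMap_mkQ (exprBorn (Tot V) _) (closedRelations G _)).comp' (bddMap_exprAct g _ U))

lemma sigmaF_one {U : Opens ℂ} (x : FObj G U) : sigmaF G 1 U x =
    mulF G disjoint_bot_right (Aff.map_one U).ge bot_le x (oneF G) := by
  obtain ⟨x, rfl⟩ := toF_surjective G _ x
  rw [oneF, mulF_toF, sigmaF_toF, sigmaE_one]

lemma sigmaF_mul (g h : Aff) {U : Opens ℂ} (x : FObj G U) : sigmaF G (g * h) U x =
    mulF G disjoint_bot_right (Aff.map_mul g h U).ge bot_le
      (sigmaF G g (h.map U) (sigmaF G h U x)) (oneF G) := by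
  obtain ⟨x, rfl⟩ := toF_surjective G _ x
  rw [oneF, sigmaF_toF, sigmaF_toF, sigmaF_toF, mulF_toF, sigmaE_mul]

lemma sigmaF_unit (g : Aff) : sigmaF G g ⊥ (oneF G) =
    mulF G disjoint_bot_right bot_le bot_le (oneF G) (oneF G) := by
  rw [oneF, sigmaF_toF, mulF_toF, sigmaE_unit]

lemma sigmaF_mul_map (g : Aff) {U U' W : Opens ℂ} (h : Disjoint U U') (hU : U ≤ W)
    (hU' : U' ≤ W) (x : FObj G U) (y : FObj G U') : sigmaF G g W (mulF G h hU hU' x y) =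
      mulF G (g.map_disjoint h) (g.map_mono hU) (g.map_mono hU') (sigmaF G g U x)
        (sigmaF G g U' y) := by
  obtain ⟨x, rfl⟩ := toF_surjective G _ x
  obtain ⟨y, rfl⟩ := toF_surjective G _ y
  rw [mulF_toF, sigmaF_toF, sigmaF_toF, sigmaF_toF, mulF_toF]
  exact congrArg (toF G _) (exprAct_mul g _ h hU hU' x y)

/-- The affine-linearly invariant prefactorization algebra `FV`. -/
def FV : AffPFA.{u} where
  obj := FObj G
  born := bornF G
  isBVS U := isBVS_quot (isBVS_expr _ U) _
  mul := mulF G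
  mul_bdd := mulF_bdd G
  one := oneF G
  mul_assoc := mulF_assoc G
  mul_one := mulF_one G
  mul_comm := mulF_comm G
  act := sigmaF G
  act_bdd := sigmaF_bdd G
  act_one := sigmaF_one G
  act_mul := sigmaF_mul G
  act_unit := sigmaF_unit G
  act_mul_map := sigmaF_mul_map G

end FactorizationAlgebra

/-! ### The vertex algebra of a prefactorization algebra -/

section Discs

/-- The open disc `B_r(p)`. -/
def disc (p : ℂ) (r : ℝ) : Opens ℂ := ⟨Metric.ball p r, Metric.isOpen_ball⟩

lemma disc_mono (p : ℂ) {r s : ℝ} (h : r ≤ s) : disc p r ≤ disc p s :=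
  fun _ hz => Metric.ball_subset_ball h hz

/-- The dilation `w ↦ q w`. -/
def Aff.dil (q : ℂˣ) : Aff := ⟨q, 0⟩

/-- The translation `w ↦ w + z`. -/
def Aff.transl (z : ℂ) : Aff := ⟨1, z⟩

lemma Aff.dil_disc_le {q : ℂˣ} (hq : ‖(q : ℂ)‖ < 1) (r : ℝ) :
    (Aff.dil q).map (disc 0 r) ≤ disc 0 r := by
  rintro _ ⟨w, hw, rfl⟩
  have hw' : ‖w‖ < r := by simpa [disc] using hw
  have : (Aff.dil q).act w = q * w := by simp [Aff.act, Aff.dil]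
  change _ ∈ Metric.ball _ _
  rw [this, mem_ball_zero_iff, norm_mul]
  exact (mul_le_of_le_one_left (norm_nonneg w) hq.le).trans_lt hw'

lemma Aff.transl_disc_le (z : ℂ) (r : ℝ) : (Aff.transl z).map (disc 0 r) ≤ disc z r := by
  rintro _ ⟨w, hw, rfl⟩
  have hw' : ‖w‖ < r := by simpa [disc] using hw
  have : (Aff.transl z).act w = w + z := by simp [Aff.act, Aff.transl]
  change _ ∈ Metric.ball _ _
  rw [this, mem_ball_iff_norm, add_sub_cancel_right]
  exact hw'

/-- The radii `r 1, …, r m, R > 0` are such that the `B_{r i}(z i)` are pairwise disjoint and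
contained in `B_R(0)`. -/
structure Admissible {m : ℕ} (z : Fin m → ℂ) (r : Fin m → ℝ) (R : ℝ) : Prop where
  pos : ∀ i, 0 < r i
  pos' : 0 < R
  disj : ∀ i j, i ≠ j → Disjoint (disc (z i) (r i)) (disc (z j) (r j))
  le : ∀ i, disc (z i) (r i) ≤ disc 0 R

lemma exists_admissible {m : ℕ} (z : Conf (univ : Set ℂ) (Fin m)) :
    ∃ p : (Fin m → ℝ) × ℝ, Admissible z.1 p.1 p.2 := by
  have h1 : ∀ᶠ ε : ℝ in 𝓝[>] 0, ∀ i j, i ≠ j →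
      Disjoint (disc (z.1 i) ε) (disc (z.1 j) ε) := by
    rw [eventually_all]; intro i
    rw [eventually_all]; intro j
    by_cases h : i = j
    · exact Eventually.of_forall fun _ h' => absurd h h'
    · have hd : 0 < dist (z.1 i) (z.1 j) / 2 := half_pos (dist_pos.2 fun e => h (z.2.2 e))
      filter_upwards [nhdsWithin_le_nhds (Iio_mem_nhds hd)] with ε hε _
      rw [← Opens.coe_disjoint]
      exact Metric.ball_disjoint_ball (by have : ε < _ := hε; linarith)
  obtain ⟨ε, h, hε⟩ := (h1.and self_mem_nhdsWithin).exists
  have h2 : ∀ᶠ R : ℝ in atTop, ∀ i, disc (z.1 i) ε ≤ disc 0 R := by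
    rw [eventually_all]; intro i
    filter_upwards [eventually_ge_atTop (‖z.1 i‖ + ε)] with R hR
    intro w hw
    refine Metric.ball_subset_ball' ?_ hw
    rw [dist_zero_right]; linarith
  obtain ⟨R, h', hR⟩ := (h2.and (eventually_gt_atTop 0)).exists
  exact ⟨(fun _ => ε, R), fun _ => hε, hR, h, h'⟩

end Discs

section CircleIntegral

variable {X : Type u} [AddCommGroup X] [Module ℂ X]

/-- `v` is the contour integral of `f` over the circle `|z| = 1/2`, computed in a Banach space with
a bounded linear map to `X`. -/
def HasCircleIntegral (b : Bornology X) (f : ℂ → X) (v : X) : Prop :=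
  ∃ (Y : Type u) (_ : NormedAddCommGroup Y) (_ : NormedSpace ℂ Y) (_ : CompleteSpace Y)
    (j : Y →ₗ[ℂ] X) (g : ℂ → Y), (∀ T : Set Y, Bornology.IsBounded T → Bdd b (j '' T)) ∧
      ContinuousOn g (Metric.sphere 0 (1 / 2)) ∧
      (∀ z ∈ Metric.sphere (0 : ℂ) (1 / 2), j (g z) = f z) ∧ j (circleIntegral g 0 (1 / 2)) = v

open Classical in
/-- The contour integral over the circle `|z| = 1/2`, or `0` if it does not exist. -/
def circInt (b : Bornology X) (f : ℂ → X) : X :=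
  if h : ∃ v, HasCircleIntegral b f v then h.choose else 0

end CircleIntegral

namespace AffPFA

variable (F : AffPFA.{u})

/-- The extension maps of the underlying precosheaf. -/
def ext {U W : Opens ℂ} (h : U ≤ W) : F.obj U →ₗ[ℂ] F.obj W :=
  (F.mul disjoint_bot_right h bot_le).flip F.one

/-- The `m`-ary multiplication maps. -/
def mmul : ∀ (m : ℕ) (U : Fin m → Opens ℂ) (W : Opens ℂ),
    (∀ i j, i ≠ j → Disjoint (U i) (U j)) → (∀ i, U i ≤ W) → (∀ i, F.obj (U i)) → F.obj W
  | 0, _, _, _, _, _ => F.ext bot_le F.one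
  | m + 1, U, _, hd, hW, x =>
    F.mul (V := ⨆ i : Fin m, U i.succ)
      (disjoint_iSup_iff.2 fun i => hd 0 i.succ (Fin.succ_ne_zero i).symm) (hW 0)
      (iSup_le fun i => hW i.succ) (x 0)
      (mmul m (fun i => U i.succ) _ (fun _ _ h => hd _ _ fun e => h (Fin.succ_injective m e))
        (le_iSup fun i : Fin m => U i.succ) fun i => x i.succ)

/-- The action of `q ∈ ℂˣ` with `|q| < 1` on `F(B_r(0))`. -/
def rho (r : ℝ) (q : ℂˣ) (hq : ‖(q : ℂ)‖ < 1) : F.obj (disc 0 r) →ₗ[ℂ] F.obj (disc 0 r) :=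
  F.ext (Aff.dil_disc_le hq r) ∘ₗ F.act (Aff.dil q) (disc 0 r)

/-- The costalk `F(0) = lim F(B_r(0))`. -/
def costalk : Submodule ℂ (∀ r : {r : ℝ // 0 < r}, F.obj (disc 0 r)) where
  carrier := {x | ∀ (r s : {r : ℝ // 0 < r}) (h : (r : ℝ) ≤ s),
    F.ext (disc_mono 0 h) (x r) = x s}
  zero_mem' _ _ _ := map_zero _
  add_mem' hx hy r s h := by
    rw [Pi.add_apply, Pi.add_apply, map_add, hx r s h, hy r s h]
  smul_mem' c x hx r s h := by
    rw [Pi.smul_apply, Pi.smul_apply, map_smul, hx r s h]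

/-- The bornology of the costalk. -/
@[reducible] def costalkBorn : Bornology F.costalk :=
  subBorn (piBorn fun r : {r : ℝ // 0 < r} => F.born (disc 0 r)) F.costalk

/-- The weight space `F(0)_k` of the costalk. -/
def weightSpace (k : ℤ) : Submodule ℂ F.costalk where
  carrier := {x | ∀ (q : ℂˣ) (hq : ‖(q : ℂ)‖ < 1) (r : {r : ℝ // 0 < r}),
    F.rho r q hq (x.1 r) = ((q ^ k : ℂˣ) : ℂ) • x.1 r}
  zero_mem' q hq r := by
    change F.rho r q hq 0 = _ • (0 : F.obj (disc 0 r))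
    rw [map_zero, smul_zero]
  add_mem' {x y} hx hy q hq r := by
    change F.rho r q hq (x.1 r + y.1 r) = _ • (x.1 r + y.1 r)
    rw [map_add, smul_add, hx q hq r, hy q hq r]
  smul_mem' c x hx q hq r := by
    change F.rho r q hq (c • x.1 r) = _ • c • x.1 r
    rw [map_smul, hx q hq r, smul_comm]

/-- The homogeneous components of the graded vector space `VF`. -/
def VF (k : ℤ) : Type u := F.weightSpace k

instance (k : ℤ) : AddCommGroup (F.VF k) := inferInstanceAs (AddCommGroup (F.weightSpace k))

instance (k : ℤ) : Module ℂ (F.VF k) := inferInstanceAs (Module ℂ (F.weightSpace k))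

/-- The bornology of the homogeneous components of `VF`. -/
@[reducible] def bornVF (k : ℤ) : Bornology (F.VF k) := subBorn F.costalkBorn (F.weightSpace k)

/-- The map `π_r` from `F(0)_k` to `F(B_r(0))`. -/
def proj (r : {r : ℝ // 0 < r}) (k : ℤ) : F.VF k →ₗ[ℂ] F.obj (disc 0 r) :=
  LinearMap.proj r ∘ₗ F.costalk.subtype ∘ₗ (F.weightSpace k).subtype

/-- The map `P_r` from `VF` to `F(B_r(0))`. -/
def P (r : {r : ℝ // 0 < r}) : Tot F.VF →ₗ[ℂ] F.obj (disc 0 r) :=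
  DirectSum.toModule ℂ ℤ _ (F.proj r)

open Classical in
/-- The projection `l_k` to the `k`-th weight space,
`x ↦ (2 π i)⁻¹ ∮ z ^ (- k - 1) ρ(z) x dz`. -/
def wproj (r : ℝ) (k : ℤ) (x : F.obj (disc 0 r)) : F.obj (disc 0 r) :=
  (2 * Real.pi * Complex.I)⁻¹ • circInt (F.born (disc 0 r)) fun z =>
    if h : z ≠ 0 ∧ ‖z‖ < 1 then z ^ (-k - 1) • F.rho r (Units.mk0 z h.1) h.2 x else 0

/-- The `k`-th component of `L^R`: the composition of `l_k` and the inverse of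
`π_R : F(0)_k ≅ F(B_R(0))_k`. -/
def L (R : {r : ℝ // 0 < r}) (k : ℤ) (x : F.obj (disc 0 R)) : F.VF k :=
  Function.invFun (F.proj R k) (F.wproj R k x)

/-- The inclusion of `VF` into `F(B_r(z))` by translation. -/
def place (z : ℂ) (r : {r : ℝ // 0 < r}) (a : Tot F.VF) : F.obj (disc z r) :=
  F.ext (Aff.transl_disc_le z r) (F.act (Aff.transl z) (disc 0 r) (F.P r a))

/-- The multiplication maps of `VF`, computed with specific radii. -/
def muRad {m : ℕ} {z : Fin m → ℂ} {r : Fin m → ℝ} {R : ℝ} (h : Admissible z r R)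
    (a : Fin m → Tot F.VF) (k : ℤ) : F.VF k :=
  F.L ⟨R, h.pos'⟩ k (F.mmul m (fun i => disc (z i) (r i)) (disc 0 R) h.disj h.le
    fun i => F.place (z i) ⟨r i, h.pos i⟩ (a i))

/-- The multiplication maps of `VF`. -/
def mu (m : ℕ) (a : Fin m → Tot F.VF) (z : Conf (univ : Set ℂ) (Fin m)) (k : ℤ) : F.VF k :=
  F.muRad (exists_admissible z).choose_spec a k

/-- The homogeneous components of `VF` are discrete. -/
def HasDiscreteWeightSpaces : Prop := ∀ k, F.bornVF k = discreteBorn (F.VF k)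

/-- `F` has discrete weight spaces and `(VF, μ)` satisfies the meromorphicity axiom. -/
def HasMeromorphicOPE : Prop := F.HasDiscreteWeightSpaces ∧ IsMeromorphic F.mu

end AffPFA

/-! ### The comparison map -/

section Comparison

variable {V : ℤ → Type u} [∀ k, AddCommGroup (V k)] [∀ k, Module ℂ (V k)] (G : GVA V)

lemma scale_tin (lam : ℂˣ) (k : ℤ) (a : V k) :
    scale V lam (tin V k a) = tin V k (((lam ^ k : ℂˣ) : ℂ) • a) := by
  refine DFinsupp.ext fun l => ?_
  rw [scale_apply]
  by_cases h : k = l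
  · subst h
    rw [tin, DirectSum.lof_apply, DirectSum.lof_apply]
  · have e : ∀ x : V k, (tin V k x) l = 0 := fun x => DFinsupp.single_eq_of_ne (Ne.symm h)
    rw [e, e, smul_zero]

/-- The point `0` as a configuration in `B_r(0)`. -/
def originConf (r : {r : ℝ // 0 < r}) : Conf (disc 0 r : Set ℂ) (Fin 1) :=
  ⟨fun _ => 0, fun _ => Metric.mem_ball_self r.2, fun _ _ _ => Subsingleton.elim _ _⟩

/-- The linear map `a ↦ [α ⊗ a]`, where `a` has degree `k`. -/
def clsOne (U : Opens ℂ) (α : OPrime (Conf (U : Set ℂ) (Fin 1))) (k : ℤ) :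
    V k →ₗ[ℂ] Expr (Tot V) U where
  toFun a := cls U α fun _ => tin V k a
  map_add' a b := by
    have := tprod.map_update_add (fun _ : Fin 1 => (0 : Tot V)) 0 (tin V k a) (tin V k b)
    rw [← map_add] at this
    have e : ∀ x : Tot V, Function.update (fun _ : Fin 1 => (0 : Tot V)) 0 x = fun _ => x :=
      fun x => by ext i : 1; rw [Subsingleton.elim i 0, Function.update_self]
    rw [e, e, e] at this
    rw [cls, cls, cls, this, TensorProduct.tmul_add, map_add]
  map_smul' c a := by
    have := tprod.map_update_smul (fun _ : Fin 1 => (0 : Tot V)) 0 c (tin V k a)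
    rw [← map_smul] at this
    have e : ∀ x : Tot V, Function.update (fun _ : Fin 1 => (0 : Tot V)) 0 x = fun _ => x :=
      fun x => by ext i : 1; rw [Subsingleton.elim i 0, Function.update_self]
    rw [e, e] at this
    rw [cls, cls, this, TensorProduct.tmul_smul, map_smul, RingHom.id_apply]

/-- The class `[δ_0 ⊗ a]` in `FV(B_r(0))`. -/
def deltaClass (r : {r : ℝ // 0 < r}) (k : ℤ) : V k →ₗ[ℂ] (FV G).obj (disc 0 r) :=
  toF G (disc 0 r) ∘ₗ clsOne (disc 0 r) (delta (originConf r)) k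

lemma ext_toF_cls {U W : Opens ℂ} (h : U ≤ W) {m : ℕ} (α : OPrime (Conf (U : Set ℂ) (Fin m)))
    (a : Fin m → Tot V) : (FV G).ext h (toF G U (cls U α a)) =
      toF G W (cls W (push id differentiable_id (mapsTo_id h) α) a) := by
  change toF G W (exprMul disjoint_bot_right h bot_le (cls U α a) (exprOne (Tot V) ⊥)) = _
  rw [cls, exprMul_one, preInc_tmul, cls]

lemma deltaClass_mem_costalk (k : ℤ) (a : V k) :
    (fun r => deltaClass G r k a) ∈ (FV G).costalk := fun r _ h =>
  ext_toF_cls G (disc_mono 0 h) (delta (originConf r)) _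

lemma deltaClass_mem_weightSpace (k : ℤ) (a : V k) :
    (⟨fun r => deltaClass G r k a, deltaClass_mem_costalk G k a⟩ : (FV G).costalk) ∈
      (FV G).weightSpace k := by
  intro q hq r
  change (FV G).ext (Aff.dil_disc_le hq r) (toF G _ (sigmaE (Aff.dil q) (disc 0 r)
    (cls (disc 0 r) (delta (originConf r)) fun _ => tin V k a))) = _ • deltaClass G r k a
  rw [sigmaE_cls, ext_toF_cls, ← map_smul]
  change _ = toF G _ (cls (disc 0 r) (delta (originConf r)) _)
  congr 2
  · refine OPrime.ext' fun f => congrArg f.1 (Subtype.ext (funext fun i => ?_))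
    change ((q : ℂˣ) : ℂ) * 0 + 0 = 0
    simp
  · exact funext fun _ => scale_tin q k a

/-- The comparison map `I` in degree `k`, given by `a ↦ [δ_0 ⊗ a]`. -/
def compI (k : ℤ) : V k →ₗ[ℂ] (FV G).VF k where
  toFun a := ⟨⟨fun r => deltaClass G r k a, deltaClass_mem_costalk G k a⟩,
    deltaClass_mem_weightSpace G k a⟩
  map_add' a b := Subtype.ext (Subtype.ext (funext fun r => map_add (deltaClass G r k) a b))
  map_smul' c a := Subtype.ext (Subtype.ext (funext fun r => map_smul (deltaClass G r k) c a))

end Comparison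

/-! ### Isomorphisms -/

section Isomorphisms

/-- Complete bornological vector spaces. -/
def IsCompleteBVS {X : Type u} [AddCommGroup X] [Module ℂ X] (b : Bornology X) : Prop :=
  IsBVS b ∧ IsCompleteBorn b

/-- Isomorphisms of bornological vector spaces: bijective linear maps that are bounded and whose
inverse is bounded. -/
def IsBornIso {X Y : Type*} [AddCommGroup X] [Module ℂ X] [AddCommGroup Y] [Module ℂ Y]
    (b : Bornology X) (c : Bornology Y) (f : X →ₗ[ℂ] Y) : Prop :=
  Function.Bijective f ∧ BddMap b c f ∧ ∀ T, Bdd c T → Bdd b (f ⁻¹' T)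

variable {V V' : ℤ → Type u} [∀ k, AddCommGroup (V k)] [∀ k, Module ℂ (V k)]
  [∀ k, AddCommGroup (V' k)] [∀ k, Module ℂ (V' k)]

/-- The map of direct sums `⨁ₖ V k → ⨁ₖ V' k` induced by linear maps in each degree. -/
def totMap (f : ∀ k, V k →ₗ[ℂ] V' k) : Tot V →ₗ[ℂ] Tot V' := DFinsupp.mapRange.linearMap f

/-- Isomorphisms of geometric vertex algebras: degreewise linear isomorphisms that commute with the
multiplication maps. -/
def GVA.IsIso (G : GVA V) (G' : GVA V') (f : ∀ k, V k →ₗ[ℂ] V' k) : Prop :=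
  (∀ k, Function.Bijective (f k)) ∧
    ∀ (m : ℕ) (a : Fin m → Tot V) (z : Conf (univ : Set ℂ) (Fin m)) (k : ℤ),
      G'.mu m (fun i => totMap f (a i)) z k = f k (G.mu m a z k)

end Isomorphisms

end

end FactVA

open FactVA

namespace FactVA

noncomputable section

open scoped TensorProduct DirectSum Topology
open Set Filter TopologicalSpace

/-! ### Discrete bornological spaces -/

section Discrete

variable {X Y : Type*} [AddCommGroup X] [Module ℂ X] [AddCommGroup Y] [Module ℂ Y]

/-! On a round disc the subspace divided out in `FV` is exactly the kernel of evaluation, so `evF`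
embeds the value on a disc into the product of the `V k`. One inclusion is formal: a relation `r` on
a disc `U` is the product `r · 1` with `d = U` and `W` empty. The other is associativity. If `d` is
a disc with center `p` and `W` is disjoint from it, every point of `W` is farther from `p` than
every point of `d`. The associativity series therefore expands the evaluation of `r · e` in terms of
the components of the evaluation of `r` translated by `-p` (`hasSum_ev_mul`), and translation
preserves relations. So evaluation kills the disc relations. Its kernel is b-closed because
evaluation is bounded into discrete spaces, hence it contains the closure as well.

Everything else is read through this embedding (`evF_injective`). Equivariance says that `ρ(q)` acts
by `q ^ k` in degree `k`, so a weight vector of weight `k` has evaluation concentrated in degree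
`k`. Insertion at zero says that `[δ_0 ⊗ a]` evaluates to `a`. By injectivity the weight vector is
`I` of its own degree `k` evaluation, which makes `I` bijective with evaluation as its inverse.
Degree `k` evaluation is bounded into the discrete space `V k`, and linear maps out of discrete
spaces are bounded, so the weight spaces are discrete (`bornVF_eq`). Completeness and the
bornological isomorphisms are then facts about discrete spaces.

For the multiplication, the contour integral in `L^R` has to exist before it can be computed. On a
class with homogeneous labels, `ρ(z)` dilates the functional and multiplies by a power of `z`. The
dilates over the circle `|z| = 1/2` are controlled by one compact set, and a Schwarz lemma estimate
shows that they depend continuously on `z` in a Banach space (`exists_dil_lift`). Bounded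
functionals pass under the integral, the residue selects degree `k`, and `L^R` turns out to be
evaluation in degree `k` followed by `I` (`L_eq`). The product of the classes `[δ_{z i} ⊗ a i]` is
`[δ_z ⊗ a]` (`mmul_place`), which evaluates to `μ(a)(z)`; no radius survives in the result. The
axioms for the new multiplication maps follow by transport of structure along `I`. -/

lemma apply_eq_sum_single {n : ℕ} (g : (Fin n → ℂ) →ₗ[ℂ] X) (t : Fin n → ℂ) :
    g t = ∑ i, t i • g (Pi.single i 1) := by
  conv_lhs => rw [← Finset.univ_sum_single t, map_sum]
  refine Finset.sum_congr rfl fun i _ => ?_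
  rw [← map_smul, ← Pi.single_smul, smul_eq_mul, mul_one]

/-- Linear maps out of discrete spaces are bounded. -/
lemma bddMap_of_discrete {b : Bornology Y} (hb : IsBVS b) (f : X →ₗ[ℂ] Y) :
    BddMap (discreteBorn X) b f := by
  intro S hS
  obtain ⟨n, e, T, hT, h⟩ := bdd_discrete.1 hS
  obtain ⟨R, hR⟩ := hT.subset_closedBall 0
  -- The summand 1 makes `M` invertible; dividing the coefficients by `M` puts them in the unit
  -- disc, where absolute convexity applies.
  set M : ℝ := max R 0 + 1
  have hM : 0 < M := by positivity
  have hM' : (M : ℂ) ≠ 0 := by exact_mod_cast hM.ne'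
  refine (hb.finset_sum Finset.univ
    (fun i => (fun y => (M : ℂ) • y) '' absHull {f (e (Pi.single i 1))})
    fun i _ => hb.smul (hb.hull_bdd _ (bdd_singleton _ _)) _).subset ?_
  rintro _ ⟨x, hx, rfl⟩
  obtain ⟨t, ht, rfl⟩ := h hx
  refine ⟨fun i => t i • f (e (Pi.single i 1)), fun i _ => ?_, apply_eq_sum_single (f ∘ₗ e) t⟩
  have h0 := subset_absHull {f (e (Pi.single i 1))} rfl
  refine ⟨(t i / M) • f (e (Pi.single i 1)), ?_, by simp [smul_smul, mul_div_cancel₀ _ hM']⟩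
  have ht' : ‖t i‖ ≤ M := (norm_le_pi_norm t i).trans
    ((mem_closedBall_zero_iff.1 (hR ht)).trans (by simp only [M]; linarith [le_max_left R 0]))
  simpa using isAbsConvex_absHull _ _ h0 _ h0 (t i / M) 0 (by
    rw [norm_zero, add_zero, norm_div, Complex.norm_real, Real.norm_of_nonneg hM.le,
      div_le_one hM]
    exact ht')

lemma isAbsConvex_closedBall {E : Type*} [NormedAddCommGroup E] [NormedSpace ℂ E] (R : ℝ) :
    IsAbsConvex (Metric.closedBall (0 : E) R) := by
  intro x hx y hy a b hab
  rw [mem_closedBall_zero_iff] at hx hy ⊢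
  refine (norm_add_le _ _).trans ?_
  rw [norm_smul, norm_smul]
  have h1 := mul_le_mul_of_nonneg_left hx (norm_nonneg a)
  have h2 := mul_le_mul_of_nonneg_left hy (norm_nonneg b)
  have h3 := mul_le_mul_of_nonneg_right hab ((norm_nonneg x).trans hx)
  linarith

lemma IsAbsConvex.image {S : Set X} (hS : IsAbsConvex S) (f : X →ₗ[ℂ] Y) :
    IsAbsConvex (f '' S) := by
  rintro _ ⟨x, hx, rfl⟩ _ ⟨y, hy, rfl⟩ a b hab
  exact ⟨_, hS x hx y hy a b hab, by rw [map_add, map_smul, map_smul]⟩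

/-- Balls in `ℂ^n` are absolutely convex, and so are their linear images; the hull of a bounded set
stays inside such an image. -/
lemma isBVS_discrete : IsBVS (discreteBorn X) where
  smul_bdd B hB r _ := by
    have := bddMap_discrete ((r : ℂ) • LinearMap.id : X →ₗ[ℂ] X) B hB
    exact this
  hull_bdd B hB := by
    obtain ⟨n, e, T, hT, h⟩ := bdd_discrete.1 hB
    obtain ⟨R, hR⟩ := hT.subset_closedBall 0
    exact bdd_discrete.2 ⟨n, e, Metric.closedBall 0 R, Metric.isBounded_closedBall,
      absHull_min ((isAbsConvex_closedBall R).image e) (h.trans (image_mono hR))⟩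

/-- A linear functional pulled back to `ℂ^n` is continuous. This is what allows functionals on the
`V k` to detect bornological limits and contour integrals. -/
lemma bddMap_discrete_norm (φ : Module.Dual ℂ X) {S : Set X} (hS : Bdd (discreteBorn X) S) :
    ∃ C, ∀ x ∈ S, ‖φ x‖ ≤ C := by
  obtain ⟨n, e, T, hT, h⟩ := bdd_discrete.1 hS
  obtain ⟨C, hC⟩ := (hT.image (LinearMap.toContinuousLinearMap (φ ∘ₗ e))).exists_norm_le
  refine ⟨C, fun x hx => ?_⟩
  obtain ⟨t, ht, rfl⟩ := h hx
  exact hC _ ⟨t, ht, rfl⟩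

/-- A finite-dimensional normed space is already a Banach space, so the span of a bounded set serves
as the required completely normable subobject. -/
lemma isCompleteBorn_discrete {X : Type u} [AddCommGroup X] [Module ℂ X] :
    IsCompleteBorn (discreteBorn X) := by
  intro B hB
  obtain ⟨n, e, T, hT, h⟩ := bdd_discrete.1 hB
  -- The map `e` parametrizing the bounded set need not be injective; coordinates on its range
  -- replace it.
  let d := Module.finrank ℂ (LinearMap.range e)
  let E : LinearMap.range e ≃ₗ[ℂ] (Fin d → ℂ) := (Module.finBasis ℂ _).equivFun
  let i : (Fin d → ℂ) →ₗ[ℂ] X := (LinearMap.range e).subtype ∘ₗ E.symm.toLinearMap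
  -- Completeness asks for a Banach space in the universe of `X`.
  let up : ULift.{u} (Fin d → ℂ) ≃ₗ[ℂ] (Fin d → ℂ) := ULift.moduleEquiv
  let p : (Fin n → ℂ) →ₗ[ℂ] ULift.{u} (Fin d → ℂ) :=
    up.symm.toLinearMap ∘ₗ E.toLinearMap ∘ₗ e.rangeRestrict
  have : FiniteDimensional ℂ (ULift.{u} (Fin d → ℂ)) := up.symm.finiteDimensional
  refine ⟨ULift.{u} (Fin d → ℂ), inferInstance, inferInstance, inferInstance,
    i ∘ₗ up.toLinearMap, ?_, fun S hS => ?_, LinearMap.toContinuousLinearMap p '' T,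
    hT.image _, ?_⟩
  · exact ((LinearMap.range e).injective_subtype.comp E.symm.injective).comp up.injective
  · refine bdd_discrete.2 ⟨d, i, _, hS.image (LinearMap.toContinuousLinearMap up.toLinearMap), ?_⟩
    rw [image_image]
    rfl
  · refine h.trans ?_
    rintro _ ⟨t, ht, rfl⟩
    refine ⟨_, ⟨t, ht, rfl⟩, ?_⟩
    simp [p, i]

lemma isCompleteBVS_discrete {X : Type u} [AddCommGroup X] [Module ℂ X] :
    IsCompleteBVS (discreteBorn X) := ⟨isBVS_discrete, isCompleteBorn_discrete⟩

lemma bornology_ext {X : Type*} {b c : Bornology X} (h : ∀ S, Bdd b S ↔ Bdd c S) : b = c :=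
  Bornology.ext_iff_isBounded.2 h

/-- The direct sum of discrete spaces is discrete. -/
lemma sumBorn_discrete {ι : Type*} [DecidableEq ι] {X : ι → Type*} [∀ i, AddCommGroup (X i)]
    [∀ i, Module ℂ (X i)] : sumBorn (fun i => discreteBorn (X i)) = discreteBorn (⨁ i, X i) := by
  refine bornology_ext fun S => ⟨fun hS => ?_, fun hS => ?_⟩
  -- The identity is bounded in both directions: out of the sum because the inclusions of the
  -- discrete summands are bounded, and into it because every linear map out of a discrete space is.
  · simpa using bddMap_sum isBVS_discrete (f := LinearMap.id)
      (fun i => bddMap_discrete (DirectSum.lof ℂ ι X i)) S hS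
  · simpa using bddMap_of_discrete (isBVS_sum fun i => isBVS_discrete) LinearMap.id S hS

/-- The inverse is again a linear map between discrete spaces, so boundedness is automatic on both
sides. -/
lemma isBornIso_discrete {f : X →ₗ[ℂ] Y} (hf : Function.Bijective f) :
    IsBornIso (discreteBorn X) (discreteBorn Y) f := by
  refine ⟨hf, bddMap_discrete f, fun T hT => ?_⟩
  let e := LinearEquiv.ofBijective f hf
  refine (bddMap_discrete e.symm.toLinearMap T hT).subset fun x hx => ⟨f x, hx, ?_⟩
  exact e.symm_apply_apply x

end Discrete

/-! ### Holomorphic functions with values in finite-dimensional subspaces -/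

section VectorValuedHol

variable {E E' : Type*} [NormedAddCommGroup E] [NormedSpace ℂ E] [NormedAddCommGroup E']
  [NormedSpace ℂ E'] {W : Type*} [AddCommGroup W] [Module ℂ W]

/-- The functions `c i` are coordinates in a basis of the finite-dimensional subspace. The
coordinate forms are extended to all of `W`, since holomorphy is tested by functionals on `W`. This
reduces vector-valued questions to scalar ones. -/
lemma HolFD.exists_decomp {X : Set E} {f : X → W} (hf : HolFD f) :
    ∃ (n : ℕ) (c : Fin n → Hol X) (e : Fin n → W), ∀ x, f x = ∑ i, (c i).1 x • e i := by
  obtain ⟨S, hS, hfS, hf⟩ := hf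
  let b := Module.finBasis ℂ S
  choose c hc using fun i => (b.coord i).exists_extend
  refine ⟨_, fun i => ⟨fun x => c i (f x), hf (c i)⟩, fun i => b i, fun x => ?_⟩
  have := congrArg (Submodule.subtype S) (b.sum_repr ⟨f x, hfS x⟩)
  rw [map_sum] at this
  refine this.symm.trans (Finset.sum_congr rfl fun i _ => ?_)
  rw [map_smul]
  congr 1
  exact (LinearMap.congr_fun (hc i) ⟨f x, hfS x⟩).symm

lemma pairing_eq_sum {X : Set E} (α : OPrime X) (f : HolW W X) {n : ℕ} (c : Fin n → Hol X)
    (e : Fin n → W) (h : ∀ x, f.1 x = ∑ i, (c i).1 x • e i) :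
    pairing α f = ∑ i, α.1 (c i) • e i := by
  refine eq_of_dual fun φ => ?_
  rw [dual_pairing, map_sum]
  have : holComp φ f = ∑ i, φ (e i) • c i := by
    ext x
    change φ (f.1 x) = (∑ i, φ (e i) • c i : Hol X).1 x
    rw [h, map_sum, AddSubmonoidClass.coe_finsetSum, Finset.sum_apply]
    exact Finset.sum_congr rfl fun i _ => by
      rw [map_smul, smul_eq_mul, mul_comm]; rfl
  rw [this, map_sum]
  exact Finset.sum_congr rfl fun i _ => by
    rw [map_smul, map_smul, smul_eq_mul, smul_eq_mul, mul_comm]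

/-- The functionals in a bounded set share a constant and a compact set, and `f` is bounded on that
compact set. -/
lemma functBorn_norm_apply {X : Set E} {S : Set (OPrime X)} (hS : Bdd (functBorn X) S)
    (f : Hol X) : ∃ C, ∀ α ∈ S, ‖α.1 f‖ ≤ C := by
  obtain ⟨K, hKX, hK, C, hC, h⟩ := bdd_funct.1 hS
  obtain ⟨F, hF, hf⟩ := f.2
  obtain ⟨M, hM⟩ := hK.exists_bound_of_continuousOn (hF.continuousOn.mono hKX)
  exact ⟨C * max M 0, fun α hα => h α hα f _ (le_max_right _ _) fun x hx => by
    rw [← hf]; exact (hM _ hx).trans (le_max_left _ _)⟩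

/-- After a decomposition of `f`, the pairing is a linear image of the scalar vector `(α(c i))`,
each entry of which is bounded as `α` varies in a bounded set. -/
lemma bddMap_pairing {X : Set E} (f : HolW W X) :
    BddMap (functBorn X) (discreteBorn W) fun α => pairing α f := by
  intro S hS
  obtain ⟨n, c, e, h⟩ := HolFD.exists_decomp f.2
  choose C hC using fun i => functBorn_norm_apply hS (c i)
  refine bdd_discrete.2 ⟨n, Fintype.linearCombination ℂ e, {t | ∀ i, ‖t i‖ ≤ C i}, ?_, ?_⟩
  · refine (Metric.isBounded_closedBall (x := (0 : Fin n → ℂ)) (r := ∑ i, |C i|)).subset ?_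
    intro t ht
    rw [mem_closedBall_zero_iff, pi_norm_le_iff_of_nonneg (by positivity)]
    exact fun i => ((ht i).trans (le_abs_self _)).trans
      (Finset.single_le_sum (fun j _ => abs_nonneg (C j)) (Finset.mem_univ i))
  · rintro _ ⟨α, hα, rfl⟩
    exact ⟨fun i => α.1 (c i), fun i => hC i α hα, by
      rw [Fintype.linearCombination_apply]; exact (pairing_eq_sum α f c e h).symm⟩

/-- A bounded set in the discrete variable involves only finitely many vectors with bounded
coefficients, so boundedness in the other variable alone suffices: the image lies in a finite sum of
multiples of hulls. -/
lemma bddMap₂_of_discrete {X Y Z : Type*} [AddCommGroup X] [Module ℂ X] [AddCommGroup Y]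
    [Module ℂ Y] [AddCommGroup Z] [Module ℂ Z] {b : Bornology X} {d : Bornology Z} (hd : IsBVS d)
    (f : X →ₗ[ℂ] Y →ₗ[ℂ] Z) (h : ∀ y, BddMap b d fun x => f x y) :
    BddMap₂ b (discreteBorn Y) d fun x y => f x y := by
  intro S T hS hT
  obtain ⟨n, e, T, hT, h'⟩ := bdd_discrete.1 hT
  obtain ⟨R, hR⟩ := hT.subset_closedBall 0
  set M : ℝ := max R 0 + 1
  have hM : 0 < M := by positivity
  have hM' : (M : ℂ) ≠ 0 := by exact_mod_cast hM.ne'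
  refine (hd.finset_sum Finset.univ
    (fun i => (fun y => (M : ℂ) • y) '' absHull ((fun x => f x (e (Pi.single i 1))) '' S))
    fun i _ => hd.smul (hd.hull_bdd _ (h _ S hS)) _).subset ?_
  rintro _ ⟨x, hx, y, hy, rfl⟩
  obtain ⟨t, ht, rfl⟩ := h' hy
  refine ⟨fun i => t i • f x (e (Pi.single i 1)), fun i _ => ?_,
    apply_eq_sum_single (f x ∘ₗ e) t⟩
  have h0 := subset_absHull ((fun x => f x (e (Pi.single i 1))) '' S) (mem_image_of_mem _ hx)
  refine ⟨(t i / M) • f x (e (Pi.single i 1)), ?_, by simp [smul_smul, mul_div_cancel₀ _ hM']⟩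
  have ht' : ‖t i‖ ≤ M := (norm_le_pi_norm t i).trans
    ((mem_closedBall_zero_iff.1 (hR ht)).trans (by simp only [M]; linarith [le_max_left R 0]))
  simpa using isAbsConvex_absHull _ _ h0 _ h0 (t i / M) 0 (by
    rw [norm_zero, add_zero, norm_div, Complex.norm_real, Real.norm_of_nonneg hM.le,
      div_le_one hM]
    exact ht')

lemma mul_mem_hol {X : Set E} {Y : Set E'} (f : Hol X) (g : Hol Y) :
    (fun p : ↥(X ×ˢ Y) => f.1 ⟨p.1.1, p.2.1⟩ * g.1 ⟨p.1.2, p.2.2⟩) ∈ Hol (X ×ˢ Y) := by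
  obtain ⟨F, hF, hf⟩ := f.2
  obtain ⟨F', hF', hf'⟩ := g.2
  refine ⟨fun p => F p.1 * F' p.2, ?_, fun p => ?_⟩
  · exact (hF.comp differentiable_fst.differentiableOn fun p hp => hp.1).mul
      (hF'.comp differentiable_snd.differentiableOn fun p hp => hp.2)
  · exact congrArg₂ (· * ·) (hf ⟨p.1.1, p.2.1⟩) (hf' ⟨p.1.2, p.2.2⟩)

end VectorValuedHol

/-! ### The evaluation map and the relations -/

section EvaluationMap

variable {V : ℤ → Type u} [∀ k, AddCommGroup (V k)] [∀ k, Module ℂ (V k)] (G : GVA V)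

/-- Boundedness is used twice: it makes the kernel of evaluation b-closed, and it bounds the inverse
of `I`. -/
lemma bddMap_ev (U : Opens ℂ) (k : ℤ) :
    BddMap (exprBorn (Tot V) U) (discreteBorn (V k)) fun x => ev G U x k := by
  refine bddMap_liftE isBVS_discrete (preEv G U k) (preEv_reix G U k) fun m => ?_
  refine bddMap_tensor isBVS_discrete ?_
  exact bddMap₂_of_discrete isBVS_discrete (pairing.compl₂ (tlift (muW G (U : Set ℂ) m k)))
    fun y => bddMap_pairing _

/-- Appending a point `p` outside of `W` to a configuration in `W`. -/
def snocConf {W : Set ℂ} {p : ℂ} (hp : p ∉ W) {m : ℕ} (w : Conf W (Fin m)) :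
    Conf (univ : Set ℂ) (Fin (m + 1)) :=
  ⟨Fin.snoc (α := fun _ => ℂ) w.1 p, fun _ => mem_univ _, by
    rw [Fin.snoc_injective_iff]
    exact ⟨w.2.2, fun ⟨i, hi⟩ => hp (hi ▸ w.2.1 i)⟩⟩

/-- The linear map `v ↦ (w ↦ φ (μ(b, w, v, p)_l))`. -/
def insertHol {W : Set ℂ} {p : ℂ} (hp : p ∉ W) {m : ℕ} (b : Fin m → Tot V) (l : ℤ)
    (φ : Module.Dual ℂ (V l)) (k : ℤ) : V k →ₗ[ℂ] Hol (Conf W (Fin m)) where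
  toFun v := ⟨fun w => φ (G.mu (m + 1) (Fin.snoc (α := fun _ => Tot V) b (tin V k v))
      (snocConf hp w) l), by
    obtain ⟨S, _, _, h⟩ := G.holo (m + 1) (Fin.snoc (α := fun _ => Tot V) b (tin V k v)) l
    obtain ⟨F, hF, hf⟩ := h φ
    refine ⟨fun w => F (Fin.snoc (α := fun _ => ℂ) w p), ?_, fun w => hf (snocConf hp w)⟩
    refine hF.comp (Differentiable.differentiableOn ?_) fun w hw => (snocConf hp ⟨w, hw⟩).2
    rw [differentiable_pi]
    intro i
    refine Fin.lastCases ?_ (fun i => ?_) i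
    · simp
    · simp only [Fin.snoc_castSucc]
      fun_prop⟩
  map_add' v v' := by
    ext w
    have := (G.mu (m + 1)).map_update_add (Fin.snoc (α := fun _ => Tot V) b 0) (Fin.last m)
      (tin V k v) (tin V k v')
    simp only [Fin.update_snoc_last] at this
    change φ _ = φ _ + φ _
    rw [map_add (tin V k), this]
    exact map_add φ _ _
  map_smul' c v := by
    ext w
    have := (G.mu (m + 1)).map_update_smul (Fin.snoc (α := fun _ => Tot V) b 0) (Fin.last m)
      c (tin V k v)
    simp only [Fin.update_snoc_last] at this
    change φ _ = c • φ _
    rw [map_smul (tin V k), this]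
    exact map_smul φ _ _

/-! ### Evaluation of products and the relations on discs -/

lemma append_eq_elim {m n : ℕ} {X : Type*} (x : Fin m → X) (y : Fin n → X) :
    (fun j => Sum.elim x y (finSumFinEquiv.symm j)) = Fin.append x y := by
  funext j
  refine Fin.addCases (fun i => ?_) (fun i => ?_) j <;> simp

lemma exprMul_cls {U U' W : Opens ℂ} (h : Disjoint U U') (hU : U ≤ W) (hU' : U' ≤ W)
    {M : Type u} [AddCommGroup M] [Module ℂ M] {m n : ℕ}
    (α : OPrime (Conf (U : Set ℂ) (Fin m))) (a : Fin m → M)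
    (β : OPrime (Conf (U' : Set ℂ) (Fin n))) (b : Fin n → M) :
    exprMul h hU hU' (cls U α a) (cls U' β b) =
      cls W (push _ (differentiable_reindex finSumFinEquiv) (mapsTo_reindex W finSumFinEquiv)
        (mulFun h hU hU' α β)) (Fin.append a b) := by
  rw [cls, cls, exprMul_mkE _ _ _ _ _ finSumFinEquiv, preMul_tmul, cls, ← append_eq_elim,
    ← reix_tmul, mkE_reix]
  exact mkE_eq _ _ _ _

/-- This is the associativity axiom integrated against `β` and the functionals that make up `x`. The
factor `x` enters the series only through the evaluation of its translate by `-p`, which is what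
makes evaluation compatible with the disc relations. -/
lemma hasSum_ev_mul {d W U : Opens ℂ} {p : ℂ} {ρ : ℝ} (hd : (d : Set ℂ) = Metric.ball p ρ)
    (hp : p ∉ (W : Set ℂ)) (h : Disjoint d W) (hdU : d ≤ U) (hWU : W ≤ U) {m : ℕ}
    (β : OPrime (Conf (W : Set ℂ) (Fin m))) (b : Fin m → Tot V) (l : ℤ)
    (φ : Module.Dual ℂ (V l)) (x : Expr (Tot V) d) :
    HasSum (fun k => β.1 (insertHol G hp b l φ k
        (ev G _ (sigmaE (Aff.transl (-p)) d x) k)))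
      (φ (ev G U (exprMul h hdU hWU x (cls W β b)) l)) := by
  induction x using expr_induction with
  | h0 => simp
  | hadd x y hx hy => simpa using hx.add hy
  | h n α a =>
    have ha : (fun i => scale V (Aff.transl (-p)).lam (a i)) = a :=
      funext fun i => scale_one (a i)
    -- The factors are swapped because the associativity axiom lists the inserted block last.
    rw [← exprMul_comm, exprMul_cls, ev_cls, dual_pairing, push_apply, sigmaE_cls, ha]
    -- `H k` is the `k`-th term of the associativity series as a function of both configurations, so
    -- that the double pairing becomes one application of the product functional.
    let H : ℤ → Hol (Conf (W : Set ℂ) (Fin m) ×ˢ Conf (d : Set ℂ) (Fin n)) := fun k =>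
      ⟨fun q => (insertHol G hp b l φ k (G.mu n a (toUniv
        (⟨_, mapsTo_act (Aff.transl (-p)) d q.2.2⟩ :
          Conf ((Aff.transl (-p)).map d : Set ℂ) (Fin n))) k)).1 ⟨q.1.1, q.2.1⟩, by
        -- Joint holomorphy: once `p_k μ(a)` is written as a finite sum of scalar functions times
        -- fixed vectors, `H k` is a finite sum of products of a function of `w` and a function of
        -- `z`.
        obtain ⟨N, c, e, hc⟩ := (G.holo n a k).exists_decomp
        simp only [hc, map_sum, map_smul]
        let c' : Fin N → Hol (Conf (d : Set ℂ) (Fin n)) := fun i =>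
          pull (Y := Conf univ (Fin n)) (fun z i => (Aff.transl (-p)).act (z i)) (differentiable_act' _)
            (fun z hz => ⟨fun _ => mem_univ _, (mapsTo_act (Aff.transl (-p)) d hz).2⟩) (c i)
        convert (Hol (Conf (W : Set ℂ) (Fin m) ×ˢ Conf (d : Set ℂ) (Fin n))).sum_mem
          (fun i (_ : i ∈ Finset.univ) => mul_mem_hol (insertHol G hp b l φ k (e i)) (c' i))
          using 1
        funext q
        rw [AddSubmonoidClass.coe_finsetSum, Finset.sum_apply, Finset.sum_apply]
        exact Finset.sum_congr rfl fun i _ => mul_comm _ _⟩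
    have e1 : ∀ k, β.1 (insertHol G hp b l φ k (ev G _ (cls _
        (push _ (differentiable_act' (Aff.transl (-p))) (mapsTo_act (Aff.transl (-p)) d) α) a)
          k)) =
        (extProd (isOpen_conf W.2 _) (isOpen_conf d.2 _) β α).1 (H k) := by
      intro k
      rw [extProd_apply]
      refine congrArg β.1 (Subtype.ext (funext fun w => ?_))
      rw [ev_cls]
      -- For fixed `w` the insertion is a linear functional on `V k`, so it can be moved inside the
      -- pairing with `α`.
      let ψ : Module.Dual ℂ (V k) := LinearMap.proj w ∘ₗ (Hol _).subtype ∘ₗ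
        insertHol G hp b l φ k
      exact dual_pairing _ _ ψ
    simp only [e1]
    refine hasSum_functional _ H (pull _ differentiable_elim (mapsTo_elim h.symm hWU hdU)
      (pull _ (differentiable_reindex finSumFinEquiv) (mapsTo_reindex U finSumFinEquiv)
      (holComp φ (muW G U (m + n) l (Fin.append b a))))) fun K hKX hK => ?_
    -- The change of variables `(w, z) ↦ ((w, p), z - p)` takes pairs of configurations to the
    -- domain of the associativity axiom.
    let s : (Fin m → ℂ) × (Fin n → ℂ) → (Fin (m + 1) → ℂ) × (Fin n → ℂ) := fun q =>
      (Fin.snoc (α := fun _ => ℂ) q.1 p, fun i => (Aff.transl (-p)).act (q.2 i))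
    have hact : ∀ z, (Aff.transl (-p)).act z = z - p := fun z => by
      simp [Aff.act, Aff.transl, sub_eq_add_neg]
    have hs : Continuous s := by
      refine Continuous.prodMk ?_ ?_
      · rw [continuous_pi_iff]
        intro i
        refine Fin.lastCases ?_ (fun i => ?_) i
        · simp only [Fin.snoc_last]
          fun_prop
        · simp only [Fin.snoc_castSucc]
          fun_prop
      · simp only [hact]
        fun_prop
    have hmem : ∀ q ∈ K, s q ∈ assocSet m n := by
      intro q hq
      obtain ⟨h1, h2⟩ := hKX hq
      refine ⟨(snocConf hp ⟨q.1, h1⟩).2, ⟨fun _ => mem_univ _,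
        (mapsTo_act (Aff.transl (-p)) d h2).2⟩, fun i j => ?_⟩
      -- Points of `d` are at distance less than `ρ` from `p`, points of `W` at distance at least
      -- `ρ`; this is the inequality that the axiom requires.
      have h3 : q.2 j ∈ Metric.ball p ρ := hd ▸ h2.1 j
      have h4 : q.1 i ∉ Metric.ball p ρ := fun hmem =>
        disjoint_iff_mem.1 h (q.1 i) (show q.1 i ∈ (d : Set ℂ) from hd ▸ hmem) (h1.1 i)
      simp only [s, Fin.snoc_castSucc, Fin.snoc_last, hact]
      rw [mem_ball_iff_norm] at h3 h4
      exact h3.trans_le (not_lt.1 h4)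
    obtain ⟨u, hu, hb, hsum⟩ := (G.assoc m n b a l (s '' K)
      (by rintro _ ⟨q, hq, rfl⟩; exact hmem q hq) (hK.image hs)).2 φ
    refine ⟨u, hu, fun k q hq => hb k ⟨s q, hmem q hq⟩ (mem_image_of_mem s hq),
      fun q hq => ?_⟩
    have := hsum ⟨s q, hmem q hq⟩ (mem_image_of_mem s hq)
    refine Eq.mp ?_ this
    -- The axiom adds the last point `p` to the inserted points, which undoes the translation by
    -- `-p`.
    refine congrArg (HasSum _) (congrArg φ (congrFun (congrArg (G.mu (m + n) _)
      (Subtype.ext ?_)) l))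
    refine Eq.trans ?_ (append_eq_elim q.1.1 q.1.2).symm
    change Fin.append (fun i => (s q.1).1 i.castSucc)
      (fun j => (s q.1).2 j + (s q.1).1 (Fin.last m)) = _
    simp [s, hact]

/-- A relation on `d` stays a relation after its center is moved to the origin, so every term of the
series for `r · e` vanishes. -/
lemma discRelations_le_ker (U : Opens ℂ) : discRelations G U ≤ LinearMap.ker (ev G U) := by
  rw [discRelations, Submodule.span_le]
  rintro _ ⟨d, W, h, hd, hW, ⟨p, ρ, hρ, hdisc⟩, r, hr, e, rfl⟩
  rw [SetLike.mem_coe, LinearMap.mem_ker]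
  have hp : p ∉ (W : Set ℂ) := fun hpW => disjoint_iff_mem.1 h p
    (show p ∈ (d : Set ℂ) from hdisc ▸ Metric.mem_ball_self hρ) hpW
  induction e using expr_induction with
  | h0 => simp
  | hadd x y hx hy => rw [map_add, map_add, hx, hy, add_zero]
  | h m β b =>
    ext l
    refine eq_of_dual fun φ => ?_
    have h1 := hasSum_ev_mul G hdisc hp h hd hW β b l φ r
    have h2 := sigmaE_mem_relations G (Aff.transl (-p)) hr
    rw [relations, LinearMap.mem_ker] at h2
    simp only [h2, Pi.zero_apply, map_zero] at h1
    rw [Pi.zero_apply, map_zero]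
    exact h1.unique hasSum_zero

/-- If `x n - y` is `ε n` times an element of a bounded set and all `x n` evaluate to zero, then
each functional of the evaluation of `y` is at most `|ε n| C`, which tends to 0. -/
lemma bClosed_ker_ev (U : Opens ℂ) :
    BClosed (exprBorn (Tot V) U) (LinearMap.ker (ev G U) : Set (Expr (Tot V) U)) := by
  rintro x y hx ⟨B, ε, hB, hε, h⟩
  rw [SetLike.mem_coe, LinearMap.mem_ker]
  ext l
  refine eq_of_dual fun φ => ?_
  rw [Pi.zero_apply, map_zero]
  obtain ⟨C, hC⟩ := bddMap_discrete_norm φ (bddMap_ev G U l B hB)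
  have h1 : ∀ n, ‖φ (ev G U y l)‖ ≤ |ε n| * C := by
    intro n
    obtain ⟨v, hv, e⟩ := h n
    have h2 : ev G U (x n) = 0 := hx n
    have e2 : φ (ev G U y l) = -((ε n : ℂ) * φ (ev G U v l)) := by
      have := congrArg (fun t => φ (ev G U t l)) e
      simp only [map_sub, map_smul, Pi.sub_apply, Pi.smul_apply, h2, Pi.zero_apply, zero_sub,
        smul_eq_mul] at this
      rw [← this, map_neg, neg_neg]
    rw [e2, norm_neg, norm_mul, Complex.norm_real, Real.norm_eq_abs]
    exact mul_le_mul_of_nonneg_left (hC _ (mem_image_of_mem _ hv)) (abs_nonneg _)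
  have h3 : Tendsto (fun n => |ε n| * C) atTop (𝓝 0) := by
    simpa using (hε.abs).mul_const C
  exact norm_le_zero_iff.1 (ge_of_tendsto' h3 h1)

lemma closedRelations_le_ker (U : Opens ℂ) : closedRelations G U ≤ LinearMap.ker (ev G U) :=
  fun _ hx => hx _ ⟨bClosed_ker_ev G U, discRelations_le_ker G U⟩

/-- On a disc, an element of the kernel is itself a generator of the relations: take `d = U`, `W`
empty and `e` the unit. -/
lemma ker_le_closedRelations {U : Opens ℂ} (hU : IsDisc U) :
    LinearMap.ker (ev G U) ≤ closedRelations G U := by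
  intro x hx
  exact le_bClosure _ _ (Submodule.subset_span ⟨U, ⊥, disjoint_bot_right, le_rfl, bot_le, hU, x,
    hx, exprOne (Tot V) ⊥, (exprMul_one_self x).symm⟩)

/-- The quotient map `EV(U) → FV(U)`. -/
def toFV (U : Opens ℂ) : Expr (Tot V) U →ₗ[ℂ] (FV G).obj U := toF G U

lemma toFV_surjective (U : Opens ℂ) : Function.Surjective (toFV G U) := toF_surjective G U

lemma bddMap_toFV (U : Opens ℂ) : BddMap (exprBorn (Tot V) U) ((FV G).born U) (toFV G U) :=
  bddMap_mkQ _ (closedRelations G U)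

/-- The evaluation map on `FV(U)`. -/
def evF (U : Opens ℂ) : (FV G).obj U →ₗ[ℂ] ∀ k, V k :=
  liftF G (ev G U) fun _ hx => closedRelations_le_ker G U hx

lemma evF_toFV (U : Opens ℂ) (x : Expr (Tot V) U) : evF G U (toFV G U x) = ev G U x := rfl

/-- On a disc, quotienting by the closed relations is quotienting by the kernel of evaluation. Later
identities between elements on discs are checked after evaluation, degree by degree. -/
lemma evF_injective {U : Opens ℂ} (hU : IsDisc U) : Function.Injective (evF G U) := by
  rw [injective_iff_map_eq_zero]
  intro x hx
  obtain ⟨x, rfl⟩ := toFV_surjective G U x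
  exact toF_eq_zero G (ker_le_closedRelations G hU hx)

lemma bddMap_evF (U : Opens ℂ) (k : ℤ) :
    BddMap ((FV G).born U) (discreteBorn (V k)) fun x => evF G U x k :=
  bddMap_quot (X := Expr (Tot V) U) (f := fun x : FObj G U => evF G U x k) (bddMap_ev G U k)

lemma isDisc_disc (p : ℂ) {r : ℝ} (hr : 0 < r) : IsDisc (disc p r) := ⟨p, r, hr, rfl⟩

end EvaluationMap

/-! ### Contour integrals in bornological spaces -/

section ContourIntegrals

variable {X : Type u} [AddCommGroup X] [Module ℂ X]

/-- On the circle `|z| = 1/2`, the function `f` is the composition of a continuous function with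
values in a Banach space and a bounded linear map. -/
def HasBanachLift (b : Bornology X) (f : ℂ → X) : Prop :=
  ∃ (Y : Type u) (_ : NormedAddCommGroup Y) (_ : NormedSpace ℂ Y) (_ : CompleteSpace Y)
    (j : Y →ₗ[ℂ] X) (g : ℂ → Y), (∀ T : Set Y, Bornology.IsBounded T → Bdd b (j '' T)) ∧
      ContinuousOn g (Metric.sphere 0 (1 / 2)) ∧
      ∀ z ∈ Metric.sphere (0 : ℂ) (1 / 2), j (g z) = f z

/-- The two lifts are combined in the product of their Banach spaces. -/
lemma HasBanachLift.add {b : Bornology X} (hb : IsBVS b) {f f' : ℂ → X} (h : HasBanachLift b f)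
    (h' : HasBanachLift b f') : HasBanachLift b fun z => f z + f' z := by
  obtain ⟨Y, _, _, _, j, g, hj, hg, hf⟩ := h
  obtain ⟨Y', _, _, _, j', g', hj', hg', hf'⟩ := h'
  refine ⟨Y × Y', inferInstance, inferInstance, inferInstance, j.coprod j',
    fun z => (g z, g' z), fun T hT => ?_, hg.prodMk hg', fun z hz => ?_⟩
  · refine (hb.add (hj _ hT.image_fst) (hj' _ hT.image_snd)).subset ?_
    rintro _ ⟨y, hy, rfl⟩
    exact ⟨_, ⟨_, ⟨y, hy, rfl⟩, rfl⟩, _, ⟨_, ⟨y, hy, rfl⟩, rfl⟩, rfl⟩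
  · rw [LinearMap.coprod_apply, hf z hz, hf' z hz]

lemma HasBanachLift.smul {b : Bornology X} {f : ℂ → X} (h : HasBanachLift b f) {c : ℂ → ℂ}
    (hc : ContinuousOn c (Metric.sphere 0 (1 / 2))) : HasBanachLift b fun z => c z • f z := by
  obtain ⟨Y, i₁, i₂, i₃, j, g, hj, hg, hf⟩ := h
  exact ⟨Y, i₁, i₂, i₃, j, fun z => c z • g z, hj, hc.smul hg, fun z hz => by
    rw [map_smul, hf z hz]⟩

lemma HasBanachLift.congr {b : Bornology X} {f f' : ℂ → X} (h : HasBanachLift b f)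
    (h' : ∀ z ∈ Metric.sphere (0 : ℂ) (1 / 2), f z = f' z) : HasBanachLift b f' := by
  obtain ⟨Y, i₁, i₂, i₃, j, g, hj, hg, hf⟩ := h
  exact ⟨Y, i₁, i₂, i₃, j, g, hj, hg, fun z hz => (hf z hz).trans (h' z hz)⟩

/-- A lift can be integrated in its Banach space, so `circInt` is not the default value 0. It may be
any admissible value: uniqueness is not needed, because the value is later pinned down by
functionals. -/
lemma HasBanachLift.hasCircleIntegral {b : Bornology X} {f : ℂ → X} (h : HasBanachLift b f) :
    HasCircleIntegral b f (circInt b f) := by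
  have h' : ∃ v, HasCircleIntegral b f v := by
    obtain ⟨Y, i₁, i₂, i₃, j, g, hj, hg, hf⟩ := h
    exact ⟨_, Y, i₁, i₂, i₃, j, g, hj, hg, hf, rfl⟩
  rw [circInt, dif_pos h']
  exact h'.choose_spec

/-- Bounded functionals commute with contour integrals. -/
lemma HasCircleIntegral.apply {b : Bornology X} {f : ℂ → X} {v : X}
    (h : HasCircleIntegral b f v) (φ : Module.Dual ℂ X)
    (hφ : ∀ S, Bdd b S → ∃ C, ∀ x ∈ S, ‖φ x‖ ≤ C) :
    φ v = circleIntegral (fun z => φ (f z)) 0 (1 / 2) := by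
  obtain ⟨Y, _, _, _, j, g, hj, hg, hf, rfl⟩ := h
  obtain ⟨C, hC⟩ := hφ _ (hj _ (Metric.isBounded_closedBall (x := (0 : Y)) (r := 1)))
  -- The composite of `φ` and `j` is bounded on the unit ball, hence continuous, and continuous
  -- functionals commute with the integral in `Y`.
  let Φ : Y →L[ℂ] ℂ := (φ ∘ₗ j).clmOfExistsBoundedImage
    ⟨_, Metric.closedBall_mem_nhds 0 one_pos, by
      rw [NormedSpace.isVonNBounded_iff]
      refine (Metric.isBounded_closedBall (x := (0 : ℂ)) (r := C)).subset ?_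
      rintro _ ⟨y, hy, rfl⟩
      exact mem_closedBall_zero_iff.2 (hC _ (mem_image_of_mem j hy))⟩
  have hint : CircleIntegrable g 0 (1 / 2) := hg.circleIntegrable (by norm_num)
  have h1 : Φ (circleIntegral g 0 (1 / 2)) = circleIntegral (fun z => Φ (g z)) 0 (1 / 2) := by
    rw [circleIntegral, circleIntegral, ← Φ.intervalIntegral_comp_comm hint.out]
    simp
  refine h1.trans (circleIntegral.integral_congr (by norm_num) fun z hz => ?_)
  exact congrArg φ (hf z hz)

end ContourIntegrals

/-! ### Dilations of analytic functionals -/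

section Dilations

/-- A functional controlled by the supremum over `K` kills every function vanishing on `K`, so it
factors through restriction to `K`. The functionals so obtained lie in the dual of a normed space,
which is complete even if the space of restrictions is not. -/
lemma exists_dual_of_boundedBy {E : Type*} [NormedAddCommGroup E] [NormedSpace ℂ E] {X K : Set E}
    [CompactSpace K] (hK : K ⊆ X) {C : ℝ} (β : Module.Dual ℂ (Hol X)) (h : BoundedBy β K C) :
    ∃ y : StrongDual ℂ (LinearMap.range (resC hK)),
      ∀ f, y ⟨resC hK f, LinearMap.mem_range_self _ f⟩ = β f := by
  have hb : ∀ f, ‖β f‖ ≤ C * ‖resC hK f‖ := fun f =>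
    h f _ (norm_nonneg _) fun x hx => (resC hK f).norm_coe_le_norm ⟨x.1, hx⟩
  have hker : LinearMap.ker (resC hK) ≤ LinearMap.ker β := by
    intro f hf
    rw [LinearMap.mem_ker] at hf ⊢
    have := hb f
    rw [hf, norm_zero, mul_zero] at this
    exact norm_le_zero_iff.1 this
  let ψ : LinearMap.range (resC hK) →ₗ[ℂ] ℂ :=
    (Submodule.liftQ _ β hker) ∘ₗ (resC hK).quotKerEquivRange.symm.toLinearMap
  have hψ : ∀ f, ψ ⟨resC hK f, LinearMap.mem_range_self _ f⟩ = β f := by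
    intro f
    have : (resC hK).quotKerEquivRange.symm ⟨resC hK f, LinearMap.mem_range_self _ f⟩ =
        Submodule.Quotient.mk f := by
      rw [LinearEquiv.symm_apply_eq]; rfl
    simp only [ψ, LinearMap.comp_apply, LinearEquiv.coe_coe, this]
    rfl
  exact ⟨ψ.mkContinuous C (by
    rintro ⟨_, f, rfl⟩
    rw [hψ]
    exact hb f), hψ⟩

variable {ι : Type}

lemma mapsTo_dil {R : ℝ} {z : ℂ} (hz0 : z ≠ 0) (hz : ‖z‖ ≤ 1) :
    MapsTo (fun (w : ι → ℂ) i => z * w i) (Conf (disc 0 R : Set ℂ) ι) (Conf (disc 0 R) ι) := by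
  intro w hw
  refine ⟨fun i => ?_, fun i j e => hw.2 (mul_left_cancel₀ hz0 e)⟩
  have h1 : w i ∈ Metric.ball (0 : ℂ) R := hw.1 i
  change z * w i ∈ Metric.ball (0 : ℂ) R
  rw [mem_ball_zero_iff] at h1 ⊢
  rw [norm_mul]
  exact (mul_le_of_le_one_left (norm_nonneg _) hz).trans_lt h1

variable [Fintype ι]

lemma differentiable_dil (z : ℂ) : Differentiable ℂ (fun (w : ι → ℂ) i => z * w i) := by
  fun_prop

/-- The pushforward of functionals along the dilation by `z`. -/
def dilPush {R : ℝ} {z : ℂ} (hz0 : z ≠ 0) (hz : ‖z‖ ≤ 1) :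
    OPrime (Conf (disc 0 R : Set ℂ) ι) →ₗ[ℂ] OPrime (Conf (disc 0 R : Set ℂ) ι) :=
  push _ (differentiable_dil z) (mapsTo_dil hz0 hz)

/-- The function `t ↦ f(t w)` is holomorphic on the disc of radius 1/8 about `z`, which lies in the
annulus `3/8 ≤ |t| ≤ 5/8`, so it is bounded there by `M` and its increments by `2M`. The Schwarz
lemma gives the Lipschitz constant `2M / (1/8) = 16M`. -/
lemma norm_dil_sub_le {R : ℝ} (f : Hol (Conf (disc 0 R : Set ℂ) ι)) {w : ι → ℂ} (M : ℝ)
    (hw : w ∈ Conf (disc 0 R : Set ℂ) ι)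
    (hM : ∀ t (h0 : t ≠ 0) (h1 : ‖t‖ ≤ 1), 3 / 8 ≤ ‖t‖ → ‖t‖ ≤ 5 / 8 →
      ‖f.1 ⟨_, mapsTo_dil h0 h1 hw⟩‖ ≤ M)
    {z z' : ℂ} (hz0 : z ≠ 0) (hz1 : ‖z‖ ≤ 1) (hz0' : z' ≠ 0) (hz1' : ‖z'‖ ≤ 1)
    (hz : ‖z‖ = 1 / 2) (hzz : ‖z' - z‖ < 1 / 8) :
    ‖f.1 ⟨_, mapsTo_dil hz0' hz1' hw⟩ - f.1 ⟨_, mapsTo_dil hz0 hz1 hw⟩‖ ≤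
      16 * M * ‖z' - z‖ := by
  obtain ⟨F, hF, hf⟩ := f.2
  have hball : ∀ t ∈ Metric.ball z (1 / 8), 3 / 8 ≤ ‖t‖ ∧ ‖t‖ ≤ 5 / 8 := by
    intro t ht
    rw [mem_ball_iff_norm] at ht
    have h1 := abs_norm_sub_norm_le t z
    rw [hz, abs_le] at h1
    constructor <;> linarith [h1.1, h1.2]
  have hmem : ∀ t ∈ Metric.ball z (1 / 8), t ≠ 0 ∧ ‖t‖ ≤ 1 := by
    intro t ht
    have := hball t ht
    exact ⟨fun h => by rw [h, norm_zero] at this; linarith [this.1], by linarith [this.2]⟩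
  let φ : ℂ → ℂ := fun t => F fun i => t * w i
  have hb : ∀ t ∈ Metric.ball z (1 / 8), ‖φ t‖ ≤ M := by
    intro t ht
    have := hM t (hmem t ht).1 (hmem t ht).2 (hball t ht).1 (hball t ht).2
    rwa [← hf] at this
  have hd : DifferentiableOn ℂ φ (Metric.ball z (1 / 8)) :=
    hF.comp (Differentiable.differentiableOn (by fun_prop)) fun t ht =>
      mapsTo_dil (hmem t ht).1 (hmem t ht).2 hw
  have h1 := Complex.dist_le_div_mul_dist_of_mapsTo_ball (R₂ := 2 * M) hd (fun t ht => by
    rw [mem_closedBall_iff_norm]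
    refine (norm_sub_le _ _).trans ?_
    linarith [hb t ht, hb z (Metric.mem_ball_self (by norm_num))])
    (mem_ball_iff_norm.2 hzz)
  rw [dist_eq_norm, dist_eq_norm] at h1
  rw [← hf, ← hf]
  refine h1.trans (le_of_eq ?_)
  ring

lemma continuousWithinAt_of_norm_sub_le {Y Z : Type*} [SeminormedAddCommGroup Y]
    [SeminormedAddCommGroup Z] {g : Y → Z} {S : Set Y} {z : Y} {δ c : ℝ} (hδ : 0 < δ)
    (h : ∀ z' ∈ S, ‖z' - z‖ < δ → ‖g z' - g z‖ ≤ c * ‖z' - z‖) : ContinuousWithinAt g S z := by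
  rw [ContinuousWithinAt, tendsto_iff_norm_sub_tendsto_zero]
  refine squeeze_zero' (Eventually.of_forall fun _ => norm_nonneg _) ?_
    (g := fun z' => c * ‖z' - z‖) ?_
  · filter_upwards [self_mem_nhdsWithin,
      nhdsWithin_le_nhds (Metric.ball_mem_nhds z hδ)] with z' h1 h2
    exact h z' h1 (mem_ball_iff_norm.1 h2)
  · have h1 : Continuous fun z' : Y => c * ‖z' - z‖ := by fun_prop
    simpa using (h1.tendsto z).mono_left (nhdsWithin_le_nhds (s := S))

/-- The dilates `z α`, `|z| = 1/2`, of an analytic functional depend continuously on `z`. -/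
lemma exists_dil_lift {R : ℝ} (α : OPrime (Conf (disc 0 R : Set ℂ) ι)) :
    ∃ (Y : Type) (_ : NormedAddCommGroup Y) (_ : NormedSpace ℂ Y) (_ : CompleteSpace Y)
      (j : Y →ₗ[ℂ] OPrime (Conf (disc 0 R : Set ℂ) ι)) (g : ℂ → Y),
      (∀ T : Set Y, Bornology.IsBounded T → Bdd (functBorn _) (j '' T)) ∧
      ContinuousOn g (Metric.sphere 0 (1 / 2)) ∧
      ∀ z ∈ Metric.sphere (0 : ℂ) (1 / 2), ∀ (hz0 : z ≠ 0) (hz : ‖z‖ ≤ 1),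
        j (g z) = dilPush hz0 hz α := by
  obtain ⟨K, hKX, hK, C, hα⟩ := α.2
  -- A compact annulus around the circle, with a margin of 1/8 on each side for the Schwarz
  -- estimate. The compact set `K'` of all `t w` with `t ∈ A` and `w ∈ K` then controls every dilate
  -- of `α` on the circle simultaneously.
  let A : Set ℂ := Metric.closedBall 0 (5 / 8) \ Metric.ball 0 (3 / 8)
  have hA : IsCompact A := (isCompact_closedBall _ _).diff Metric.isOpen_ball
  have hmemA : ∀ t, t ∈ A ↔ 3 / 8 ≤ ‖t‖ ∧ ‖t‖ ≤ 5 / 8 := by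
    intro t
    simp only [A, Set.mem_sdiff, mem_closedBall_zero_iff, mem_ball_zero_iff, not_lt]
    exact and_comm
  let s : ℂ × (ι → ℂ) → ι → ℂ := fun p i => p.1 * p.2 i
  let K' : Set (ι → ℂ) := s '' (A ×ˢ K)
  have hK' : IsCompact K' := (hA.prod hK).image (by fun_prop)
  have hK'X : K' ⊆ Conf (disc 0 R : Set ℂ) ι := by
    rintro _ ⟨⟨t, w⟩, ⟨ht, hw⟩, rfl⟩
    have := (hmemA t).1 ht
    exact mapsTo_dil (fun h : t = 0 => by rw [h, norm_zero] at this; linarith [this.1])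
      (by linarith [this.2]) (hKX hw)
  have : CompactSpace K' := isCompact_iff_compactSpace.1 hK'
  have hsph : ∀ z ∈ Metric.sphere (0 : ℂ) (1 / 2), ‖z‖ = 1 / 2 ∧ z ≠ 0 ∧ ‖z‖ ≤ 1 ∧ z ∈ A := by
    intro z hz
    rw [mem_sphere_zero_iff_norm] at hz
    refine ⟨hz, fun h => by rw [h, norm_zero] at hz; norm_num at hz, by linarith, ?_⟩
    rw [hmemA]
    constructor <;> linarith
  -- On the circle the dilate is bounded by the supremum over `K'` and defines an element of the
  -- dual; off the circle the value 0 is chosen, which plays no role.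
  have hex : ∀ z : ℂ, ∃ y : StrongDual ℂ (LinearMap.range (resC hK'X)),
      z ∈ Metric.sphere (0 : ℂ) (1 / 2) → ∀ (hz0 : z ≠ 0) (hz : ‖z‖ ≤ 1),
        ∀ f, y ⟨resC hK'X f, LinearMap.mem_range_self _ f⟩ = (dilPush hz0 hz α).1 f := by
    intro z
    by_cases hz : z ∈ Metric.sphere (0 : ℂ) (1 / 2)
    · obtain ⟨-, h0, h1, hzA⟩ := hsph z hz
      obtain ⟨y, hy⟩ := exists_dual_of_boundedBy (C := C) hK'X (dilPush h0 h1 α).1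
        fun f M hM hf => hα _ M hM fun w hw => hf _ ⟨(z, w.1), ⟨hzA, hw⟩, rfl⟩
      exact ⟨y, fun _ _ _ => hy⟩
    · exact ⟨0, fun h => absurd h hz⟩
  choose g hg using hex
  -- A functional on the space of restrictions to `K'` acts on holomorphic functions by first
  -- restricting them.
  let j : StrongDual ℂ (LinearMap.range (resC hK'X)) →ₗ[ℂ]
      OPrime (Conf (disc 0 R : Set ℂ) ι) :=
    { toFun := fun y => .mk (y.toLinearMap ∘ₗ (resC hK'X).rangeRestrict)
        ⟨K', hK'X, hK', ‖y‖, fun f M hM hf => (y.le_opNorm _).trans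
          (mul_le_mul_of_nonneg_left ((ContinuousMap.norm_le _ hM).2 fun x =>
            hf ⟨x.1, hK'X x.2⟩ x.2) (norm_nonneg _))⟩
      map_add' := fun _ _ => rfl
      map_smul' := fun _ _ => rfl }
  have hgc : ContinuousOn g (Metric.sphere 0 (1 / 2)) := by
    intro z hz
    obtain ⟨hzn, hz0, hz1, hzA⟩ := hsph z hz
    -- The operator norm of the difference is tested on restrictions `f|K'`; the estimate for
    -- dilates holds at each `w ∈ K`, and `α` costs the factor `max C 0`.
    have key : ∀ z' ∈ Metric.sphere (0 : ℂ) (1 / 2), ‖z' - z‖ < 1 / 8 →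
        ‖g z' - g z‖ ≤ max C 0 * 16 * ‖z' - z‖ := by
      intro z' hz' hzz
      obtain ⟨hzn', hz0', hz1', hzA'⟩ := hsph z' hz'
      refine ContinuousLinearMap.opNorm_le_bound _ (by positivity) ?_
      rintro ⟨_, f, rfl⟩
      rw [sub_apply, hg z' hz' hz0' hz1', hg z hz hz0 hz1]
      change ‖α.1 _ - α.1 _‖ ≤ _
      rw [← map_sub]
      refine ((hα.mono subset_rfl (le_max_left C 0)) _ (16 * ‖resC hK'X f‖ * ‖z' - z‖)
        (by positivity) fun w hw => ?_).trans (le_of_eq ?_)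
      · refine norm_dil_sub_le f _ w.2 (fun t h0 h1 h2 h3 => ?_) hz0 hz1 hz0' hz1' hzn hzz
        exact (resC hK'X f).norm_coe_le_norm
          ⟨_, (t, w.1), ⟨(hmemA t).2 ⟨h2, h3⟩, hw⟩, rfl⟩
      · change _ = max C 0 * 16 * ‖z' - z‖ * ‖resC hK'X f‖
        ring
    exact continuousWithinAt_of_norm_sub_le (Z := StrongDual ℂ (LinearMap.range (resC hK'X)))
      (g := g) (δ := 1 / 8) (c := max C 0 * 16) (by norm_num) key
  refine ⟨_, inferInstance, inferInstance, inferInstance, j, g, fun T hT => ?_, hgc,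
    fun z hz hz0 hz1 => OPrime.ext' fun f => hg z hz hz0 hz1 f⟩
  obtain ⟨D, hD⟩ := hT.exists_norm_le
  refine bdd_funct.2 ⟨K', hK'X, hK', max D 0, le_max_right _ _, ?_⟩
  rintro _ ⟨y, hy, rfl⟩ f M hM hf
  exact (y.le_opNorm _).trans (mul_le_mul ((hD y hy).trans (le_max_left _ _))
    ((ContinuousMap.norm_le _ hM).2 fun x => hf ⟨x.1, hK'X x.2⟩ x.2) (norm_nonneg _)
    (le_max_right _ _))

end Dilations

/-! ### The weight spaces of `FV` -/

section WeightSpaces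

variable {V : ℤ → Type u} [∀ k, AddCommGroup (V k)] [∀ k, Module ℂ (V k)] (G : GVA V)

/-- The linear map `α ↦ [α ⊗ a]`. -/
def clsLeft {M : Type u} [AddCommGroup M] [Module ℂ M] (U : Opens ℂ) {m : ℕ} (a : Fin m → M) :
    OPrime (Conf (U : Set ℂ) (Fin m)) →ₗ[ℂ] Expr M U :=
  mkE U (Equiv.refl _) ∘ₗ (TensorProduct.mk ℂ _ _).flip (tprod a)

/-- The multilinear map `a ↦ [α ⊗ a]`. -/
def clsRight {M : Type u} [AddCommGroup M] [Module ℂ M] (U : Opens ℂ) {m : ℕ}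
    (α : OPrime (Conf (U : Set ℂ) (Fin m))) : MultilinearMap ℂ (fun _ : Fin m => M) (Expr M U) :=
  (mkE U (Equiv.refl _) ∘ₗ TensorProduct.mk ℂ _ _ α).compMultilinearMap tprod

lemma cls_smul_right {M : Type u} [AddCommGroup M] [Module ℂ M] (U : Opens ℂ) {m : ℕ}
    (α : OPrime (Conf (U : Set ℂ) (Fin m))) (c : Fin m → ℂ) (a : Fin m → M) :
    cls U α (fun i => c i • a i) = (∏ i, c i) • cls U α a :=
  (clsRight U α).map_smul_univ c a

lemma clsLeft_apply {M : Type u} [AddCommGroup M] [Module ℂ M] (U : Opens ℂ) {m : ℕ}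
    (α : OPrime (Conf (U : Set ℂ) (Fin m))) (a : Fin m → M) : clsLeft U a α = cls U α a := rfl

lemma bddMap_clsLeft {M : Type u} [AddCommGroup M] [Module ℂ M] (U : Opens ℂ) {m : ℕ}
    (a : Fin m → M) : BddMap (functBorn _) (exprBorn M U) (clsLeft U a) := by
  refine (bddMap_mkE U (Equiv.refl (Fin m))).comp' fun S hS => ?_
  refine bdd_tensor.2 ⟨S, {tprod a}, hS, bdd_singleton _ _, Subset.trans ?_ (subset_absHull _)⟩
  rintro _ ⟨α, hα, rfl⟩
  exact ⟨α, hα, _, rfl, rfl⟩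

/-- `EV(U)` is spanned by the classes of tensors of homogeneous elements. -/
lemma mem_of_homogeneous {U : Opens ℂ} {S : Submodule ℂ (Expr (Tot V) U)}
    (h : ∀ (m : ℕ) (α : OPrime (Conf (U : Set ℂ) (Fin m))) (k : Fin m → ℤ) (v : ∀ i, V (k i)),
      cls U α (fun i => tin V (k i) (v i)) ∈ S) (x : Expr (Tot V) U) : x ∈ S := by
  induction x using expr_induction with
  | h0 => exact S.zero_mem
  | hadd x y hx hy => exact S.add_mem hx hy
  | h m α a =>
    -- Modulo `S`, the class is multilinear in the labels, and a multilinear map on direct sums that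
    -- vanishes on homogeneous tuples is zero.
    have : S.mkQ.compMultilinearMap (clsRight U α) = 0 := by
      refine MultilinearMap.dfinsupp_ext (κ := fun _ : Fin m => ℤ) (M := fun _ k => V k)
        fun p => ?_
      ext v
      exact (Submodule.Quotient.mk_eq_zero S).2 (h m α p v)
    exact (Submodule.Quotient.mk_eq_zero S).1 (congrArg (fun f => f a) this)

lemma ext_toFV_cls {U W : Opens ℂ} (h : U ≤ W) {m : ℕ} (α : OPrime (Conf (U : Set ℂ) (Fin m)))
    (a : Fin m → Tot V) : (FV G).ext h (toFV G U (cls U α a)) =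
      toFV G W (cls W (push id differentiable_id (mapsTo_id h) α) a) := ext_toF_cls G h α a

lemma act_toFV (g : Aff) {U : Opens ℂ} (x : Expr (Tot V) U) :
    (FV G).act g U (toFV G U x) = toFV G _ (sigmaE g U x) := rfl

lemma act_toFV_cls (g : Aff) {U : Opens ℂ} {m : ℕ} (α : OPrime (Conf (U : Set ℂ) (Fin m)))
    (a : Fin m → Tot V) : (FV G).act g U (toFV G U (cls U α a)) =
      toFV G _ (cls _ (push _ (differentiable_act' g) (mapsTo_act g U) α)
        fun i => scale V g.lam (a i)) := by
  rw [act_toFV, sigmaE_cls]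

/-- Extension changes neither the functional nor the labels, only the open set. Elements of the
costalk therefore have one evaluation, common to all radii. -/
lemma evF_ext {U W : Opens ℂ} (h : U ≤ W) (x : (FV G).obj U) :
    evF G W ((FV G).ext h x) = evF G U x := by
  obtain ⟨x, rfl⟩ := toFV_surjective G U x
  induction x using expr_induction with
  | h0 => simp
  | hadd x y hx hy => simp only [map_add, hx, hy]
  | h m α a =>
    rw [ext_toFV_cls, evF_toFV, evF_toFV]
    ext k
    refine eq_of_dual fun φ => ?_
    rw [ev_cls, ev_cls, dual_pairing, dual_pairing, push_apply]
    exact congrArg α.1 (Subtype.ext (funext fun _ => rfl))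

lemma rho_toFV_cls (r : ℝ) (q : ℂˣ) (hq : ‖(q : ℂ)‖ < 1) {m : ℕ}
    (α : OPrime (Conf (disc 0 r : Set ℂ) (Fin m))) (a : Fin m → Tot V) :
    (FV G).rho r q hq (toFV G _ (cls _ α a)) =
      toFV G _ (cls _ (dilPush q.ne_zero hq.le α) fun i => scale V q (a i)) := by
  rw [AffPFA.rho, LinearMap.comp_apply, act_toFV_cls, ext_toFV_cls]
  congr 2
  refine OPrime.ext' fun f => congrArg α.1 (Subtype.ext (funext fun w =>
    congrArg f.1 (Subtype.ext (funext fun i => ?_))))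
  exact add_zero _

/-- Equivariance of `μ` integrated against `α`: dilating the points and scaling the labels together
multiply the degree `k` component by `q ^ k`. -/
lemma evF_rho (r : ℝ) (q : ℂˣ) (hq : ‖(q : ℂ)‖ < 1) (x : (FV G).obj (disc 0 r)) (k : ℤ) :
    evF G _ ((FV G).rho r q hq x) k = ((q ^ k : ℂˣ) : ℂ) • evF G _ x k := by
  obtain ⟨x, rfl⟩ := toFV_surjective G _ x
  induction x using expr_induction with
  | h0 => simp
  | hadd x y hx hy => simp only [map_add, Pi.add_apply, smul_add, hx, hy]
  | h m α a =>
    rw [rho_toFV_cls, evF_toFV, evF_toFV]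
    refine eq_of_dual fun φ => ?_
    rw [ev_cls, ev_cls, map_smul, dual_pairing, dual_pairing, dilPush, push_apply, ← map_smul]
    refine congrArg α.1 (Subtype.ext (funext fun w => ?_))
    refine (congrArg φ (G.equivariant m q a (toUniv w) k)).trans ?_
    rw [map_smul]
    rfl

open Classical in
/-- The map `z ↦ ρ(z) x`, extended by zero. -/
def rhoFun (F : AffPFA.{u}) (r : ℝ) (x : F.obj (disc 0 r)) (z : ℂ) : F.obj (disc 0 r) :=
  if h : z ≠ 0 ∧ ‖z‖ < 1 then F.rho r (Units.mk0 z h.1) h.2 x else 0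

lemma ne_zero_of_mem_sphere {z : ℂ} (hz : z ∈ Metric.sphere (0 : ℂ) (1 / 2)) :
    z ≠ 0 ∧ ‖z‖ < 1 := by
  rw [mem_sphere_zero_iff_norm] at hz
  exact ⟨fun h => by rw [h, norm_zero] at hz; norm_num at hz, by rw [hz]; norm_num⟩

lemma rhoFun_of_mem (F : AffPFA.{u}) (r : ℝ) (x : F.obj (disc 0 r)) {z : ℂ}
    (hz : z ∈ Metric.sphere (0 : ℂ) (1 / 2)) : ∃ q : ℂˣ, ∃ hq : ‖(q : ℂ)‖ < 1,
      (q : ℂ) = z ∧ rhoFun F r x z = F.rho r q hq x :=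
  have h := ne_zero_of_mem_sphere hz
  ⟨Units.mk0 z h.1, h.2, rfl, dif_pos h⟩

lemma wproj_eq_smul (F : AffPFA.{u}) (r : ℝ) (k : ℤ) (x : F.obj (disc 0 r)) :
    F.wproj r k x = (2 * Real.pi * Complex.I : ℂ)⁻¹ •
      circInt (F.born (disc 0 r)) fun z => z ^ (-k - 1) • rhoFun F r x z := by
  have : (fun z => z ^ (-k - 1) • rhoFun F r x z) = fun z => open Classical in
      if h : z ≠ 0 ∧ ‖z‖ < 1 then z ^ (-k - 1) • F.rho r (Units.mk0 z h.1) h.2 x else 0 := by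
    funext z
    rw [rhoFun]
    split_ifs
    · rfl
    · rw [smul_zero]
  rw [this, AffPFA.wproj]

/-! ### Existence of the contour integrals -/

lemma continuousOn_zpow_sphere (n : ℤ) :
    ContinuousOn (fun z : ℂ => z ^ n) (Metric.sphere 0 (1 / 2)) := fun z hz =>
  (continuousAt_zpow₀ z n (Or.inl fun h => by
    rw [mem_sphere_zero_iff_norm, h, norm_zero] at hz; norm_num at hz)).continuousWithinAt

lemma hasBanachLift_zero {X : Type u} [AddCommGroup X] [Module ℂ X] (b : Bornology X) :
    HasBanachLift b fun _ => 0 :=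
  ⟨PUnit, inferInstance, inferInstance, inferInstance, 0, fun _ => 0, fun T _ =>
    (bdd_singleton b 0).subset (by rintro _ ⟨y, _, rfl⟩; rfl), continuousOn_const,
    fun _ _ => rfl⟩

lemma prod_zpow_eq {z : ℂ} (hz : z ≠ 0) {ι : Type*} (s : Finset ι) (k : ι → ℤ) :
    ∏ i ∈ s, z ^ k i = z ^ ∑ i ∈ s, k i := by
  classical
  induction s using Finset.induction_on with
  | empty => simp
  | insert i s hi ih => rw [Finset.prod_insert hi, Finset.sum_insert hi, zpow_add₀ hz, ih]

/-- The elements `x` for which `ρ(z) x` is the image of a continuous family in a Banach space. -/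
def liftSubmodule (F : AffPFA.{u}) (r : ℝ) : Submodule ℂ (F.obj (disc 0 r)) where
  carrier := {x | HasBanachLift (F.born (disc 0 r)) (rhoFun F r x)}
  zero_mem' := (hasBanachLift_zero _).congr fun z _ => by
    rw [rhoFun]
    split_ifs
    · rw [map_zero]
    · rfl
  add_mem' {x y} hx hy := (HasBanachLift.add (F.isBVS _) hx hy).congr fun z _ => by
    rw [rhoFun, rhoFun, rhoFun]
    split_ifs
    · rw [map_add]
    · rw [add_zero]
  smul_mem' c x hx := (HasBanachLift.smul hx (c := fun _ => c) continuousOn_const).congr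
    fun z _ => by
      rw [rhoFun, rhoFun]
      split_ifs
      · rw [map_smul]
      · rw [smul_zero]

/-- With labels of degrees `k i`, the operator `ρ(z)` dilates `α` and multiplies the class by `z` to
the power `∑ i, k i`. The first depends continuously on `z` by `exists_dil_lift`, the second is a
continuous scalar on the circle. -/
lemma hasBanachLift_cls (r : ℝ) {m : ℕ} (α : OPrime (Conf (disc 0 r : Set ℂ) (Fin m)))
    (k : Fin m → ℤ) (v : ∀ i, V (k i)) :
    toFV G _ (cls _ α fun i => tin V (k i) (v i)) ∈ liftSubmodule (FV G) r := by
  obtain ⟨Y, _, _, _, j, g, hj, hg, hjg⟩ := exists_dil_lift α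
  let a : Fin m → Tot V := fun i => tin V (k i) (v i)
  let J : Y →ₗ[ℂ] (FV G).obj (disc 0 r) := toFV G _ ∘ₗ clsLeft (disc 0 r) a ∘ₗ j
  have hJ : ∀ T : Set Y, Bornology.IsBounded T → Bdd ((FV G).born (disc 0 r)) (J '' T) := by
    intro T hT
    have h := bddMap_toFV G (disc 0 r) _ (bddMap_clsLeft (disc 0 r) a _ (hj _ hT))
    rw [image_image, image_image] at h
    exact h
  have h1 : HasBanachLift ((FV G).born (disc 0 r)) fun z => J (g z) := by
    -- The Banach space of functionals lives in `Type`, while a lift must be in the universe of the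
    -- values.
    refine ⟨ULift.{u} Y, inferInstance, inferInstance, inferInstance,
      J ∘ₗ (ULift.moduleEquiv (R := ℂ)).toLinearMap, fun z => ⟨g z⟩, fun T hT => ?_,
      continuous_uliftUp.comp_continuousOn hg, fun _ _ => rfl⟩
    obtain ⟨C, hC⟩ := hT.exists_norm_le
    have hT' : Bornology.IsBounded (ULift.down '' T) :=
      (Metric.isBounded_closedBall (x := (0 : Y)) (r := C)).subset (by
        rintro _ ⟨y, hy, rfl⟩
        exact mem_closedBall_zero_iff.2 (hC y hy))
    have h := hJ _ hT'
    rw [image_image] at h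
    exact h
  have hJg : ∀ z ∈ Metric.sphere (0 : ℂ) (1 / 2), ∀ (h0 : z ≠ 0) (h1 : ‖z‖ ≤ 1),
      J (g z) = toFV G _ (cls _ (dilPush h0 h1 α) a) := fun z hz h0 h1 => by
    rw [← clsLeft_apply, ← hjg z hz h0 h1]
    rfl
  refine HasBanachLift.congr (h1.smul (continuousOn_zpow_sphere (∑ i, k i))) fun z hz => ?_
  obtain ⟨q, hq, rfl, e⟩ := rhoFun_of_mem (FV G) r
    (toFV G _ (cls _ α fun i => tin V (k i) (v i))) hz
  have ha : (fun i => scale V q (tin V (k i) (v i))) = fun i => (q : ℂ) ^ k i • a i := by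
    funext i
    rw [scale_tin, map_smul, Units.val_zpow_eq_zpow_val]
  rw [e, rho_toFV_cls, hJg _ hz q.ne_zero hq.le, ha, cls_smul_right, map_smul,
    prod_zpow_eq q.ne_zero]

/-- The elements admitting a lift form a subspace, and `EV` is spanned by classes with homogeneous
labels. -/
lemma hasBanachLift_rhoFun (r : ℝ) (x : (FV G).obj (disc 0 r)) :
    HasBanachLift ((FV G).born (disc 0 r)) (rhoFun (FV G) r x) := by
  obtain ⟨x, rfl⟩ := toFV_surjective G _ x
  exact mem_of_homogeneous (S := (liftSubmodule (FV G) r).comap (toFV G _))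
    (fun m α k v => hasBanachLift_cls G r α k v) x

/-! ### Weight projections and weight vectors in terms of evaluation -/

/-- This is the hypothesis under which functionals of the evaluation commute with contour integrals.
-/
lemma norm_evF_le (U : Opens ℂ) (k : ℤ) (φ : Module.Dual ℂ (V k)) (S : Set ((FV G).obj U))
    (hS : Bdd ((FV G).born U) S) : ∃ C, ∀ x ∈ S, ‖φ (evF G U x k)‖ ≤ C := by
  obtain ⟨C, hC⟩ := bddMap_discrete_norm φ (bddMap_evF G U k S hS)
  exact ⟨C, fun x hx => hC _ (mem_image_of_mem _ hx)⟩

lemma integral_zpow_half (n : ℤ) : circleIntegral (fun z : ℂ => z ^ n) 0 (1 / 2) =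
    if n = -1 then 2 * Real.pi * Complex.I else 0 := by
  split_ifs with h
  · subst h
    simpa using circleIntegral.integral_sub_center_inv 0 (R := 1 / 2) (by norm_num)
  · simpa using circleIntegral.integral_sub_zpow_of_ne h 0 0 (1 / 2)

/-- In degree `l`, `ρ(z)` is multiplication by `z ^ l`, so after a functional the integrand is `z ^
(l - k - 1)` times a constant. The integral is nonzero only for `l = k`, where the prefactor
normalizes it to 1. -/
lemma evF_wproj (r : ℝ) (k l : ℤ) (x : (FV G).obj (disc 0 r)) :
    evF G _ ((FV G).wproj r k x) l = if l = k then evF G _ x l else 0 := by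
  refine eq_of_dual fun φ => ?_
  obtain ⟨Φ, hΦ⟩ : ∃ Φ : Module.Dual ℂ ((FV G).obj (disc 0 r)), ∀ y, Φ y = φ (evF G _ y l) :=
    ⟨φ ∘ₗ LinearMap.proj l ∘ₗ evF G (disc 0 r), fun _ => rfl⟩
  have h2 := ((hasBanachLift_rhoFun G r x).smul
    (continuousOn_zpow_sphere (-k - 1))).hasCircleIntegral.apply Φ fun S hS => by
      simp only [hΦ]
      exact norm_evF_le G _ l φ S hS
  have h3 : circleIntegral (fun z => Φ (z ^ (-k - 1) • rhoFun (FV G) r x z)) 0 (1 / 2) =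
      circleIntegral (fun z => z ^ (l - k - 1) * φ (evF G _ x l)) 0 (1 / 2) := by
    refine circleIntegral.integral_congr (by norm_num) fun z hz => ?_
    obtain ⟨q, hq, rfl, e⟩ := rhoFun_of_mem (FV G) r x hz
    have e2 : (q : ℂ) ^ (l - k - 1) = (q : ℂ) ^ (-k - 1) * (q : ℂ) ^ l := by
      rw [← zpow_add₀ q.ne_zero]
      congr 1
      ring
    rw [e, map_smul, hΦ, evF_rho, map_smul, Units.val_zpow_eq_zpow_val, smul_eq_mul, smul_eq_mul,
      e2, mul_assoc]
  have h4 : circleIntegral (fun z => z ^ (l - k - 1) * φ (evF G _ x l)) 0 (1 / 2) =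
      circleIntegral (fun z : ℂ => z ^ (l - k - 1)) 0 (1 / 2) * φ (evF G _ x l) := by
    simp only [circleIntegral, smul_eq_mul, ← mul_assoc]
    exact intervalIntegral.integral_mul_const _ _
  rw [h3, h4, integral_zpow_half] at h2
  rw [← hΦ, wproj_eq_smul, map_smul, h2, smul_eq_mul]
  have h6 : (2 * Real.pi * Complex.I : ℂ) ≠ 0 := Complex.two_pi_I_ne_zero
  by_cases hlk : l = k
  · rw [if_pos hlk, if_pos (by omega), ← mul_assoc, inv_mul_cancel₀ h6, one_mul]
  · rw [if_neg hlk, if_neg (by omega), zero_mul, mul_zero, map_zero]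

/-- Pairing with `δ_0` is evaluation of `μ(a)` at the point 0, which is `a` by insertion at zero. -/
lemma evF_deltaClass (r : {r : ℝ // 0 < r}) (k l : ℤ) (a : V k) :
    evF G _ (deltaClass G r k a) l = tin V k a l := by
  change evF G _ (toFV G _ (cls _ (delta (originConf r)) fun _ => tin V k a)) l = _
  rw [evF_toFV, ← G.insertion (tin V k a) l]
  refine eq_of_dual fun φ => ?_
  rw [ev_cls, dual_pairing]
  rfl

lemma tin_apply (k l : ℤ) (a : V k) : tin V k a l = if h : k = l then h ▸ a else 0 := by
  split_ifs with h
  · subst h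
    exact DirectSum.lof_apply ℂ k a
  · exact DFinsupp.single_eq_of_ne (Ne.symm h)

/-- Both sides have the same evaluation, and evaluation is injective on discs. The surjectivity of
`I` rests on this. -/
lemma eq_deltaClass (r : {r : ℝ // 0 < r}) (k : ℤ) (x : (FV G).obj (disc 0 r))
    (h : ∀ l, l ≠ k → evF G _ x l = 0) : x = deltaClass G r k (evF G _ x k) := by
  refine evF_injective G (isDisc_disc 0 r.2) (funext fun l => ?_)
  rw [evF_deltaClass, tin_apply]
  split_ifs with hl
  · subst hl; rfl
  · exact h l (Ne.symm hl)

lemma wproj_eq (r : {r : ℝ // 0 < r}) (k : ℤ) (x : (FV G).obj (disc 0 r)) :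
    (FV G).wproj r k x = deltaClass G r k (evF G _ x k) := by
  have := eq_deltaClass G r k ((FV G).wproj r k x) fun l hl => by rw [evF_wproj, if_neg hl]
  rwa [evF_wproj, if_pos rfl] at this

lemma rho_proj {F : AffPFA.{u}} {k : ℤ} (x : F.VF k) (r : {r : ℝ // 0 < r}) (q : ℂˣ)
    (hq : ‖(q : ℂ)‖ < 1) : F.rho r q hq (F.proj r k x) = ((q ^ k : ℂˣ) : ℂ) • F.proj r k x :=
  x.2 q hq r

lemma ext_proj {F : AffPFA.{u}} {k : ℤ} (x : F.VF k) (r s : {r : ℝ // 0 < r})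
    (h : (r : ℝ) ≤ s) : F.ext (disc_mono 0 h) (F.proj r k x) = F.proj s k x :=
  x.1.2 r s h

/-- The operator `ρ(q)` multiplies the degree `l` evaluation by `q ^ l` and the weight vector by `q
^ k`, so `(q ^ k - q ^ l)` kills that evaluation. For `|q| = 1/2` the absolute values of distinct
powers already differ. -/
lemma evF_of_weightSpace {k : ℤ} (x : (FV G).VF k) (r : {r : ℝ // 0 < r}) {l : ℤ} (hl : l ≠ k) :
    evF G _ ((FV G).proj r k x) l = 0 := by
  obtain ⟨q, hq⟩ : ∃ q : ℂˣ, ‖(q : ℂ)‖ = 1 / 2 :=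
    ⟨Units.mk0 (1 / 2) (by norm_num), by rw [Units.val_mk0]; norm_num⟩
  have h3 := evF_rho G r q (by rw [hq]; norm_num) ((FV G).proj r k x) l
  rw [rho_proj, map_smul, Pi.smul_apply, ← sub_eq_zero, ← sub_smul, smul_eq_zero] at h3
  refine h3.resolve_left fun h4 => hl ?_
  rw [sub_eq_zero, Units.val_zpow_eq_zpow_val, Units.val_zpow_eq_zpow_val] at h4
  have h5 := congrArg norm h4
  rw [norm_zpow, norm_zpow, hq] at h5
  exact (zpow_right_injective₀ (by norm_num) (by norm_num) h5).symm

lemma proj_compI (r : {r : ℝ // 0 < r}) (k : ℤ) (a : V k) :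
    (FV G).proj r k (compI G k a) = deltaClass G r k a := rfl

lemma evF_proj_eq {k : ℤ} (x : (FV G).VF k) (r s : {r : ℝ // 0 < r}) :
    evF G _ ((FV G).proj r k x) = evF G _ ((FV G).proj s k x) := by
  have key : ∀ (r s : {r : ℝ // 0 < r}), (r : ℝ) ≤ s →
      evF G _ ((FV G).proj r k x) = evF G _ ((FV G).proj s k x) := by
    intro r s h
    rw [← ext_proj x r s h, evF_ext]
  rcases le_total (r : ℝ) s with h | h
  · exact key r s h
  · exact (key s r h).symm

/-- The inverse of the comparison map. -/
def compInv (k : ℤ) : (FV G).VF k →ₗ[ℂ] V k :=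
  -- The radius 1 is arbitrary: by `evF_proj_eq` every radius gives the same evaluation.
  LinearMap.proj k ∘ₗ evF G _ ∘ₗ (FV G).proj ⟨1, one_pos⟩ k

lemma compInv_compI (k : ℤ) (a : V k) : compInv G k (compI G k a) = a := by
  change evF G _ (deltaClass G ⟨1, one_pos⟩ k a) k = a
  rw [evF_deltaClass, tin_apply, dif_pos rfl]

lemma compI_compInv (k : ℤ) (x : (FV G).VF k) : compI G k (compInv G k x) = x := by
  refine Subtype.ext (Subtype.ext (funext fun r => ?_))
  have h := eq_deltaClass G r k ((FV G).proj r k x) fun l hl => evF_of_weightSpace G x r hl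
  rw [evF_proj_eq G x r ⟨1, one_pos⟩] at h
  exact h.symm

/-- The comparison map as a linear equivalence. -/
def compEquiv (k : ℤ) : V k ≃ₗ[ℂ] (FV G).VF k :=
  LinearEquiv.ofLinearMap (compI G k) (compInv G k)
    (LinearMap.ext (compI_compInv G k)) (LinearMap.ext (compInv_compI G k))

lemma compI_bijective (k : ℤ) : Function.Bijective (compI G k) := (compEquiv G k).bijective

/-- The degree `k` evaluation at any single radius recovers the element. Injectivity is what makes
`Function.invFun` in the definition of `L` a genuine inverse on the image of `π_R`. -/
lemma proj_injective (r : {r : ℝ // 0 < r}) (k : ℤ) :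
    Function.Injective ((FV G).proj r k) := by
  intro x y h
  rw [← compI_compInv G k x, ← compI_compInv G k y]
  refine congrArg _ ?_
  change evF G _ ((FV G).proj _ k x) k = evF G _ ((FV G).proj _ k y) k
  rw [evF_proj_eq G x _ r, evF_proj_eq G y _ r, h]

/-- The weight projection of `x` is `π_R` applied to `I` of its degree `k` evaluation, so inverting
`π_R` is legitimate. From here on the contour integral no longer appears. -/
lemma L_eq (R : {r : ℝ // 0 < r}) (k : ℤ) (x : (FV G).obj (disc 0 R)) :
    (FV G).L R k x = compI G k (evF G _ x k) := by
  unfold AffPFA.L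
  rw [wproj_eq, ← proj_compI]
  exact Function.leftInverse_invFun (proj_injective G R k) _

/-! ### The bornology of the weight spaces -/

/-- The subspace and product bornologies are initial, so boundedness is tested at each radius
separately. -/
lemma bdd_bornVF {F : AffPFA.{u}} {k : ℤ} {S : Set (F.VF k)} : Bdd (F.bornVF k) S ↔
    ∀ r : {r : ℝ // 0 < r}, Bdd (F.born (disc 0 r)) (F.proj r k '' S) := by
  let _ := fun r : {r : ℝ // 0 < r} => F.born (disc 0 r)
  let _ := F.costalkBorn
  refine (Bornology.isBounded_induced (f := (Subtype.val : F.weightSpace k → F.costalk))).trans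
    ((Bornology.isBounded_induced (f := (Subtype.val : F.costalk → _))).trans
      (Bornology.forall_isBounded_image_eval_iff.symm.trans (forall_congr' fun r => ?_)))
  refine iff_of_eq (congrArg (Bdd (F.born (disc 0 r))) ?_)
  exact (image_image (Function.eval r) Subtype.val _).trans
    (image_image _ (Subtype.val : F.weightSpace k → F.costalk) S)

/-- A bounded set of weight vectors evaluates to a bounded set of the discrete space `V k`, and `I`
carries it back; radius 1 alone suffices. Conversely each `π_r` is bounded on discrete sets, as is
any linear map. -/
lemma bornVF_eq (k : ℤ) : (FV G).bornVF k = discreteBorn ((FV G).VF k) := by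
  refine bornology_ext fun S => ⟨fun hS => ?_, fun hS => bdd_bornVF.2 fun r =>
    bddMap_of_discrete ((FV G).isBVS _) _ S hS⟩
  have h1 := bddMap_discrete (compI G k) _
    (bddMap_evF G _ k _ (bdd_bornVF.1 hS ⟨1, one_pos⟩))
  refine h1.subset fun x hx => ⟨_, ⟨_, ⟨x, hx, rfl⟩, rfl⟩, compI_compInv G k x⟩

lemma hasDiscreteWeightSpaces_FV : (FV G).HasDiscreteWeightSpaces := bornVF_eq G

end WeightSpaces

/-! ### The multiplication maps of `VFV` -/

section Multiplication

variable {V : ℤ → Type u} [∀ k, AddCommGroup (V k)] [∀ k, Module ℂ (V k)] (G : GVA V)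

/-- The first point followed by the other ones. -/
def consEquiv (m : ℕ) : Fin 1 ⊕ Fin m ≃ Fin (m + 1) :=
  -- The sum is enumerated by `Fin (1 + m)`, while the recursion defining `mmul` uses `Fin (m + 1)`.
  finSumFinEquiv.trans (finCongr (Nat.add_comm 1 m))

lemma consEquiv_symm_zero (m : ℕ) : (consEquiv m).symm 0 = Sum.inl 0 :=
  (Equiv.symm_apply_eq _).2 (Fin.ext rfl)

lemma consEquiv_symm_succ (m : ℕ) (i : Fin m) : (consEquiv m).symm i.succ = Sum.inr i :=
  (Equiv.symm_apply_eq _).2 (Fin.ext (Nat.add_comm _ _))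

/-- The product of two point evaluations is evaluation at the joined configuration. The form with
one point split off in front matches the recursion of `mmul`. -/
lemma exprMul_delta {U U' W : Opens ℂ} (h : Disjoint U U') (hU : U ≤ W) (hU' : U' ≤ W)
    {M : Type u} [AddCommGroup M] [Module ℂ M] {m : ℕ} (z : Conf (W : Set ℂ) (Fin (m + 1)))
    (x : Conf (U : Set ℂ) (Fin 1)) (y : Conf (U' : Set ℂ) (Fin m))
    (hx : x.1 0 = z.1 0) (hy : ∀ i, y.1 i = z.1 i.succ) (a : Fin (m + 1) → M) :
    exprMul h hU hU' (cls U (delta x) fun _ => a 0) (cls U' (delta y) fun i => a i.succ) =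
      cls W (delta z) a := by
  have h1 : reix W (consEquiv m) (mulFun h hU hU' (delta x) (delta y) ⊗ₜ
      tprod (Sum.elim (fun _ => a 0) fun i => a i.succ)) = delta z ⊗ₜ tprod a := by
    rw [reix_tmul]
    congr 1
    · refine OPrime.ext' fun f => congrArg f.1 (Subtype.ext (funext fun i => ?_))
      refine Fin.cases ?_ (fun i => ?_) i
      · change Sum.elim x.1 y.1 ((consEquiv m).symm 0) = _
        rw [consEquiv_symm_zero]
        exact hx
      · change Sum.elim x.1 y.1 ((consEquiv m).symm i.succ) = _
        rw [consEquiv_symm_succ]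
        exact hy i
    · refine tprod_congr fun i => ?_
      refine Fin.cases ?_ (fun i => ?_) i
      · rw [consEquiv_symm_zero]
        rfl
      · rw [consEquiv_symm_succ]
        rfl
  rw [cls, cls, exprMul_mkE _ _ _ _ _ (consEquiv m), preMul_tmul, cls, ← h1, mkE_reix]
  exact mkE_eq _ _ _ _

lemma mul_toFV {U U' W : Opens ℂ} (h : Disjoint U U') (hU : U ≤ W) (hU' : U' ≤ W)
    (x : Expr (Tot V) U) (y : Expr (Tot V) U') :
    (FV G).mul h hU hU' (toFV G U x) (toFV G U' y) = toFV G W (exprMul h hU hU' x y) := rfl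

lemma one_FV : (FV G).one = toFV G ⊥ (exprOne (Tot V) ⊥) := rfl

lemma totMap_tin {V' : ℤ → Type u} [∀ k, AddCommGroup (V' k)] [∀ k, Module ℂ (V' k)]
    (f : ∀ k, V k →ₗ[ℂ] V' k) (k : ℤ) (a : V k) :
    totMap f (tin V k a) = tin V' k (f k a) :=
  DFinsupp.mapRange_single (f := fun k => f k) (hf := fun k => map_zero (f k))

/-- The linear map `a ↦ [α ⊗ a]` on all of `⨁ₖ V k`. -/
def clsTot (U : Opens ℂ) (α : OPrime (Conf (U : Set ℂ) (Fin 1))) : Tot V →ₗ[ℂ] Expr (Tot V) U :=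
  (clsRight U α).toLinearMap (fun _ => 0) 0

lemma clsTot_apply (U : Opens ℂ) (α : OPrime (Conf (U : Set ℂ) (Fin 1))) (a : Tot V) :
    clsTot U α a = cls U α fun _ => a := by
  refine congrArg (cls U α) (funext fun i => ?_)
  rw [Subsingleton.elim i 0, Function.update_self]

lemma P_tin {F : AffPFA.{u}} (r : {r : ℝ // 0 < r}) (k : ℤ) (x : F.VF k) :
    F.P r (tin F.VF k x) = F.proj r k x :=
  DirectSum.toModule_lof ℂ k x

lemma deltaClass_eq (r : {r : ℝ // 0 < r}) (k : ℤ) (a : V k) :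
    deltaClass G r k a = toFV G _ (cls _ (delta (originConf r)) fun _ => tin V k a) := rfl

/-- Both sides are linear in `a`, and on homogeneous elements the identity is the definition of `I`.
-/
lemma P_totMap_compI (r : {r : ℝ // 0 < r}) (a : Tot V) :
    (FV G).P r (totMap (compI G) a) = toFV G _ (cls _ (delta (originConf r)) fun _ => a) := by
  have : (FV G).P r ∘ₗ totMap (compI G) =
      toFV G _ ∘ₗ clsTot (disc 0 r) (delta (originConf r)) := by
    refine DirectSum.linearMap_ext ℂ fun k => LinearMap.ext fun a => ?_
    change (FV G).P r (totMap (compI G) (tin V k a)) =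
      toFV G _ (clsTot (disc 0 r) (delta (originConf r)) (tin V k a))
    rw [totMap_tin, P_tin, proj_compI, clsTot_apply, deltaClass_eq]
  rw [← clsTot_apply]
  exact LinearMap.congr_fun this a

/-- The center of a disc as a configuration. -/
def centerConf (z : ℂ) (r : {r : ℝ // 0 < r}) : Conf (disc z r : Set ℂ) (Fin 1) :=
  ⟨fun _ => z, fun _ => Metric.mem_ball_self r.2, fun _ _ _ => Subsingleton.elim _ _⟩

/-- Translation moves `δ_0` to `δ_z` and, having linear part 1, leaves the label unchanged. -/
lemma place_totMap_compI (z : ℂ) (r : {r : ℝ // 0 < r}) (a : Tot V) :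
    (FV G).place z r (totMap (compI G) a) =
      toFV G _ (cls _ (delta (centerConf z r)) fun _ => a) := by
  rw [AffPFA.place, P_totMap_compI, act_toFV_cls, ext_toFV_cls]
  congr 2
  · refine OPrime.ext' fun f => congrArg f.1 (Subtype.ext (funext fun i => ?_))
    change ((1 : ℂˣ) : ℂ) * 0 + z = z
    simp
  · exact funext fun _ => scale_one a

/-- Only the centers of the discs matter: each factor is a point evaluation, and such classes
multiply to the evaluation at the whole configuration. -/
lemma mmul_place (m : ℕ) (z : Fin m → ℂ) (r : Fin m → {r : ℝ // 0 < r}) (W : Opens ℂ)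
    (hd : ∀ i j, i ≠ j → Disjoint (disc (z i) (r i)) (disc (z j) (r j)))
    (hW : ∀ i, disc (z i) (r i) ≤ W) (x : Conf (W : Set ℂ) (Fin m)) (hx : ∀ i, x.1 i = z i)
    (a : Fin m → Tot V) :
    (FV G).mmul m (fun i => disc (z i) (r i)) W hd hW
      (fun i => (FV G).place (z i) (r i) (totMap (compI G) (a i))) =
        toFV G W (cls W (delta x) a) := by
  -- The target varies because `mmul` first multiplies the later factors inside the union of their
  -- discs.
  induction m generalizing W with
  | zero =>
    rw [AffPFA.mmul, one_FV, exprOne, ext_toFV_cls]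
    congr 2
    · exact OPrime.ext' fun f => congrArg f.1 (Subtype.ext (funext fun i => i.elim0))
    · exact funext fun i => i.elim0
  | succ m ih =>
    have hy : ∀ i : Fin m, z i.succ ∈ ((⨆ i : Fin m, disc (z i.succ) (r i.succ) : Opens ℂ) :
        Set ℂ) := fun i => le_iSup (fun i : Fin m => disc (z i.succ) (r i.succ)) i
      (Metric.mem_ball_self (r i.succ).2)
    have hinj : Function.Injective fun i : Fin m => z i.succ := fun i j h => by
      refine Fin.succ_injective m (x.2.2 ?_)
      rw [hx, hx]
      exact h
    rw [AffPFA.mmul, ih (fun i => z i.succ) (fun i => r i.succ) _ _ _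
      ⟨fun i => z i.succ, hy, hinj⟩ (fun _ => rfl) fun i => a i.succ, place_totMap_compI, mul_toFV,
      exprMul_delta _ _ _ x _ _ (hx 0).symm fun i => (hx i.succ).symm]

lemma evF_cls_delta {W : Opens ℂ} {m : ℕ} (x : Conf (W : Set ℂ) (Fin m)) (a : Fin m → Tot V)
    (k : ℤ) : evF G W (toFV G W (cls W (delta x) a)) k = G.mu m a (toUniv x) k := by
  rw [evF_toFV]
  refine eq_of_dual fun φ => ?_
  rw [ev_cls, dual_pairing]
  rfl

/-- The product of the inserted classes is `[δ_z ⊗ a]`, and `L^R` returns `I` of its evaluation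
`μ(a)(z)`. Since the right-hand side contains no radii, neither their choice nor that of `R`
matters. -/
lemma muRad_compI {m : ℕ} (a : Fin m → Tot V) (z : Conf (univ : Set ℂ) (Fin m))
    {r : Fin m → ℝ} {R : ℝ} (h : Admissible z.1 r R) (k : ℤ) :
    (FV G).muRad h (fun i => totMap (compI G) (a i)) k = compI G k (G.mu m a z k) := by
  rw [AffPFA.muRad, L_eq, mmul_place G m z.1 (fun i => ⟨r i, h.pos i⟩) _ h.disj h.le
    ⟨z.1, fun i => h.le i (Metric.mem_ball_self (h.pos i)), z.2.2⟩ fun _ => rfl, evF_cls_delta]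
  rfl

lemma mu_compI {m : ℕ} (a : Fin m → Tot V) (z : Conf (univ : Set ℂ) (Fin m)) (k : ℤ) :
    (FV G).mu m (fun i => totMap (compI G) (a i)) z k = compI G k (G.mu m a z k) :=
  muRad_compI G a z _ k

end Multiplication

/-! ### Transport of structure -/

section Transport

lemma HolFD.map {E W W' : Type*} [NormedAddCommGroup E] [NormedSpace ℂ E] [AddCommGroup W]
    [Module ℂ W] [AddCommGroup W'] [Module ℂ W'] {X : Set E} {f : X → W} (hf : HolFD f)
    (g : W →ₗ[ℂ] W') : HolFD fun x => g (f x) := by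
  obtain ⟨S, hS, hfS, h⟩ := hf
  exact ⟨S.map g, inferInstance, fun x => Submodule.mem_map_of_mem (hfS x), fun φ => h (φ ∘ₗ g)⟩

variable {V V' : ℤ → Type u} [∀ k, AddCommGroup (V k)] [∀ k, Module ℂ (V k)]
  [∀ k, AddCommGroup (V' k)] [∀ k, Module ℂ (V' k)]

lemma totMap_apply (f : ∀ k, V k →ₗ[ℂ] V' k) (a : Tot V) (k : ℤ) :
    totMap f a k = f k (a k) := rfl

lemma totMap_scale (f : ∀ k, V k →ₗ[ℂ] V' k) (lam : ℂˣ) (a : Tot V) :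
    totMap f (scale V lam a) = scale V' lam (totMap f a) :=
  DFinsupp.ext fun k => by
    rw [totMap_apply, scale_apply, scale_apply, map_smul, totMap_apply]

lemma totMap_symm (e : ∀ k, V k ≃ₗ[ℂ] V' k) (a : Tot V') :
    totMap (fun k => (e k).toLinearMap) (totMap (fun k => (e k).symm.toLinearMap) a) = a :=
  DFinsupp.ext fun k => (e k).apply_symm_apply (a k)

lemma totMap_symm' (e : ∀ k, V k ≃ₗ[ℂ] V' k) (a : Tot V) :
    totMap (fun k => (e k).symm.toLinearMap) (totMap (fun k => (e k).toLinearMap) a) = a :=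
  DFinsupp.ext fun k => (e k).symm_apply_apply (a k)

/-- Postcomposition with linear maps in each degree. -/
def postComp (f : ∀ k, V k →ₗ[ℂ] V' k) (X : Type*) : (X → ∀ k, V k) →ₗ[ℂ] X → ∀ k, V' k where
  toFun g x k := f k (g x k)
  map_add' _ _ := funext fun _ => funext fun k => map_add (f k) _ _
  map_smul' _ _ := funext fun _ => funext fun k => map_smul (f k) _ _

/-- Multiplication maps transported along linear equivalences in each degree. -/
def transportMu (mu : MultData V) (e : ∀ k, V k ≃ₗ[ℂ] V' k) : MultData V' := fun m =>
  (postComp (fun k => (e k).toLinearMap) _).compMultilinearMap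
    ((mu m).compLinearMap fun _ => totMap fun k => (e k).symm.toLinearMap)

variable (mu : MultData V) (e : ∀ k, V k ≃ₗ[ℂ] V' k)

lemma transportMu_apply (m : ℕ) (a : Fin m → Tot V') (z : Conf (univ : Set ℂ) (Fin m)) (k : ℤ) :
    transportMu mu e m a z k =
      e k (mu m (fun i => totMap (fun k => (e k).symm.toLinearMap) (a i)) z k) := rfl

/-- The map `e k` applied to the inner product meets its inverse in the argument of the outer one
and cancels; only the outermost `e l` remains. -/
lemma assocTerm_transport {m n : ℕ} (a : Fin m → Tot V') (b : Fin n → Tot V') (k : ℤ)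
    (p : assocSet m n) (l : ℤ) :
    assocTerm (transportMu mu e) a b k p l =
      e l (assocTerm mu (fun i => totMap (fun k => (e k).symm.toLinearMap) (a i))
        (fun i => totMap (fun k => (e k).symm.toLinearMap) (b i)) k p l) := by
  rw [assocTerm, assocTerm, transportMu_apply, transportMu_apply]
  refine congrArg (fun c => e l (mu (m + 1) c ⟨p.1.1, p.2.1⟩ l)) (funext fun i => ?_)
  refine Fin.lastCases ?_ (fun i => ?_) i
  · rw [Fin.snoc_last, Fin.snoc_last, totMap_tin]
    exact congrArg _ ((e k).symm_apply_apply _)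
  · rw [Fin.snoc_castSucc, Fin.snoc_castSucc]

lemma append_comp {X Y : Type*} (f : X → Y) {m n : ℕ} (a : Fin m → X) (b : Fin n → X) :
    (fun i => f (Fin.append a b i)) = Fin.append (fun i => f (a i)) fun i => f (b i) := by
  funext i
  refine Fin.addCases (fun i => ?_) (fun i => ?_) i
  · rw [Fin.append_left, Fin.append_left]
  · rw [Fin.append_right, Fin.append_right]

/-- A functional on `V' l` is pulled back along `e l`, so the same dominating series works, and the
finite-dimensional subspace is replaced by its image. -/
lemma isAssoc_transport (h : IsAssoc mu) : IsAssoc (transportMu mu e) := by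
  intro m n a b l K hK hKc
  obtain ⟨⟨S, hS, h1⟩, h2⟩ := h m n (fun i => totMap (fun k => (e k).symm.toLinearMap) (a i))
    (fun i => totMap (fun k => (e k).symm.toLinearMap) (b i)) l K hK hKc
  refine ⟨⟨S.map (e l).toLinearMap, inferInstance, fun k p hp => ?_⟩, fun φ => ?_⟩
  · rw [assocTerm_transport]
    exact Submodule.mem_map_of_mem (h1 k p hp)
  · obtain ⟨u, hu, h3, h4⟩ := h2 (φ ∘ₗ (e l).toLinearMap)
    refine ⟨u, hu, fun k p hp => ?_, fun p hp => ?_⟩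
    · rw [assocTerm_transport]
      exact h3 k p hp
    · simp only [assocTerm_transport, transportMu_apply, append_comp]
      exact h4 p hp

/-- The pole order `N` is that of the elements corresponding to `a` and `b`; the holomorphic
extensions are composed with `e k`. -/
lemma isMeromorphic_transport (h : IsMeromorphic fun m => mu m) :
    IsMeromorphic fun m => transportMu mu e m := by
  intro a b
  obtain ⟨N, hN⟩ := h (totMap (fun k => (e k).symm.toLinearMap) a)
    (totMap (fun k => (e k).symm.toLinearMap) b)
  refine ⟨N, fun k => ?_⟩
  obtain ⟨f, hf, hfz⟩ := hN k
  refine ⟨_, hf.map (e k).toLinearMap, fun z => ?_⟩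
  beta_reduce
  rw [hfz, map_smul, transportMu_apply]
  have : (fun i => totMap (fun k => (e k).symm.toLinearMap) (![a, b] i)) =
      ![totMap (fun k => (e k).symm.toLinearMap) a,
        totMap (fun k => (e k).symm.toLinearMap) b] := by
    funext i
    fin_cases i <;> rfl
  rw [this]
  rfl

/-- Transport of geometric vertex algebras along linear equivalences in each degree. -/
def GVA.transport (G : GVA V) (e : ∀ k, V k ≃ₗ[ℂ] V' k) : GVA V' where
  mu := transportMu G.mu e
  holo m a k := (G.holo m _ k).map (e k).toLinearMap
  perm m s a z := funext fun k => congrArg (e k) (congrFun (G.perm m s (fun i => totMap _ (a i)) z) k)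
  insertion a k := by
    rw [transportMu_apply, G.insertion]
    exact (e k).apply_symm_apply (a k)
  equivariant m lam a z k := by
    simp only [transportMu_apply, totMap_scale]
    rw [G.equivariant, map_smul]
  assoc := isAssoc_transport G.mu e G.assoc
  merom := isMeromorphic_transport G.mu e G.merom

lemma GVA.transport_mu (G : GVA V) (e : ∀ k, V k ≃ₗ[ℂ] V' k) :
    (G.transport e).mu = transportMu G.mu e := rfl

end Transport

/-! ### The vertex algebra `VFV` -/

section VertexAlgebra

variable {V : ℤ → Type u} [∀ k, AddCommGroup (V k)] [∀ k, Module ℂ (V k)] (G : GVA V)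

/-- Every argument is `I` of something, and on such arguments `mu_compI` computes the
multiplication. Hence the axioms hold for the multiplication maps of `VFV` without being checked on
the prefactorization algebra. -/
lemma transport_mu_eq (m : ℕ) (a : Fin m → Tot (FV G).VF) (z : Conf (univ : Set ℂ) (Fin m)) :
    (G.transport (compEquiv G)).mu m a z = (FV G).mu m a z := by
  have ha : a = fun i => totMap (compI G)
      (totMap (fun k => (compEquiv G k).symm.toLinearMap) (a i)) :=
    funext fun i => (totMap_symm (compEquiv G) (a i)).symm
  funext k
  conv_rhs => rw [ha]
  rw [mu_compI, GVA.transport_mu, transportMu_apply]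
  rfl

lemma isIso_transport : G.IsIso (G.transport (compEquiv G)) (compI G) :=
  ⟨compI_bijective G, fun m a z k => by rw [transport_mu_eq, mu_compI]⟩

lemma hasMeromorphicOPE_FV : (FV G).HasMeromorphicOPE := by
  refine ⟨hasDiscreteWeightSpaces_FV G, ?_⟩
  have h : (fun m a z => (G.transport (compEquiv G)).mu m a z) = (FV G).mu :=
    funext fun m => funext fun a => funext fun z => transport_mu_eq G m a z
  rw [← h]
  exact (G.transport (compEquiv G)).merom

lemma totMap_compI_bijective : Function.Bijective (totMap (compI G)) :=
  Function.bijective_iff_has_inverse.2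
    ⟨_, totMap_symm' (compEquiv G), totMap_symm (compEquiv G)⟩

lemma sumBorn_bornVF :
    sumBorn (FV G).bornVF = discreteBorn (Tot (FV G).VF) := by
  rw [show (FV G).bornVF = fun k => discreteBorn ((FV G).VF k) from funext (bornVF_eq G)]
  exact sumBorn_discrete

end VertexAlgebra

end

end FactVA

theorem mainTheorem5 {V : ℤ → Type u} [∀ k, AddCommGroup (V k)] [∀ k, Module ℂ (V k)]
    (G : GVA V) :
    -- `I` is an isomorphism of graded complete bornological spaces
    ((∀ k, IsCompleteBVS ((FV G).bornVF k)) ∧ IsCompleteBVS (sumBorn (FV G).bornVF) ∧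
      (∀ k, IsBornIso (discreteBorn (V k)) ((FV G).bornVF k) (compI G k)) ∧
      IsBornIso (sumBorn fun k => discreteBorn (V k)) (sumBorn (FV G).bornVF)
        (totMap (compI G))) ∧
    -- `I` intertwines the multiplication maps, whichever radii are used to compute those of `VFV`
    ((∀ (m : ℕ) (a : Fin m → Tot V) (z : Conf (Set.univ : Set ℂ) (Fin m)) (r : Fin m → ℝ) (R : ℝ)
        (h : Admissible z.1 r R) (k : ℤ),
        (FV G).muRad h (fun i => totMap (compI G) (a i)) k = compI G k (G.mu m a z k)) ∧
      ∀ (m : ℕ) (a : Fin m → Tot V) (z : Conf (Set.univ : Set ℂ) (Fin m)) (k : ℤ),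
        (FV G).mu m (fun i => totMap (compI G) (a i)) z k = compI G k (G.mu m a z k)) ∧
    (FV G).HasDiscreteWeightSpaces ∧ (FV G).HasMeromorphicOPE ∧
    -- `VFV` with its multiplication maps is a geometric vertex algebra, and `I` an isomorphism
    ∃ W : GVA (FV G).VF,
      (∀ (m : ℕ) (a : Fin m → Tot (FV G).VF) (z : Conf (Set.univ : Set ℂ) (Fin m)),
        W.mu m a z = (FV G).mu m a z) ∧
      G.IsIso W (compI G) := by
  -- The remaining goals are bornological and become statements about discrete spaces.
  refine ⟨⟨fun k => ?_, ?_, fun k => ?_, ?_⟩, ⟨fun m a z r R h k => muRad_compI G a z h k,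
    fun m a z k => mu_compI G a z k⟩, hasDiscreteWeightSpaces_FV G, hasMeromorphicOPE_FV G,
    G.transport (compEquiv G), transport_mu_eq G, isIso_transport G⟩
  · rw [bornVF_eq]
    exact isCompleteBVS_discrete
  · rw [sumBorn_bornVF]
    exact isCompleteBVS_discrete
  · rw [bornVF_eq]
    exact isBornIso_discrete (compI_bijective G k)
  -- Both direct sums are discrete, so bijectivity of `I` on them is enough.
  · rw [sumBorn_bornVF, sumBorn_discrete]
    exact isBornIso_discrete (totMap_compI_bijective G)
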